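/- **Setting.** Let $n\ge 1$, $s\in(0,1)$ and $1<\lambda\le\Lambda<\infty$. Call $g:\mathbb R\to\mathbb R$ admissible if it is odd and if on $[0,\infty)$ it is right continuous, $g(0)=0$, $g(t)>0$ for $t>0$, $g$ is nondecreasing, $g(t)\to\infty$ as $t\to\infty$, $g$ is absolutely continuous on bounded intervals with $$\lambda\le \frac{t\,g'(t)}{g(t)}\le\Lambda\quad\text{for a.e. }t>0,$$ and $g$ is convex on $(0,\infty)$. Let $G(t)=\int_0^{|t|}g(\tau)\,d\tau$, let $g^{-1}$ be the inverse of $g:[0,\infty)\to[0,\infty)$, and put $p^-=\lambda+1$, $p^+=\Lambda+1$. Write $d\mu=|x-y|^{-n}dx\,dy$ on $\mathbb R^n\times\mathbb R^n$, $D_su(x,y)=\frac{u(x)-u(y)}{|x-y|^s}$ and $B_R=\{x\in\mathbb R^n:|x|<R\}$. For open $U\subseteq\mathbb R^n$, $W^{s,G}(U)$ is the set of measurable $u$ with $\int_U G(u)\,dx<\infty$ and $\iint_{U\times U}G(D_su)\,d\mu<\infty$. Its norm is $\|u\|_{s,G,U}=\inf\{k>0:\int_U G(u/k)\,dx\le1\}+\inf\{k>0:\iint_{U\times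 U}G(D_su/k)\,d\mu\le1\}$. For bounded open $\Omega$, $W^{s,G}_0(\Omega)$ is the set of $\varphi\in W^{s,G}(\mathbb R^n)$ with $\varphi=0$ a.e. outside $\Omega$, and $\widetilde W^{s,G}(\Omega)$ is the set of measurable $u:\mathbb R^n\to\mathbb R$ with $\int_A G(u)\,dx<\infty$ for every compact $A$ for which there is an open $U\supset\overline\Omega$ with $$\|u\|_{s,G,U}+\int_{\mathbb R^n}g\Big(\frac{|u(x)|}{(1+|x|)^s}\Big)\frac{dx}{(1+|x|)^{n+s}}<\infty .$$ For $u\in\widetilde W^{s,G}(\Omega)$ and $K\ge0$, we say that $|(-\Delta_g)^su|\le K$ weakly in $\Omega$ if $$-K\int_\Omega\varphi\,dx\le\iint_{\mathbb R^n\times\mathbb R^n}g(D_su)\,D_s\varphi\,d\mu\le K\int_\Omega\varphi\,dx$$ for all $\varphi\in W^{s,G}_0(\Omega)$ with $\varphi\ge0$ a.e. in $\Omega$. For $p>1$ let $$\mathrm{Tail}_p(u;R)=\Big(R^{sp}\int_{\mathbb R^n\setminus B_R}\frac{|u(y)|^{p-1}}{|y|^{n+sp}}\,dy\Big)^{\frac1{p-1}}.$$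 **Statement (interior Hölder estimate).** There are an exponent $\beta>0$ depending only on $\lambda,\Lambda$, and an exponent $\alpha\in(0,1)$ and a constant $C>0$ depending only on $n,s,\lambda,\Lambda$, such that the following holds. Let $g$ be admissible, $R_0\in(0,1)$, $K\ge0$, and let $u\in\widetilde W^{s,G}(B_{R_0})\cap L^\infty(B_{R_0})$ satisfy $|(-\Delta_g)^su|\le K$ weakly in $B_{R_0}$ and $\mathrm{Tail}_{p^+}(u;R_0)<\infty$. Then, after modification on a null set, $u$ satisfies $$[u]_{C^\alpha(B_{R_0/2})}=\sup_{x\ne y\in B_{R_0/2}}\frac{|u(x)-u(y)|}{|x-y|^\alpha}\le C\big(R_0^{s-\alpha}g^{-1}(K)+R_0^{-s}Q(u;R_0)\big),$$ where $$Q(u;R_0)=\big(\|u\|_{L^\infty(B_{R_0})}+\mathrm{Tail}_{p^+}(u;R_0)+\mathrm{Tail}_{p^-}(u;R_0)\big)^\beta .$$ -/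

import Mathlib

open MeasureTheory Set Filter Topology
open scoped ENNReal

namespace FracG

/-- The Euclidean space `ℝⁿ`. -/
abbrev E (n : ℕ) : Type := EuclideanSpace ℝ (Fin n)

/-- `g` is the density of a Young function `G(t) = ∫₀ᵗ g`: on `[0,∞)` it is right continuous,
vanishes exactly at `0`, is nondecreasing and tends to infinity; it is extended to `ℝ` as an odd
function. -/
structure IsYoungDensity (g : ℝ → ℝ) : Prop where
  right_continuous : ∀ t : ℝ, 0 ≤ t → ContinuousWithinAt g (Ici t) t
  zero : g 0 = 0
  pos : ∀ t : ℝ, 0 < t → 0 < g t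
  mono : MonotoneOn g (Ioi 0)
  tendsto : Tendsto g atTop atTop
  odd : ∀ t : ℝ, g (-t) = -g t

/-- The structural hypotheses on `g = G'`: it is a Young density, absolutely continuous on bounded
intervals, satisfies the ellipticity condition `lam ≤ t g'(t) / g(t) ≤ Lam` at almost every `t > 0`
(`g'` exists almost everywhere), and is convex on `(0,∞)`. -/
structure IsAdmissible (lam Lam : ℝ) (g : ℝ → ℝ) : Prop extends IsYoungDensity g where
  absolutely_continuous : ∀ T : ℝ, 0 < T → AbsolutelyContinuousOnInterval g 0 T
  elliptic : ∀ᵐ t : ℝ, 0 < t → lam ≤ t * deriv g t / g t ∧ t * deriv g t / g t ≤ Lam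
  convex : ConvexOn ℝ (Ioi 0) g

/-- The Young function `G(t) = ∫₀ᵗ g(τ) dτ`, extended evenly to `ℝ`. -/
noncomputable def youngFun (g : ℝ → ℝ) (t : ℝ) : ℝ := ∫ τ in (0 : ℝ)..|t|, g τ

/-- The inverse of `g : [0,∞) → [0,∞)`. -/
noncomputable def gInv (g : ℝ → ℝ) (y : ℝ) : ℝ := Function.invFunOn g (Ici 0) y

/-- The measure `dμ = dx dy / |x - y|ⁿ` on `ℝⁿ × ℝⁿ`. -/
noncomputable def mu (n : ℕ) : Measure (E n × E n) :=
  (volume : Measure (E n × E n)).withDensity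
    (fun p => ENNReal.ofReal (1 / ‖p.1 - p.2‖ ^ n))

/-- The `s`-Hölder quotient `D_s u(x,y) = (u(x) - u(y)) / |x - y|ˢ`. -/
noncomputable def holderQuot {n : ℕ} (s : ℝ) (u : E n → ℝ) (p : E n × E n) : ℝ :=
  (u p.1 - u p.2) / ‖p.1 - p.2‖ ^ s

/-- The modular `∫ G(w) dν`, in `[0,∞]`. -/
noncomputable def modular {X : Type*} [MeasurableSpace X] (g : ℝ → ℝ) (ν : Measure X)
    (w : X → ℝ) : ℝ≥0∞ :=
  ∫⁻ x, ENNReal.ofReal (youngFun g (w x)) ∂ν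

/-- The Luxemburg norm `inf {k > 0 : ∫ G(w / k) dν ≤ 1}`, in `[0,∞]` with `inf ∅ = ∞`. -/
noncomputable def luxNorm {X : Type*} [MeasurableSpace X] (g : ℝ → ℝ) (ν : Measure X)
    (w : X → ℝ) : ℝ≥0∞ :=
  ⨅ (k : ℝ) (_ : 0 < k) (_ : modular g ν (fun x => w x / k) ≤ 1), ENNReal.ofReal k

/-- The Orlicz class `L^G(X, ν)`. -/
def MemLG {X : Type*} [MeasurableSpace X] (g : ℝ → ℝ) (ν : Measure X) (w : X → ℝ) : Prop :=
  AEMeasurable w ν ∧ modular g ν w < ∞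

/-- The local Orlicz class `L^G_loc(ℝⁿ)`. -/
def MemLGloc {n : ℕ} (g : ℝ → ℝ) (u : E n → ℝ) : Prop :=
  AEMeasurable u volume ∧ ∀ A : Set (E n), IsCompact A → MemLG g (volume.restrict A) u

/-- The fractional Orlicz-Sobolev space `W^{s,G}(U)`. -/
def MemW {n : ℕ} (s : ℝ) (g : ℝ → ℝ) (U : Set (E n)) (u : E n → ℝ) : Prop :=
  MemLG g (volume.restrict U) u ∧ MemLG g ((mu n).restrict (U ×ˢ U)) (holderQuot s u)

/-- The Luxemburg type norm `‖u‖_{s,G,U} = ‖u‖_{G,U} + [u]_{s,G,U}`. -/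
noncomputable def normW {n : ℕ} (s : ℝ) (g : ℝ → ℝ) (U : Set (E n)) (u : E n → ℝ) : ℝ≥0∞ :=
  luxNorm g (volume.restrict U) u + luxNorm g ((mu n).restrict (U ×ˢ U)) (holderQuot s u)

/-- The space `W̃^{s,G}(Ω)` for bounded `Ω`: functions in `L^G_loc(ℝⁿ)` such that, for some open
`U ⊃⊃ Ω`,
`‖u‖_{s,G,U} + ∫_{ℝⁿ} g(|u(x)| / (1+|x|)ˢ) dx / (1+|x|)^{n+s} < ∞`. -/
def MemWtilde {n : ℕ} (s : ℝ) (g : ℝ → ℝ) (Ω : Set (E n)) (u : E n → ℝ) : Prop :=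
  MemLGloc g u ∧
    ∃ U : Set (E n), IsOpen U ∧ closure Ω ⊆ U ∧
      normW s g U u +
        ∫⁻ x : E n, ENNReal.ofReal
          (g (|u x| / (1 + ‖x‖) ^ s) / (1 + ‖x‖) ^ ((n : ℝ) + s)) < ∞

/-- The space `W₀^{s,G}(Ω)` of functions in `W^{s,G}(ℝⁿ)` vanishing a.e. outside `Ω`. -/
def MemW0 {n : ℕ} (s : ℝ) (g : ℝ → ℝ) (Ω : Set (E n)) (φ : E n → ℝ) : Prop :=
  MemW s g univ φ ∧ ∀ᵐ x, x ∉ Ω → φ x = 0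

/-- `u` is a weak subsolution of `(-Δ_g)^s u = f` in the bounded open set `Ω`. -/
def IsWeakSubsolution {n : ℕ} (s : ℝ) (g : ℝ → ℝ) (Ω : Set (E n)) (f u : E n → ℝ) : Prop :=
  MemWtilde s g Ω u ∧
    ∀ φ : E n → ℝ, MemW0 s g Ω φ → (∀ᵐ x, x ∈ Ω → 0 ≤ φ x) →
      ∫ p, g (holderQuot s u p) * holderQuot s φ p ∂(mu n) ≤ ∫ x in Ω, f x * φ x

/-- `u` is a weak supersolution of `(-Δ_g)^s u = f`: since the operator is odd, this says that
`-u` is a weak subsolution with right-hand side `-f`. -/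
def IsWeakSupersolution {n : ℕ} (s : ℝ) (g : ℝ → ℝ) (Ω : Set (E n)) (f u : E n → ℝ) : Prop :=
  IsWeakSubsolution s g Ω (fun x => -f x) (fun x => -u x)

/-- `|(-Δ_g)^s u| ≤ K` weakly in `Ω`, that is `-K ≤ (-Δ_g)^s u ≤ K` weakly in `Ω`. -/
def WeaklyBounded {n : ℕ} (s : ℝ) (g : ℝ → ℝ) (Ω : Set (E n)) (K : ℝ) (u : E n → ℝ) : Prop :=
  IsWeakSubsolution s g Ω (fun _ => K) u ∧ IsWeakSupersolution s g Ω (fun _ => -K) u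

/-- The nonlocal tail centred at the origin,
`Tail_p(u;R) = (R^{sp} ∫_{ℝⁿ ∖ B_R} |u(y)|^{p-1} / |y|^{n+sp} dy)^{1/(p-1)}`, in `[0,∞]`. -/
noncomputable def tail {n : ℕ} (s p : ℝ) (u : E n → ℝ) (R : ℝ) : ℝ≥0∞ :=
  (ENNReal.ofReal (R ^ (s * p)) *
    ∫⁻ y in (Metric.ball (0 : E n) R)ᶜ,
      ENNReal.ofReal (|u y| ^ (p - 1) / ‖y‖ ^ ((n : ℝ) + s * p))) ^ (1 / (p - 1))

/-- `Q(u;R) = (‖u‖_{L^∞(B_R)} + Tail_{p⁺}(u;R) + Tail_{p⁻}(u;R))^β` with `p⁺ = Lam + 1` and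
`p⁻ = lam + 1`. -/
noncomputable def Q {n : ℕ} (s lam Lam β : ℝ) (u : E n → ℝ) (R : ℝ) : ℝ≥0∞ :=
  (eLpNorm u ∞ (volume.restrict (Metric.ball (0 : E n) R))
    + tail s (Lam + 1) u R + tail s (lam + 1) u R) ^ β

/-- The Hölder seminorm `[v]_{C^α(A)} = sup_{x ≠ y ∈ A} |v(x) - v(y)| / |x - y|^α`, in `[0,∞]`. -/
noncomputable def holderSeminorm {n : ℕ} (α : ℝ) (A : Set (E n)) (v : E n → ℝ) : ℝ≥0∞ :=
  ⨆ (x ∈ A) (y ∈ A) (_ : x ≠ y), ENNReal.ofReal (|v x - v y| / ‖x - y‖ ^ α)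

end FracG

/-! The estimate is an oscillation decay proved by direct comparison with a bump function; it is
linear in the data, so $\beta=1$ suffices.

The core uses only `Regular`: $g$ is odd and monotone, $g(\tau t)\le\tau g(t)$ for $\tau\in[0,1]$,
$g$ is doubling with exponent $\Lambda$, and convexity bounds its Lipschitz constant on $[-M,M]$ by
$g(2M)/M$.

The heart is `growth_lemma`. Let $w\le M$ in $B_r(x_0)$, and let $w\le M-\omega/2$ on a set $D$
filling a fixed proportion of the annulus. Test the equation with $\eta=(w-M+\psi)_+$ cut to
$B_{r/3}(x_0)$, where $\psi$ is a bump of height $e\omega$ supported there. Since $g$ is odd and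
monotone, the pairings of $w$ and of $\psi$ with $\eta$ add up to a nonnegative integrand on pairs
inside $B_r(x_0)$, and pairs with one point in $D$ give a definite gain (`pairing_lower`). After
integration the gain is a constant times $J\Gamma$, with $J=\int\eta$ and
$\Gamma=g(\omega/r^s)r^{-s}$. Every loss is at most a constant times $eJ\Gamma$: the operator
applied to $\psi$ (`abs_barrier_integral_le`), the right-hand side $K$, the growth of $w$ outside
$B_r(x_0)$, and the nonlocal tail. For small $e$ this forces $J=0$, hence $w\le M-\psi$ in
$B_{r/3}(x_0)$.

In `oscillation_decay` either $u$ or $-u$ has such a set $D$ in each annulus, so the oscillation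
shrinks by the factor $4^{-\alpha}$, $\alpha=es/32$, when the radius is divided by $4$. Two facts
keep the iteration going: growth of order $|x-x_0|^\alpha$ inherited from coarser scales stays below
the growth that the lemma tolerates (`profile_upper`), and $\alpha\le s$ makes $\Gamma$
nondecreasing along the scales (`density_scale_mono`), so that smallness of $K$ and of the tail is
needed only once.

It is arranged by starting from $\omega=\frac2e(N+T_1+T_2+R^sg^{-1}(K))$, where $N$ bounds $|u|$ in
$B_R$ and $T_1,T_2$ bound the two tails. The bound $g(bt)\le(b^\lambda+b^\Lambda)g(t)$ converts
these tails into a bound for the $g$-tail (`tailDensity_bound`). -/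

namespace FracG

/-! ### Scaling, Lipschitz bounds and the inverse of an admissible $g$ -/

/-- The consequences of admissibility used in the regularity theory. -/
structure Regular (Lam : ℝ) (g : ℝ → ℝ) : Prop where
  mono : Monotone g
  odd : ∀ t, g (-t) = -g t
  pos : ∀ t, 0 < t → 0 < g t
  sub : ∀ τ t, 0 ≤ τ → τ ≤ 1 → 0 ≤ t → g (τ * t) ≤ τ * g t
  doubling : ∀ b t, 1 ≤ b → 0 ≤ t → g (b * t) ≤ b ^ Lam * g t
  lip : ∀ M a b, 0 < M → |a| ≤ M → |b| ≤ M → |g a - g b| ≤ g (2 * M) / M * |a - b|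

namespace IsAdmissible

variable {lam Lam : ℝ} {g : ℝ → ℝ}

theorem nonneg (hg : IsAdmissible lam Lam g) {t : ℝ} (ht : 0 ≤ t) : 0 ≤ g t := by
  rcases ht.eq_or_lt with rfl | h
  · exact hg.zero.ge
  · exact (hg.pos t h).le

/-- Integration by parts for absolutely continuous functions. It turns the almost everywhere
ellipticity condition into monotonicity of $g(t)t^{-p}$ for $p=\lambda$ and $p=\Lambda$, since the
integrand has the sign of $tg'/g-p$. -/
theorem integral_rpow_weight (hg : IsAdmissible lam Lam g) (p : ℝ) {a b : ℝ} (ha : 0 < a)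
    (hab : a ≤ b) :
    ∫ t in a..b, (deriv g t * t ^ (-p) + g t * (-p * t ^ (-p - 1)))
      = g b * b ^ (-p) - g a * a ^ (-p) := by
  have hb : 0 < b := ha.trans_le hab
  have h1 : AbsolutelyContinuousOnInterval g a b := by
    refine (hg.absolutely_continuous b hb).mono ?_
    rw [uIcc_of_le hab, uIcc_of_le hb.le]
    exact Icc_subset_Icc_left ha.le
  have h2 : AbsolutelyContinuousOnInterval (fun t : ℝ => t ^ (-p)) a b := by
    apply ContDiffOn.absolutelyContinuousOnInterval
    rw [uIcc_of_le hab]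
    intro x hx
    have hx0 : x ≠ 0 := (ha.trans_le hx.1).ne'
    exact (Real.contDiffAt_rpow_const_of_ne hx0).contDiffWithinAt
  rw [← h1.integral_deriv_mul_eq_sub h2]
  refine intervalIntegral.integral_congr fun t ht => ?_
  rw [uIcc_of_le hab] at ht
  have hx0 : t ≠ 0 := (ha.trans_le ht.1).ne'
  rw [Real.deriv_rpow_const]

theorem rpow_weight_identity (hg : IsAdmissible lam Lam g) (p : ℝ) {t : ℝ} (ht : 0 < t) :
    deriv g t * t ^ (-p) + g t * (-p * t ^ (-p - 1))
      = g t * t ^ (-p - 1) * (t * deriv g t / g t - p) := by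
  have h1 : t ^ (-p) = t ^ (-p - 1) * t := by
    rw [← Real.rpow_add_one ht.ne']; congr 1; ring
  have := (hg.pos t ht).ne'
  rw [h1]; field_simp; ring

theorem mul_rpow_neg_antitone (hg : IsAdmissible lam Lam g) {a b : ℝ} (ha : 0 < a)
    (hab : a ≤ b) : g b * b ^ (-Lam) ≤ g a * a ^ (-Lam) := by
  have h := hg.integral_rpow_weight Lam ha hab
  have : ∫ t in a..b, (deriv g t * t ^ (-Lam) + g t * (-Lam * t ^ (-Lam - 1))) ≤ 0 := by
    rw [intervalIntegral.integral_of_le hab]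
    refine integral_nonpos_of_ae ?_
    rw [EventuallyLE, ae_restrict_iff' measurableSet_Ioc]
    filter_upwards [hg.elliptic] with t he ht
    have ht0 : 0 < t := ha.trans ht.1
    rw [hg.rpow_weight_identity _ ht0]
    have := hg.pos t ht0
    refine mul_nonpos_of_nonneg_of_nonpos (by positivity) ?_
    linarith [(he ht0).2]
  linarith

theorem mul_rpow_neg_monotone (hg : IsAdmissible lam Lam g) {a b : ℝ} (ha : 0 < a)
    (hab : a ≤ b) : g a * a ^ (-lam) ≤ g b * b ^ (-lam) := by
  have h := hg.integral_rpow_weight lam ha hab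
  have : 0 ≤ ∫ t in a..b, (deriv g t * t ^ (-lam) + g t * (-lam * t ^ (-lam - 1))) := by
    rw [intervalIntegral.integral_of_le hab]
    refine integral_nonneg_of_ae ?_
    rw [EventuallyLE, ae_restrict_iff' measurableSet_Ioc]
    filter_upwards [hg.elliptic] with t he ht
    have ht0 : 0 < t := ha.trans ht.1
    rw [hg.rpow_weight_identity _ ht0]
    have := hg.pos t ht0
    refine mul_nonneg (by positivity) ?_
    linarith [(he ht0).1]
  linarith

theorem le_rpow_mul_of_one_le (hg : IsAdmissible lam Lam g) {b t : ℝ} (hb : 1 ≤ b) (ht : 0 ≤ t) :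
    g (b * t) ≤ b ^ Lam * g t := by
  rcases ht.eq_or_lt with rfl | ht
  · simp [hg.zero]
  have hb0 : 0 < b := by linarith
  have h := hg.mul_rpow_neg_antitone ht (le_mul_of_one_le_left ht.le hb)
  rw [Real.mul_rpow hb0.le ht.le, Real.rpow_neg hb0.le, Real.rpow_neg ht.le] at h
  have h1 : 0 < b ^ Lam := by positivity
  have h2 : 0 < t ^ Lam := by positivity
  field_simp at h
  linarith

theorem le_rpow_mul_of_le_one (hg : IsAdmissible lam Lam g) (hlam : 1 < lam) {b t : ℝ}
    (hb0 : 0 ≤ b) (hb : b ≤ 1) (ht : 0 ≤ t) : g (b * t) ≤ b ^ lam * g t := by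
  rcases ht.eq_or_lt with rfl | ht
  · simp [hg.zero]
  rcases hb0.eq_or_lt with rfl | hb0
  · simp [hg.zero, Real.zero_rpow (by linarith : lam ≠ 0)]
  have h := hg.mul_rpow_neg_monotone (mul_pos hb0 ht) (mul_le_of_le_one_left ht.le hb)
  rw [Real.mul_rpow hb0.le ht.le, Real.rpow_neg hb0.le, Real.rpow_neg ht.le] at h
  have h1 : 0 < b ^ lam := by positivity
  have h2 : 0 < t ^ lam := by positivity
  field_simp at h
  linarith

/-- Which power dominates depends on whether $b$ exceeds $1$. Keeping both is what brings the two
tails, with exponents $p^-$ and $p^+$, into the estimate. -/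
theorem le_add_rpow_mul (hg : IsAdmissible lam Lam g) (hlam : 1 < lam) {b t : ℝ}
    (hb0 : 0 ≤ b) (ht : 0 ≤ t) : g (b * t) ≤ (b ^ lam + b ^ Lam) * g t := by
  have h0 := hg.nonneg ht
  rcases le_total b 1 with hb | hb
  · refine (hg.le_rpow_mul_of_le_one hlam hb0 hb ht).trans ?_
    have : 0 ≤ b ^ Lam := by positivity
    nlinarith
  · refine (hg.le_rpow_mul_of_one_le hb ht).trans ?_
    have : 0 ≤ b ^ lam := by positivity
    nlinarith

theorem monotone (hg : IsAdmissible lam Lam g) : Monotone g := by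
  have h1 : MonotoneOn g (Ici 0) := by
    intro a ha b hb hab
    rcases (mem_Ici.1 ha).eq_or_lt with rfl | ha
    · rw [hg.zero]; exact hg.nonneg hb
    · exact hg.mono ha (ha.trans_le hab) hab
  intro a b hab
  rcases le_total 0 a with ha | ha
  · exact h1 ha (ha.trans hab) hab
  rcases le_total 0 b with hb | hb
  · have : 0 ≤ g (-a) := hg.nonneg (by linarith)
    rw [hg.odd] at this
    linarith [hg.nonneg hb]
  · have := h1 (mem_Ici.2 (neg_nonneg.2 hb)) (mem_Ici.2 (neg_nonneg.2 ha)) (neg_le_neg hab)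
    rw [hg.odd, hg.odd] at this
    linarith

theorem le_mul (hg : IsAdmissible lam Lam g) (hlam : 1 < lam) {τ t : ℝ} (h0 : 0 ≤ τ)
    (h1 : τ ≤ 1) (ht : 0 ≤ t) : g (τ * t) ≤ τ * g t := by
  refine (hg.le_rpow_mul_of_le_one hlam h0 h1 ht).trans ?_
  refine mul_le_mul_of_nonneg_right ?_ (hg.nonneg ht)
  rcases h0.eq_or_lt with rfl | h0
  · simp [Real.zero_rpow (by linarith : lam ≠ 0)]
  · simpa using Real.rpow_le_rpow_of_exponent_ge h0 h1 hlam.le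

theorem le_div_mul (hg : IsAdmissible lam Lam g) (hlam : 1 < lam) {t M : ℝ} (h0 : 0 ≤ t)
    (hM : 0 < M) (h1 : t ≤ M) : g t ≤ g M / M * t := by
  have := hg.le_mul hlam (τ := t / M) (by positivity) ((div_le_one hM).2 h1) hM.le
  rw [div_mul_cancel₀ _ hM.ne'] at this
  calc g t ≤ _ := this
    _ = _ := by ring

/-- By convexity the slope on $[a,b]$ is at most the slope on $[b,2M]$; going out to $2M$ keeps that
interval at least $M$ long. Convexity is only given on $(0,\infty)$, so $a=0$ is settled by $g(t)\le
(t/M)g(M)$. -/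
theorem sub_le_of_nonneg (hg : IsAdmissible lam Lam g) (hlam : 1 < lam) {M a b : ℝ} (hM : 0 < M)
    (ha : 0 ≤ a) (hab : a ≤ b) (hb : b ≤ M) : g b - g a ≤ g (2 * M) / M * (b - a) := by
  rcases hab.eq_or_lt with rfl | hab
  · simp
  have hgM : g M ≤ g (2 * M) := hg.monotone (by linarith)
  have hg0 : 0 ≤ g M := hg.nonneg hM.le
  rcases ha.eq_or_lt with rfl | ha
  · rw [hg.zero, sub_zero, sub_zero]
    refine (hg.le_div_mul hlam hab.le hM hb).trans ?_
    gcongr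
  · have h := hg.convex.slope_mono_adjacent (x := a) (y := b) (z := 2 * M) ha
      (mem_Ioi.2 (by linarith)) hab (by linarith)
    have h2 : (g (2 * M) - g b) / (2 * M - b) ≤ g (2 * M) / M := by
      have : 0 ≤ g b := hg.nonneg (by linarith)
      have : 0 ≤ g (2 * M) := hg.nonneg (by linarith)
      gcongr <;> linarith
    have h3 := h.trans h2
    rwa [div_le_iff₀ (by linarith)] at h3

theorem regular (hg : IsAdmissible lam Lam g) (hlam : 1 < lam) : Regular Lam g where
  mono := hg.monotone
  odd := hg.odd
  pos := hg.pos
  sub := fun _ _ h0 h1 ht => hg.le_mul hlam h0 h1 ht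
  doubling := fun _ _ hb ht => hg.le_rpow_mul_of_one_le hb ht
  lip := by
    intro M a b hM
    have hgM : g M ≤ g (2 * M) := hg.monotone (by linarith)
    have key : ∀ a b : ℝ, a ≤ b → |a| ≤ M → |b| ≤ M → g b - g a ≤ g (2 * M) / M * (b - a) := by
      intro a b hab ha hb
      rw [abs_le] at ha hb
      rcases le_total 0 a with h0 | h0
      · exact hg.sub_le_of_nonneg hlam hM h0 hab hb.2
      rcases le_total b 0 with h1 | h1
      · have := hg.sub_le_of_nonneg hlam hM (a := -b) (b := -a) (by linarith) (by linarith)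
          (by linarith)
        rw [hg.odd, hg.odd] at this
        linarith
      -- For endpoints of opposite sign the increment is split at $0$.
      · have e1 := hg.sub_le_of_nonneg hlam hM le_rfl h1 hb.2
        have e2 := hg.sub_le_of_nonneg hlam hM (a := 0) (b := -a) le_rfl (by linarith)
          (by linarith)
        rw [hg.odd] at e2
        rw [hg.zero] at e1 e2
        linarith
    intro ha hb
    rcases le_total a b with hab | hab
    · rw [abs_sub_comm, abs_sub_comm a, abs_of_nonneg (sub_nonneg.2 hab),
        abs_of_nonneg (sub_nonneg.2 (hg.monotone hab))]
      exact key a b hab ha hb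
    · rw [abs_of_nonneg (sub_nonneg.2 hab), abs_of_nonneg (sub_nonneg.2 (hg.monotone hab))]
      exact key b a hab hb ha

/-- Continuity and divergence of $g$ put $K$ in the range, so `Function.invFunOn` returns a genuine
preimage and not its default value. -/
theorem gInv_spec (hg : IsAdmissible lam Lam g) {K : ℝ} (hK : 0 ≤ K) :
    0 ≤ gInv g K ∧ g (gInv g K) = K := by
  have hmem : K ∈ g '' Ici 0 := by
    obtain ⟨T, hT1, hT0⟩ := ((hg.tendsto.eventually_ge_atTop K).and (eventually_gt_atTop 0)).exists
    have hc : ContinuousOn g (Icc 0 T) := by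
      simpa [uIcc_of_le hT0.le] using (hg.absolutely_continuous T hT0).continuousOn
    have := intermediate_value_Icc hT0.le hc (mem_Icc.2 ⟨by rw [hg.zero]; exact hK, hT1⟩)
    exact image_mono Icc_subset_Ici_self this
  exact ⟨Function.invFunOn_mem hmem, Function.invFunOn_eq hmem⟩

end IsAdmissible

/-! ### Elementary inequalities for regular $g$ -/

namespace Regular

variable {Lam : ℝ} {g : ℝ → ℝ}

theorem zero (hg : Regular Lam g) : g 0 = 0 := by
  have := hg.odd 0
  rw [neg_zero] at this
  linarith

theorem nonneg (hg : Regular Lam g) {t : ℝ} (ht : 0 ≤ t) : 0 ≤ g t := by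
  rw [← hg.zero]; exact hg.mono ht

theorem abs_eq (hg : Regular Lam g) (t : ℝ) : |g t| = g |t| := by
  rcases le_total 0 t with h | h
  · rw [abs_of_nonneg h, abs_of_nonneg (hg.nonneg h)]
  · have h1 := hg.nonneg (neg_nonneg.2 h)
    rw [abs_of_nonpos h, hg.odd, abs_of_nonpos]
    rw [hg.odd] at h1; linarith

theorem measurable (hg : Regular Lam g) : Measurable g := hg.mono.measurable

theorem add_three_le (hg : Regular Lam g) {a b c : ℝ} (ha : 0 ≤ a) (hb : 0 ≤ b) (hc : 0 ≤ c) :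
    g (a + b + c) ≤ g (3 * a) + g (3 * b) + g (3 * c) := by
  have h1 := hg.nonneg (by linarith : 0 ≤ 3 * a)
  have h2 := hg.nonneg (by linarith : 0 ≤ 3 * b)
  have h3 := hg.nonneg (by linarith : 0 ≤ 3 * c)
  rcases le_total a b with h | h <;> rcases le_total b c with h' | h' <;>
    rcases le_total a c with h'' | h''
  all_goals first
    | (have : g (a + b + c) ≤ g (3 * a) := hg.mono (by linarith)); linarith
    | (have : g (a + b + c) ≤ g (3 * b) := hg.mono (by linarith)); linarith
    | (have : g (a + b + c) ≤ g (3 * c) := hg.mono (by linarith)); linarith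

/-- For `a, U ≥ 0` one has `g (U - a) + g a ≥ g (U / 2)`. -/
theorem half_le (hg : Regular Lam g) {a U : ℝ} (ha : 0 ≤ a) (hU : 0 ≤ U) :
    g (U / 2) ≤ g (U - a) + g a := by
  rcases le_total a U with h | h
  · have h1 := hg.nonneg ha
    have h2 := hg.nonneg (sub_nonneg.2 h)
    rcases le_total a (U / 2) with h' | h'
    · have : g (U / 2) ≤ g (U - a) := hg.mono (by linarith)
      linarith
    · have : g (U / 2) ≤ g a := hg.mono (by linarith)
      linarith
  · rcases hU.eq_or_lt with rfl | hU
    · rw [zero_sub, hg.odd, zero_div, hg.zero]; simp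
    have ha0 : 0 < a := hU.trans_le h
    have e1 := hg.sub ((a - U) / a) a (div_nonneg (by linarith) ha)
      ((div_le_one ha0).2 (by linarith)) ha
    have e2 := hg.sub (U / a) a (by positivity) ((div_le_one ha0).2 h) ha
    rw [div_mul_cancel₀ _ ha0.ne'] at e1 e2
    -- For $a>U$ the claim is superadditivity, $g(a-U)+g(U)\le g(a)$: the weights $(a-U)/a$ and
    -- $U/a$ in `e1` and `e2` add up to $1$.
    have e3 : g (U - a) = - g (a - U) := by rw [← hg.odd]; congr 1; ring
    have e4 : g (U / 2) ≤ g U := hg.mono (by linarith)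
    have e5 : (a - U) / a * g a + U / a * g a = g a := by field_simp; ring
    linarith

theorem youngFun_le (hg : Regular Lam g) (t : ℝ) : youngFun g t ≤ |t| * g |t| := by
  unfold youngFun
  have h : ∫ τ in (0 : ℝ)..|t|, g τ ≤ ∫ _ in (0 : ℝ)..|t|, g |t| := by
    refine intervalIntegral.integral_mono_on (abs_nonneg t)
      (hg.mono.monotoneOn _).intervalIntegrable (by simp) fun x hx => hg.mono hx.2
  simpa using h

/-- The upper half of $[0,|t|]$ already contributes $\frac{|t|}2g(|t|/2)$, and doubling recovers
$g(|t|)$. With `youngFun_le` this allows $G(t)$ to be replaced by $|t|g(|t|)$ in all integrability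
questions. -/
theorem le_youngFun (hg : Regular Lam g) (t : ℝ) :
    |t| * g |t| ≤ 2 * 2 ^ Lam * youngFun g t := by
  unfold youngFun
  have hi : ∀ a b, IntervalIntegrable g volume a b :=
    fun a b => (hg.mono.monotoneOn _).intervalIntegrable
  have h0 : 0 ≤ ∫ τ in (0 : ℝ)..(|t| / 2), g τ :=
    intervalIntegral.integral_nonneg (by positivity) fun x hx => hg.nonneg hx.1
  have h : ∫ _ in (|t| / 2)..|t|, g (|t| / 2) ≤ ∫ τ in (|t| / 2)..|t|, g τ := by
    refine intervalIntegral.integral_mono_on (by linarith [abs_nonneg t])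
      (by simp) (hi _ _) fun x hx => hg.mono hx.1
  have h2 := intervalIntegral.integral_add_adjacent_intervals (hi 0 (|t| / 2)) (hi (|t| / 2) |t|)
  have h3 := hg.doubling 2 (|t| / 2) (by norm_num) (by positivity)
  rw [mul_div_cancel₀ _ (by norm_num : (2 : ℝ) ≠ 0)] at h3
  simp only [intervalIntegral.integral_const, smul_eq_mul] at h
  have h5 : (0 : ℝ) < 2 ^ Lam := by positivity
  rw [← h2]
  calc |t| * g |t| ≤ |t| * (2 ^ Lam * g (|t| / 2)) := by gcongr
    _ = 2 * 2 ^ Lam * ((|t| - |t| / 2) * g (|t| / 2)) := by ring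
    _ ≤ _ := by gcongr; linarith

theorem abs_mul_mono (hg : Regular Lam g) {a b : ℝ} (h : |a| ≤ |b|) :
    |a| * g |a| ≤ |b| * g |b| :=
  mul_le_mul h (hg.mono h) (hg.nonneg (abs_nonneg _)) (abs_nonneg _)

theorem abs_mul_add_le (hg : Regular Lam g) (a b : ℝ) :
    |a + b| * g |a + b| ≤ 2 * 2 ^ Lam * (|a| * g |a| + |b| * g |b|) := by
  have key : ∀ c : ℝ, |2 * c| * g |2 * c| ≤ 2 * 2 ^ Lam * (|c| * g |c|) := by
    intro c
    have h3 := hg.doubling 2 |c| (by norm_num) (by positivity)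
    rw [abs_mul, abs_two]
    calc _ ≤ 2 * |c| * (2 ^ Lam * g |c|) := by gcongr
      _ = _ := by ring
  have hp : ∀ c : ℝ, 0 ≤ |c| * g |c| := fun c => mul_nonneg (abs_nonneg _) (hg.nonneg (abs_nonneg _))
  have h5 : (0 : ℝ) < 2 ^ Lam := by positivity
  have ht := abs_add_le a b
  rcases le_total |a| |b| with h | h
  · calc _ ≤ |2 * b| * g |2 * b| := hg.abs_mul_mono (by rw [abs_mul, abs_two]; linarith)
      _ ≤ _ := key b
      _ ≤ _ := by gcongr; linarith [hp a]
  · calc _ ≤ |2 * a| * g |2 * a| := hg.abs_mul_mono (by rw [abs_mul, abs_two]; linarith)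
      _ ≤ _ := key a
      _ ≤ _ := by gcongr; linarith [hp b]

theorem abs_mul_le (hg : Regular Lam g) (a b : ℝ) :
    |g a * b| ≤ |a| * g |a| + |b| * g |b| := by
  have hp : ∀ c : ℝ, 0 ≤ |c| * g |c| := fun c => mul_nonneg (abs_nonneg _) (hg.nonneg (abs_nonneg _))
  rw [abs_mul, hg.abs_eq]
  rcases le_total |a| |b| with h | h
  · have : g |a| * |b| ≤ |b| * g |b| := by
      rw [mul_comm]; exact mul_le_mul_of_nonneg_left (hg.mono h) (abs_nonneg _)
    linarith [hp a]
  · have : g |a| * |b| ≤ |a| * g |a| := by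
      rw [mul_comm]; exact mul_le_mul_of_nonneg_right h (hg.nonneg (abs_nonneg _))
    linarith [hp b]

end Regular

/-! ### The integrable kernel and the measure $\mu$ -/

/-- The kernel `|z|^{-n-s} min(1, (|z|/ρ)^{2-s})`, integrable on `ℝⁿ`. -/
noncomputable def kern (n : ℕ) (s ρ t : ℝ) : ℝ := 1 / t ^ n * (1 / t ^ s) * min 1 ((t / ρ) ^ (2 - s))

theorem kern_nonneg (n : ℕ) (s : ℝ) {ρ t : ℝ} (hρ : 0 < ρ) (ht : 0 ≤ t) : 0 ≤ kern n s ρ t := by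
  unfold kern; positivity

theorem kern_of_le {n : ℕ} {s ρ t : ℝ} (hs : s < 1) (hρ : 0 < ρ) (ht : 0 ≤ t) (h : t ≤ ρ) :
    kern n s ρ t = 1 / t ^ n * (1 / t ^ s) * (t / ρ) ^ (2 - s) := by
  unfold kern
  rw [min_eq_right]
  exact Real.rpow_le_one (by positivity) ((div_le_one hρ).2 h) (by linarith)

theorem kern_of_ge {n : ℕ} {s ρ t : ℝ} (hs : s < 1) (hρ : 0 < ρ) (h : ρ ≤ t) :
    kern n s ρ t = 1 / t ^ n * (1 / t ^ s) := by
  unfold kern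
  rw [min_eq_left, mul_one]
  exact Real.one_le_rpow ((one_le_div hρ).2 h) (by linarith)

theorem kern_scale (n : ℕ) (s : ℝ) {ρ t : ℝ} (hρ : 0 < ρ) (ht : 0 ≤ t) :
    kern n s ρ t = ρ ^ (-s) * (1 / ρ ^ n) * kern n s 1 (ρ⁻¹ * t) := by
  unfold kern
  rw [mul_pow, Real.mul_rpow (by positivity) ht, div_one, div_eq_inv_mul t, Real.rpow_neg hρ.le,
    Real.inv_rpow hρ.le, inv_pow]
  have : 0 < ρ ^ s := by positivity
  rcases ht.eq_or_lt with rfl | ht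
  · rcases Nat.eq_zero_or_pos n with rfl | hn
    · by_cases hs : s = 0
      · simp [hs]
      · simp [Real.zero_rpow hs]
    · simp [hn.ne']
  have : 0 < t ^ s := by positivity
  field_simp

/-- In polar coordinates the integrand is $y^{1-2s}$ on $(0,1]$ and $y^{-1-s}$ beyond. The first is
integrable because $s<1$, the second because $s>0$. -/
theorem integrableOn_kern_one {n : ℕ} (hn : 1 ≤ n) {s : ℝ} (hs0 : 0 < s) (hs : s < 1) :
    IntegrableOn (fun y : ℝ => y ^ (n - 1) * kern n s 1 y) (Ioi 0) := by
  have hpow : ∀ y : ℝ, 0 < y → y ^ (n - 1) * (1 / y ^ n) = y ^ (-1 : ℝ) := by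
    intro y hy
    obtain ⟨m, rfl⟩ : ∃ m, n = m + 1 := ⟨n - 1, by omega⟩
    rw [Real.rpow_neg_one]
    simp only [Nat.add_sub_cancel]
    field_simp
    ring
  rw [← Ioc_union_Ioi_eq_Ioi (zero_le_one' ℝ)]
  refine IntegrableOn.union ?_ ?_
  · have h : IntegrableOn (fun y : ℝ => y ^ (1 - 2 * s)) (Ioc 0 1) :=
      (intervalIntegrable_iff_integrableOn_Ioc_of_le zero_le_one).1
        (intervalIntegral.intervalIntegrable_rpow' (by linarith))
    refine h.congr_fun (fun y hy => ?_) measurableSet_Ioc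
    simp only
    rw [kern_of_le hs one_pos hy.1.le hy.2, ← mul_assoc, ← mul_assoc, hpow y hy.1, div_one, one_div,
      ← Real.rpow_neg hy.1.le, ← Real.rpow_add hy.1, ← Real.rpow_add hy.1]
    congr 1; ring
  · have h := integrableOn_Ioi_rpow_of_lt (a := -1 - s) (by linarith) zero_lt_one
    refine h.congr_fun (fun y hy => ?_) measurableSet_Ioi
    have hy0 : 0 < y := zero_lt_one.trans hy
    simp only
    rw [kern_of_ge hs one_pos (mem_Ioi.1 hy).le, ← mul_assoc, hpow y hy0, one_div,
      ← Real.rpow_neg hy0.le, ← Real.rpow_add hy0]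
    congr 1

/-- The integral of the normalised kernel. -/
noncomputable def kernInt (n : ℕ) (s : ℝ) : ℝ := ∫ z : E n, kern n s 1 ‖z‖

theorem kernInt_nonneg (n : ℕ) (s : ℝ) : 0 ≤ kernInt n s :=
  integral_nonneg fun _ => kern_nonneg n s one_pos (norm_nonneg _)

theorem integrable_kern_one {n : ℕ} (hn : 1 ≤ n) {s : ℝ} (hs0 : 0 < s) (hs : s < 1) :
    Integrable (fun z : E n => kern n s 1 ‖z‖) := by
  have : Nonempty (Fin n) := ⟨⟨0, hn⟩⟩
  have h := integrable_fun_norm_addHaar (volume : Measure (E n)) (f := kern n s 1)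
  rw [h, finrank_euclideanSpace_fin]
  exact integrableOn_kern_one hn hs0 hs

theorem kern_norm_scale (n : ℕ) (s : ℝ) {ρ : ℝ} (hρ : 0 < ρ) (z : E n) :
    kern n s ρ ‖z‖ = ρ ^ (-s) * (1 / ρ ^ n) * kern n s 1 ‖ρ⁻¹ • z‖ := by
  rw [norm_smul, Real.norm_of_nonneg (by positivity : 0 ≤ ρ⁻¹)]
  exact kern_scale n s hρ (norm_nonneg z)

theorem integrable_kern {n : ℕ} (hn : 1 ≤ n) {s : ℝ} (hs0 : 0 < s) (hs : s < 1) {ρ : ℝ}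
    (hρ : 0 < ρ) : Integrable (fun z : E n => kern n s ρ ‖z‖) := by
  simp_rw [kern_norm_scale n s hρ]
  exact ((integrable_kern_one hn hs0 hs).comp_smul (inv_ne_zero hρ.ne')).const_mul _

theorem integral_kern (n : ℕ) (s : ℝ) {ρ : ℝ} (hρ : 0 < ρ) :
    ∫ z : E n, kern n s ρ ‖z‖ = ρ ^ (-s) * kernInt n s := by
  simp_rw [kern_norm_scale n s hρ]
  rw [integral_const_mul, Measure.integral_comp_inv_smul_of_nonneg _
    (fun z : E n => kern n s 1 ‖z‖) hρ.le, finrank_euclideanSpace_fin, smul_eq_mul, kernInt]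
  have : ρ ^ n ≠ 0 := by positivity
  field_simp

theorem measurable_weight (n : ℕ) :
    Measurable (fun p : E n × E n => ENNReal.ofReal (1 / ‖p.1 - p.2‖ ^ n)) := by
  fun_prop

theorem integral_mu {n : ℕ} (F : E n × E n → ℝ) :
    ∫ p, F p ∂(mu n) = ∫ p, 1 / ‖p.1 - p.2‖ ^ n * F p := by
  rw [mu, integral_withDensity_eq_integral_toReal_smul (measurable_weight n)
    (Eventually.of_forall fun _ => ENNReal.ofReal_lt_top)]
  refine integral_congr_ae (Eventually.of_forall fun p => ?_)
  simp only [smul_eq_mul]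
  rw [ENNReal.toReal_ofReal (by positivity)]

theorem integrable_mu_iff {n : ℕ} (F : E n × E n → ℝ) :
    Integrable F (mu n) ↔ Integrable (fun p => 1 / ‖p.1 - p.2‖ ^ n * F p) := by
  rw [mu, integrable_withDensity_iff_integrable_smul' (measurable_weight n)
    (Eventually.of_forall fun _ => ENNReal.ofReal_lt_top)]
  refine integrable_congr (Eventually.of_forall fun p => ?_)
  simp only [smul_eq_mul]
  rw [ENNReal.toReal_ofReal (by positivity)]

theorem integrableOn_mu_iff {n : ℕ} (F : E n × E n → ℝ) {S : Set (E n × E n)}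
    (hS : MeasurableSet S) :
    IntegrableOn F S (mu n) ↔ IntegrableOn (fun p => 1 / ‖p.1 - p.2‖ ^ n * F p) S := by
  rw [← integrable_indicator_iff hS, ← integrable_indicator_iff hS, integrable_mu_iff]
  refine integrable_congr (Eventually.of_forall fun p => ?_)
  by_cases hp : p ∈ S <;> simp [hp]

theorem mu_absolutelyContinuous (n : ℕ) : mu n ≪ (volume : Measure (E n × E n)) :=
  withDensity_absolutelyContinuous _ _

/-- The volume-preserving change $y=x+z$ makes the difference $z$ an independent variable, so that
for fixed $z$ one can integrate in $x$ first. -/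
theorem integrable_shear_iff {n : ℕ} (F : E n × E n → ℝ) :
    Integrable (fun p : E n × E n => F (p.1, p.1 + p.2)) ↔ Integrable F :=
  (measurePreserving_prod_add (volume : Measure (E n)) (volume : Measure (E n))).integrable_comp_emb
    (MeasurableEquiv.shearAddRight (E n)).measurableEmbedding (g := F)

theorem integral_shear {n : ℕ} (F : E n × E n → ℝ) :
    ∫ p : E n × E n, F (p.1, p.1 + p.2) = ∫ p, F p :=
  (measurePreserving_prod_add (volume : Measure (E n)) (volume : Measure (E n))).integral_comp
    (MeasurableEquiv.shearAddRight (E n)).measurableEmbedding F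

theorem integrable_mul_diff {n : ℕ} {f k : E n → ℝ} (hf : Integrable f) (hk : Integrable k) :
    Integrable (fun p : E n × E n => f p.1 * k (p.2 - p.1)) := by
  rw [← integrable_shear_iff]
  have h := hf.mul_prod hk
  simp only [add_sub_cancel_left]
  exact h

/-! ### The barrier and its difference quotients -/

/-- The profile `(1 - |x|²)₊²`. -/
noncomputable def profile {n : ℕ} (x : E n) : ℝ := max 0 (1 - ‖x‖ ^ 2) ^ 2

theorem profile_nonneg {n : ℕ} (x : E n) : 0 ≤ profile x := by unfold profile; positivity

theorem profile_le_one {n : ℕ} (x : E n) : profile x ≤ 1 := by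
  unfold profile
  have : max 0 (1 - ‖x‖ ^ 2) ≤ 1 := max_le zero_le_one (by nlinarith [norm_nonneg x])
  exact pow_le_one₀ (le_max_left _ _) this

theorem profile_eq_zero {n : ℕ} {x : E n} (h : 1 ≤ ‖x‖) : profile x = 0 := by
  unfold profile
  rw [max_eq_left (by nlinarith)]; simp

theorem profile_ge {n : ℕ} {x : E n} (h : ‖x‖ ≤ 3 / 4) : 49 / 256 ≤ profile x := by
  unfold profile
  have h1 : 7 / 16 ≤ 1 - ‖x‖ ^ 2 := by nlinarith [norm_nonneg x]
  have h2 : 7 / 16 ≤ max 0 (1 - ‖x‖ ^ 2) := h1.trans (le_max_right _ _)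
  nlinarith

theorem abs_profile_sub_le {n : ℕ} (x y : E n) : |profile x - profile y| ≤ 4 * ‖x - y‖ := by
  have key : ∀ x y : E n, ‖x‖ ≤ ‖y‖ → |profile x - profile y| ≤ 4 * ‖x - y‖ := by
    intro x y hxy
    have hd : ‖y‖ - ‖x‖ ≤ ‖x - y‖ := by rw [norm_sub_rev]; exact norm_sub_norm_le y x
    have hx := norm_nonneg x
    rcases le_total 1 ‖x‖ with h | h
    · rw [profile_eq_zero h, profile_eq_zero (h.trans hxy)]; simp
    have e1 : profile x = (1 - ‖x‖ ^ 2) ^ 2 := by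
      unfold profile; rw [max_eq_right (by nlinarith)]
    rw [abs_of_nonneg]
    · rcases le_total 1 ‖y‖ with h' | h'
      · rw [profile_eq_zero h', e1]
        have h3 : 0 ≤ 1 - ‖x‖ ^ 2 := by nlinarith
        have h4 : 1 - ‖x‖ ^ 2 ≤ 2 * (1 - ‖x‖) := by nlinarith
        have h5 : (1 - ‖x‖ ^ 2) ^ 2 ≤ 1 - ‖x‖ ^ 2 := by nlinarith
        linarith
      · have e2 : profile y = (1 - ‖y‖ ^ 2) ^ 2 := by
          unfold profile; rw [max_eq_right (by nlinarith)]
        rw [e1, e2]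
        have h6 : ‖y‖ ^ 2 - ‖x‖ ^ 2 ≤ 2 * ‖x - y‖ := by nlinarith
        have h7 : 0 ≤ ‖y‖ ^ 2 - ‖x‖ ^ 2 := by nlinarith
        have h8 : 0 ≤ 2 - ‖x‖ ^ 2 - ‖y‖ ^ 2 := by nlinarith
        have h9 : 2 - ‖x‖ ^ 2 - ‖y‖ ^ 2 ≤ 2 := by nlinarith [sq_nonneg ‖x‖, sq_nonneg ‖y‖]
        calc (1 - ‖x‖ ^ 2) ^ 2 - (1 - ‖y‖ ^ 2) ^ 2
            = (‖y‖ ^ 2 - ‖x‖ ^ 2) * (2 - ‖x‖ ^ 2 - ‖y‖ ^ 2) := by ring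
          _ ≤ (2 * ‖x - y‖) * 2 := by gcongr
          _ = _ := by ring
    · rw [sub_nonneg]
      unfold profile
      gcongr
  rcases le_total ‖x‖ ‖y‖ with h | h
  · exact key x y h
  · rw [abs_sub_comm, norm_sub_rev]; exact key y x h

/-- The profile is a function of $|x|^2$ with a remainder in $[0,9|z|^2]$ after linearisation at
$|x|^2$. The linear terms at $x+z$ and $x-z$ combine through the parallelogram law into
$-4(1-|x|^2)|z|^2$. The constant is $22=9+9+4$. -/
theorem abs_profile_second_le {n : ℕ} {x z : E n} (hx : ‖x‖ ≤ 1) (hz : ‖z‖ ≤ 1) :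
    |(profile x - profile (x + z)) + (profile x - profile (x - z))| ≤ 22 * ‖z‖ ^ 2 := by
  have hpar := parallelogram_law_with_norm ℝ x z
  have key : ∀ y : E n, ‖x - y‖ ≤ ‖z‖ →
      0 ≤ profile y - profile x - 2 * (1 - ‖x‖ ^ 2) * (‖x‖ ^ 2 - ‖y‖ ^ 2) ∧
      profile y - profile x - 2 * (1 - ‖x‖ ^ 2) * (‖x‖ ^ 2 - ‖y‖ ^ 2) ≤ 9 * ‖z‖ ^ 2 := by
    intro y hy
    have hx0 := norm_nonneg x
    have hy0 := norm_nonneg y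
    have hz0 := norm_nonneg z
    have h1 : ‖x‖ - ‖y‖ ≤ ‖x - y‖ := norm_sub_norm_le x y
    have h2 : ‖y‖ - ‖x‖ ≤ ‖x - y‖ := by rw [norm_sub_rev]; exact norm_sub_norm_le y x
    have h3 : |‖x‖ ^ 2 - ‖y‖ ^ 2| ≤ 3 * ‖z‖ := by
      rw [show ‖x‖ ^ 2 - ‖y‖ ^ 2 = (‖x‖ - ‖y‖) * (‖x‖ + ‖y‖) by ring, abs_mul,
        abs_of_nonneg (by positivity : 0 ≤ ‖x‖ + ‖y‖)]
      have h4 : |‖x‖ - ‖y‖| ≤ ‖z‖ := by rw [abs_le]; constructor <;> linarith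
      have h5 : ‖x‖ + ‖y‖ ≤ 3 := by linarith
      calc _ ≤ ‖z‖ * 3 := by gcongr
        _ = _ := by ring
    have h4 : (‖x‖ ^ 2 - ‖y‖ ^ 2) ^ 2 ≤ 9 * ‖z‖ ^ 2 := by
      rw [← sq_abs]; nlinarith [abs_nonneg (‖x‖ ^ 2 - ‖y‖ ^ 2)]
    have e1 : profile x = (1 - ‖x‖ ^ 2) ^ 2 := by
      unfold profile; rw [max_eq_right (by nlinarith)]
    have hc : 0 ≤ 1 - ‖x‖ ^ 2 := by nlinarith
    rcases le_total 1 ‖y‖ with h | h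
    · rw [profile_eq_zero h, e1]
      have hq : 0 ≤ ‖y‖ ^ 2 - 1 := by nlinarith
      constructor <;> nlinarith [mul_nonneg hc hq, sq_nonneg (‖y‖ ^ 2 - 1)]
    · have e2 : profile y = (1 - ‖y‖ ^ 2) ^ 2 := by
        unfold profile; rw [max_eq_right (by nlinarith)]
      rw [e1, e2]
      constructor <;> nlinarith [sq_nonneg (‖x‖ ^ 2 - ‖y‖ ^ 2)]
  have k1 := key (x + z) (by simp)
  have k2 := key (x - z) (by simp)
  have e : (‖x‖ ^ 2 - ‖x + z‖ ^ 2) + (‖x‖ ^ 2 - ‖x - z‖ ^ 2) = - 2 * ‖z‖ ^ 2 := by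
    nlinarith [hpar]
  have hc : 0 ≤ 1 - ‖x‖ ^ 2 := by nlinarith [norm_nonneg x]
  have e2 : 2 * (1 - ‖x‖ ^ 2) * (‖x‖ ^ 2 - ‖x + z‖ ^ 2) +
      2 * (1 - ‖x‖ ^ 2) * (‖x‖ ^ 2 - ‖x - z‖ ^ 2) = - 4 * ((1 - ‖x‖ ^ 2) * ‖z‖ ^ 2) := by
    rw [← mul_add, e]; ring
  have h5 : 0 ≤ (1 - ‖x‖ ^ 2) * ‖z‖ ^ 2 := by positivity
  have h6 : (1 - ‖x‖ ^ 2) * ‖z‖ ^ 2 ≤ ‖z‖ ^ 2 :=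
    mul_le_of_le_one_left (by positivity) (by nlinarith [sq_nonneg ‖x‖])
  rw [abs_le]
  constructor <;> nlinarith [sq_nonneg ‖z‖]

theorem measurable_profile (n : ℕ) : Measurable (profile : E n → ℝ) := by
  unfold profile; fun_prop

/-- The barrier of height `A` supported in the ball of radius `ρ` around `x₀`. -/
noncomputable def barrier {n : ℕ} (A ρ : ℝ) (x₀ x : E n) : ℝ := A * profile (ρ⁻¹ • (x - x₀))

section Barrier

variable {n : ℕ} {A ρ : ℝ} {x₀ : E n}

theorem measurable_barrier : Measurable (barrier A ρ x₀) := by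
  unfold barrier
  exact ((measurable_profile n).comp (by fun_prop)).const_mul _

theorem barrier_nonneg (hA : 0 ≤ A) (x : E n) : 0 ≤ barrier A ρ x₀ x :=
  mul_nonneg hA (profile_nonneg _)

theorem barrier_le (hA : 0 ≤ A) (x : E n) : barrier A ρ x₀ x ≤ A :=
  mul_le_of_le_one_right hA (profile_le_one _)

theorem norm_inv_smul (hρ : 0 < ρ) (x : E n) : ‖ρ⁻¹ • x‖ = ‖x‖ / ρ := by
  rw [norm_smul, norm_inv, Real.norm_of_nonneg hρ.le, div_eq_inv_mul]

theorem barrier_eq_zero (hρ : 0 < ρ) {x : E n} (h : ρ ≤ ‖x - x₀‖) : barrier A ρ x₀ x = 0 := by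
  unfold barrier
  rw [profile_eq_zero, mul_zero]
  rwa [norm_inv_smul hρ, one_le_div hρ]

theorem barrier_ge (hA : 0 ≤ A) (hρ : 0 < ρ) {x : E n} (h : ‖x - x₀‖ ≤ 3 / 4 * ρ) :
    49 / 256 * A ≤ barrier A ρ x₀ x := by
  unfold barrier
  rw [mul_comm]
  refine mul_le_mul_of_nonneg_left (profile_ge ?_) hA
  rwa [norm_inv_smul hρ, div_le_iff₀ hρ]

theorem abs_barrier_sub_le (hA : 0 ≤ A) (hρ : 0 < ρ) (x y : E n) :
    |barrier A ρ x₀ x - barrier A ρ x₀ y| ≤ 4 * A * (‖x - y‖ / ρ) := by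
  unfold barrier
  rw [← mul_sub, abs_mul, abs_of_nonneg hA]
  have h := abs_profile_sub_le (ρ⁻¹ • (x - x₀)) (ρ⁻¹ • (y - x₀))
  rw [← smul_sub, sub_sub_sub_cancel_right, norm_inv_smul hρ] at h
  calc _ ≤ A * (4 * (‖x - y‖ / ρ)) := by gcongr
    _ = _ := by ring

theorem abs_barrier_sub_le' (hA : 0 ≤ A) (x y : E n) :
    |barrier A ρ x₀ x - barrier A ρ x₀ y| ≤ A := by
  rw [abs_le]
  have h1 := barrier_nonneg (ρ := ρ) (x₀ := x₀) hA x
  have h2 := barrier_nonneg (ρ := ρ) (x₀ := x₀) hA y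
  have h3 := barrier_le (ρ := ρ) (x₀ := x₀) hA x
  have h4 := barrier_le (ρ := ρ) (x₀ := x₀) hA y
  constructor <;> linarith

theorem abs_barrier_second_le (hA : 0 ≤ A) (hρ : 0 < ρ) {x z : E n} (hx : ‖x - x₀‖ ≤ ρ)
    (hz : ‖z‖ ≤ ρ) :
    |(barrier A ρ x₀ x - barrier A ρ x₀ (x + z)) + (barrier A ρ x₀ x - barrier A ρ x₀ (x - z))|
      ≤ 22 * A * (‖z‖ / ρ) ^ 2 := by
  unfold barrier
  rw [← mul_sub, ← mul_sub, ← mul_add, abs_mul, abs_of_nonneg hA]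
  have h := abs_profile_second_le (x := ρ⁻¹ • (x - x₀)) (z := ρ⁻¹ • z)
    (by rwa [norm_inv_smul hρ, div_le_one hρ]) (by rwa [norm_inv_smul hρ, div_le_one hρ])
  rw [← smul_add, ← smul_sub, norm_inv_smul hρ, show x - x₀ + z = x + z - x₀ by abel,
    show x - x₀ - z = x - z - x₀ by abel] at h
  calc _ ≤ A * (22 * (‖z‖ / ρ) ^ 2) := by gcongr
    _ = _ := by ring

theorem quot_eq {s t : ℝ} (hρ : 0 < ρ) (ht : 0 < t) (m : ℝ) :
    (t / ρ) ^ m / t ^ s = 1 / ρ ^ s * (t / ρ) ^ (m - s) := by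
  rw [Real.rpow_sub (by positivity), Real.div_rpow ht.le hρ.le s]
  have : 0 < t ^ s := by positivity
  have : 0 < ρ ^ s := by positivity
  field_simp

/-- Since $g$ is odd, the sum of the two terms is a difference of values of $g$ at nearly equal
arguments, so the Lipschitz bound sees only the second difference of the barrier. For $|z|\le\rho$
this gains the factor $(|z|/\rho)^{2-s}$ of `kern`; for larger $|z|$ the height bound $A$ is enough.
-/
theorem kern_bound_symm {Lam : ℝ} {g : ℝ → ℝ} (hg : Regular Lam g) {s : ℝ}
    (hs0 : 0 < s) (hs : s < 1) (hA : 0 < A) (hρ : 0 < ρ) {x z : E n} (hx : ‖x - x₀‖ ≤ ρ)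
    (hz0 : z ≠ 0) :
    1 / ‖z‖ ^ n * (1 / ‖z‖ ^ s) *
      |g ((barrier A ρ x₀ x - barrier A ρ x₀ (x + z)) / ‖z‖ ^ s) +
        g ((barrier A ρ x₀ x - barrier A ρ x₀ (x - z)) / ‖z‖ ^ s)|
      ≤ (6 * 8 ^ Lam + 2) * g (A / ρ ^ s) * kern n s ρ ‖z‖ := by
  have hz : 0 < ‖z‖ := norm_pos_iff.2 hz0
  set t := ‖z‖ with ht
  have hts : 0 < t ^ s := by positivity
  have hρs : 0 < ρ ^ s := by positivity
  have hg0 : 0 ≤ g (A / ρ ^ s) := hg.nonneg (by positivity)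
  set a := barrier A ρ x₀ x - barrier A ρ x₀ (x + z) with ha
  set b := barrier A ρ x₀ x - barrier A ρ x₀ (x - z) with hb
  have h8 : (0 : ℝ) < 8 ^ Lam := by positivity
  rcases le_total t ρ with h | h
  · rw [kern_of_le hs hρ hz.le h]
    -- $M$ bounds both quotients, the $4$ being the Lipschitz constant of the profile. Then
    -- $2M=8A/\rho^s$ explains $8^\Lambda$, and $22/4$ is the $11/2$ below.
    set M := 4 * (A / ρ ^ s) with hM
    have hMpos : 0 < M := by positivity
    have hq : (t / ρ) / t ^ s ≤ 1 / ρ ^ s := by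
      have := quot_eq (s := s) hρ hz 1
      rw [Real.rpow_one] at this
      rw [this]
      refine mul_le_of_le_one_right (by positivity) ?_
      exact Real.rpow_le_one (by positivity) ((div_le_one hρ).2 h) (by linarith)
    have hbd : ∀ c : ℝ, |c| ≤ 4 * A * (t / ρ) → |c / t ^ s| ≤ M := by
      intro c hc
      rw [abs_div, abs_of_pos hts]
      calc |c| / t ^ s ≤ 4 * A * (t / ρ) / t ^ s := by gcongr
        _ = 4 * A * ((t / ρ) / t ^ s) := by ring
        _ ≤ 4 * A * (1 / ρ ^ s) := by gcongr
        _ = M := by rw [hM]; ring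
    have hA' : |a / t ^ s| ≤ M := hbd a (by
      simpa using abs_barrier_sub_le (x₀ := x₀) hA.le hρ x (x + z))
    have hB' : |-(b / t ^ s)| ≤ M := by
      rw [abs_neg]
      exact hbd b (by simpa using abs_barrier_sub_le (x₀ := x₀) hA.le hρ x (x - z))
    have hl := hg.lip M _ _ hMpos hA' hB'
    rw [hg.odd, sub_neg_eq_add, sub_neg_eq_add, ← add_div] at hl
    have h2 : |(a + b) / t ^ s| ≤ 22 * A * (1 / ρ ^ s * (t / ρ) ^ (2 - s)) := by
      rw [abs_div, abs_of_pos hts, ← quot_eq hρ hz, ← mul_div_assoc, Real.rpow_two]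
      gcongr
      exact abs_barrier_second_le hA.le hρ hx h
    have hgM : g (2 * M) ≤ 8 ^ Lam * g (A / ρ ^ s) := by
      have := hg.doubling 8 (A / ρ ^ s) (by norm_num) (by positivity)
      rwa [show 2 * M = 8 * (A / ρ ^ s) by rw [hM]; ring]
    have h3 : |g (a / t ^ s) + g (b / t ^ s)| ≤
        (6 * 8 ^ Lam + 2) * g (A / ρ ^ s) * (t / ρ) ^ (2 - s) := by
      calc _ ≤ _ := hl
        _ ≤ 8 ^ Lam * g (A / ρ ^ s) / M * (22 * A * (1 / ρ ^ s * (t / ρ) ^ (2 - s))) := by gcongr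
        _ = (11 / 2 * 8 ^ Lam) * g (A / ρ ^ s) * (t / ρ) ^ (2 - s) := by
            rw [hM]; field_simp; ring
        _ ≤ _ := by gcongr; linarith
    calc _ ≤ 1 / t ^ n * (1 / t ^ s) * ((6 * 8 ^ Lam + 2) * g (A / ρ ^ s) * (t / ρ) ^ (2 - s)) := by
          gcongr
      _ = _ := by ring
  · rw [kern_of_ge hs hρ h]
    have hbd : ∀ c : ℝ, |c| ≤ A → |g (c / t ^ s)| ≤ g (A / ρ ^ s) := by
      intro c hc
      rw [hg.abs_eq, abs_div, abs_of_pos hts]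
      refine hg.mono ?_
      gcongr
    have h1 := hbd a (abs_barrier_sub_le' hA.le _ _)
    have h2 := hbd b (abs_barrier_sub_le' hA.le _ _)
    have h3 := abs_add_le (g (a / t ^ s)) (g (b / t ^ s))
    have h4 : |g (a / t ^ s) + g (b / t ^ s)| ≤ (6 * 8 ^ Lam + 2) * g (A / ρ ^ s) := by nlinarith
    calc _ ≤ 1 / t ^ n * (1 / t ^ s) * ((6 * 8 ^ Lam + 2) * g (A / ρ ^ s)) := by gcongr
      _ = _ := by ring

/-- The barrier has a finite modular with respect to the kernel. -/
theorem kern_bound_psi {Lam : ℝ} {g : ℝ → ℝ} (hg : Regular Lam g) {s : ℝ}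
    (hs0 : 0 < s) (hs : s < 1) (hA : 0 < A) (hρ : 0 < ρ) {x y : E n} (hxy : x ≠ y) :
    1 / ‖x - y‖ ^ n * (|(barrier A ρ x₀ x - barrier A ρ x₀ y) / ‖x - y‖ ^ s| *
        g |(barrier A ρ x₀ x - barrier A ρ x₀ y) / ‖x - y‖ ^ s|)
      ≤ (4 * (A / ρ ^ s) * g (4 * (A / ρ ^ s)) * ρ ^ s) * kern n s ρ ‖x - y‖ := by
  have hz : 0 < ‖x - y‖ := norm_pos_iff.2 (sub_ne_zero.2 hxy)
  set t := ‖x - y‖ with ht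
  have hts : 0 < t ^ s := by positivity
  have hρs : 0 < ρ ^ s := by positivity
  set a := barrier A ρ x₀ x - barrier A ρ x₀ y with ha
  set M := 4 * (A / ρ ^ s) with hM
  have hMpos : 0 < M := by positivity
  have hg0 : 0 ≤ g M := hg.nonneg hMpos.le
  -- The function $|t|g(|t|)$ decays at least quadratically at $0$. Below, this turns
  -- $\tau=(t/\rho)^{1-s}$ into the power $2-2s$ that makes the kernel integrable.
  have hτ : ∀ τ : ℝ, 0 ≤ τ → τ ≤ 1 → |a / t ^ s| ≤ τ * M →
      |a / t ^ s| * g |a / t ^ s| ≤ τ ^ 2 * (M * g M) := by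
    intro τ h0 h1 h
    calc _ ≤ (τ * M) * g (τ * M) := by
          gcongr
          · exact hg.nonneg (abs_nonneg _)
          · exact hg.mono h
      _ ≤ (τ * M) * (τ * g M) := by gcongr; exact hg.sub τ M h0 h1 hMpos.le
      _ = _ := by ring
  rcases le_total t ρ with h | h
  · rw [kern_of_le hs hρ hz.le h]
    have h1 : |a / t ^ s| ≤ (t / ρ) ^ (1 - s) * M := by
      rw [abs_div, abs_of_pos hts]
      calc |a| / t ^ s ≤ 4 * A * (t / ρ) / t ^ s := by
            gcongr; exact abs_barrier_sub_le hA.le hρ x y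
        _ = 4 * A * ((t / ρ) ^ (1 : ℝ) / t ^ s) := by rw [Real.rpow_one]; ring
        _ = _ := by rw [quot_eq hρ hz, hM]; ring
    have h2 := hτ _ (by positivity)
      (Real.rpow_le_one (by positivity) ((div_le_one hρ).2 h) (by linarith)) h1
    calc _ ≤ 1 / t ^ n * (((t / ρ) ^ (1 - s)) ^ 2 * (M * g M)) := by gcongr
      _ = 1 / t ^ n * (((t / ρ) ^ (2 - s) / t ^ s) * ρ ^ s * (M * g M)) := by
          rw [quot_eq hρ hz, ← Real.rpow_mul_natCast (by positivity)]
          rw [show (1 - s) * ((2 : ℕ) : ℝ) = 2 - s - s by push_cast; ring]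
          field_simp
      _ = _ := by ring
  · rw [kern_of_ge hs hρ h]
    have hr1 : ρ ^ s / t ^ s ≤ 1 := by
      rw [div_le_one hts]; gcongr
    have h1 : |a / t ^ s| ≤ (ρ ^ s / t ^ s) * M := by
      rw [abs_div, abs_of_pos hts]
      calc |a| / t ^ s ≤ (4 * A) / t ^ s := by
            gcongr; linarith [abs_barrier_sub_le' (ρ := ρ) (x₀ := x₀) hA.le x y]
        _ = _ := by rw [hM]; field_simp
    have h2 := hτ _ (by positivity) hr1 h1
    have h3 : (ρ ^ s / t ^ s) ^ 2 * (M * g M) ≤ (ρ ^ s / t ^ s) * (M * g M) := by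
      gcongr
      rw [pow_two]
      exact mul_le_of_le_one_left (by positivity) hr1
    calc _ ≤ 1 / t ^ n * ((ρ ^ s / t ^ s) * (M * g M)) :=
          mul_le_mul_of_nonneg_left (h2.trans h3) (by positivity)
      _ = _ := by ring

end Barrier

/-! ### Modulars, Luxemburg norms and integrability -/

/-- The function `t ↦ |t| g(|t|)`, comparable to the Young function of `g`. -/
noncomputable def psi (g : ℝ → ℝ) (t : ℝ) : ℝ := |t| * g |t|

theorem aemeasurable_holderQuot {n : ℕ} (s : ℝ) {u : E n → ℝ} (hu : AEMeasurable u) :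
    AEMeasurable (holderQuot s u) (volume : Measure (E n × E n)) := by
  have h1 : AEMeasurable (fun p : E n × E n => u p.1) volume :=
    hu.comp_quasiMeasurePreserving Measure.quasiMeasurePreserving_fst
  have h2 : AEMeasurable (fun p : E n × E n => u p.2) volume :=
    hu.comp_quasiMeasurePreserving Measure.quasiMeasurePreserving_snd
  have h3 : Measurable (fun p : E n × E n => ‖p.1 - p.2‖ ^ s) := by fun_prop
  exact (h1.sub h2).div h3.aemeasurable

namespace Regular

variable {Lam : ℝ} {g : ℝ → ℝ}

theorem psi_nonneg (hg : Regular Lam g) (t : ℝ) : 0 ≤ psi g t :=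
  mul_nonneg (abs_nonneg _) (hg.nonneg (abs_nonneg _))

theorem measurable_psi (hg : Regular Lam g) : Measurable (psi g) :=
  measurable_id.abs.mul (hg.measurable.comp measurable_id.abs)

theorem psi_mul_le (hg : Regular Lam g) {b : ℝ} (hb : 1 ≤ b) (t : ℝ) :
    psi g (b * t) ≤ b * b ^ Lam * psi g t := by
  unfold psi
  have hb0 : 0 ≤ b := by linarith
  have h3 := hg.doubling b |t| hb (by positivity)
  rw [abs_mul, abs_of_nonneg hb0]
  calc _ ≤ b * |t| * (b ^ Lam * g |t|) := by gcongr
    _ = _ := by ring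

theorem psi_integrable_of_le {X : Type*} [MeasurableSpace X] {ν : Measure X} (hg : Regular Lam g)
    {w w' : X → ℝ} (hw : AEMeasurable w ν) {C : ℝ} (hC : 0 ≤ C)
    (h : ∀ x, psi g (w x) ≤ C * youngFun g (w' x)) (hm : modular g ν w' < ∞) :
    Integrable (fun x => psi g (w x)) ν := by
  refine ⟨(hg.measurable_psi.comp_aemeasurable hw).aestronglyMeasurable, ?_⟩
  rw [hasFiniteIntegral_iff_ofReal (Eventually.of_forall fun x => hg.psi_nonneg _)]
  calc ∫⁻ x, ENNReal.ofReal (psi g (w x)) ∂ν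
      ≤ ∫⁻ x, ENNReal.ofReal C * ENNReal.ofReal (youngFun g (w' x)) ∂ν := by
        refine lintegral_mono fun x => ?_
        rw [← ENNReal.ofReal_mul hC]
        exact ENNReal.ofReal_le_ofReal (h x)
    _ = ENNReal.ofReal C * modular g ν w' := lintegral_const_mul' _ _ ENNReal.ofReal_ne_top
    _ < ∞ := ENNReal.mul_lt_top ENNReal.ofReal_lt_top hm

theorem memLG_of_integrable {X : Type*} [MeasurableSpace X] {ν : Measure X} (hg : Regular Lam g)
    {w : X → ℝ} (hw : AEMeasurable w ν) (h : Integrable (fun x => psi g (w x)) ν) :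
    MemLG g ν w := by
  refine ⟨hw, ?_⟩
  have h2 := h.2
  rw [hasFiniteIntegral_iff_ofReal (Eventually.of_forall fun x => hg.psi_nonneg _)] at h2
  exact (lintegral_mono fun x => ENNReal.ofReal_le_ofReal (hg.youngFun_le (w x))).trans_lt h2

/-- A finite infimum supplies some $k$ with modular of $w/k$ at most $1$, and doubling removes the
scaling; $\max(1,k)$ is used because doubling requires a factor at least $1$. -/
theorem psi_integrable_of_luxNorm {X : Type*} [MeasurableSpace X] {ν : Measure X}
    (hg : Regular Lam g) {w : X → ℝ} (hw : AEMeasurable w ν) (h : luxNorm g ν w < ∞) :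
    Integrable (fun x => psi g (w x)) ν := by
  unfold luxNorm at h
  simp only [iInf_lt_iff] at h
  obtain ⟨k, hk, hm, -⟩ := h
  have h2 : (0 : ℝ) < 2 ^ Lam := by positivity
  have hb : 1 ≤ max 1 k := le_max_left _ _
  refine hg.psi_integrable_of_le hw (C := max 1 k * (max 1 k) ^ Lam * (2 * 2 ^ Lam)) (by positivity)
    (fun x => ?_) (hm.trans_lt ENNReal.one_lt_top)
  have e : w x = k * (w x / k) := by field_simp
  have h3 : psi g (w x) ≤ psi g (max 1 k * (w x / k)) := by
    refine hg.abs_mul_mono ?_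
    conv_lhs => rw [e]
    rw [abs_mul, abs_mul, abs_of_pos hk, abs_of_nonneg (by positivity : 0 ≤ max 1 k)]
    gcongr
    exact le_max_right _ _
  calc _ ≤ _ := h3
    _ ≤ _ := hg.psi_mul_le hb _
    _ ≤ max 1 k * (max 1 k) ^ Lam * (2 * 2 ^ Lam * youngFun g (w x / k)) := by
        gcongr; exact hg.le_youngFun _
    _ = _ := by ring

end Regular

/-! ### The operator applied to the barrier -/

section Barrier

variable {n : ℕ} {A ρ s Lam : ℝ} {x₀ : E n} {g : ℝ → ℝ}

theorem integrable_kern_indicator (hn : 1 ≤ n) (hs0 : 0 < s) (hs : s < 1) {r : ℝ}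
    (hρ : 0 < ρ) (x₀ : E n) :
    Integrable (fun p : E n × E n => (Metric.closedBall x₀ r).indicator (fun _ => (1 : ℝ)) p.1 *
      kern n s ρ ‖p.1 - p.2‖) := by
  have h1 : Integrable ((Metric.closedBall x₀ r).indicator (fun _ : E n => (1 : ℝ))) :=
    (integrable_indicator_iff Metric.isClosed_closedBall.measurableSet).2
      (integrableOn_const (measure_closedBall_lt_top).ne)
  have := integrable_mul_diff h1 (integrable_kern hn hs0 hs hρ)
  simpa only [norm_sub_rev] using this

/-- The quotient vanishes unless one of the two points lies in the ball, so the kernel cut to the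
ball in either variable dominates. -/
theorem integrable_psi_barrier (hg : Regular Lam g) (hn : 1 ≤ n) (hs0 : 0 < s) (hs : s < 1)
    (hA : 0 < A) (hρ : 0 < ρ) :
    Integrable (fun p : E n × E n =>
      1 / ‖p.1 - p.2‖ ^ n * psi g (holderQuot s (barrier A ρ x₀) p)) := by
  have h1 := integrable_kern_indicator (ρ := ρ) (r := ρ) hn hs0 hs hρ x₀
  have h2 := h1.swap
  have hc : 0 ≤ 4 * (A / ρ ^ s) * g (4 * (A / ρ ^ s)) * ρ ^ s := by
    have := hg.nonneg (by positivity : 0 ≤ 4 * (A / ρ ^ s))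
    positivity
  refine ((h1.add h2).const_mul (4 * (A / ρ ^ s) * g (4 * (A / ρ ^ s)) * ρ ^ s)).mono' ?_ ?_
  · refine AEStronglyMeasurable.mul ?_ ?_
    · exact (by fun_prop : Measurable fun p : E n × E n =>
        1 / ‖p.1 - p.2‖ ^ n).aestronglyMeasurable
    · exact (hg.measurable_psi.comp_aemeasurable
        (aemeasurable_holderQuot s measurable_barrier.aemeasurable)).aestronglyMeasurable
  · refine Eventually.of_forall fun p => ?_
    obtain ⟨x, y⟩ := p
    have hk := kern_nonneg n s hρ (norm_nonneg (x - y))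
    have hk' : 0 ≤ kern n s ρ ‖y - x‖ := by rwa [norm_sub_rev]
    have hi : ∀ z : E n, 0 ≤ (Metric.closedBall x₀ ρ).indicator (fun _ => (1 : ℝ)) z :=
      fun z => indicator_nonneg (fun _ _ => zero_le_one) z
    have hR : 0 ≤ (Metric.closedBall x₀ ρ).indicator (fun _ => (1 : ℝ)) x * kern n s ρ ‖x - y‖ +
        (Metric.closedBall x₀ ρ).indicator (fun _ => (1 : ℝ)) y * kern n s ρ ‖y - x‖ := by
      have := hi x; have := hi y; positivity
    have hψ := hg.psi_nonneg (holderQuot s (barrier A ρ x₀) (x, y))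
    rw [Real.norm_of_nonneg (by positivity)]
    simp only [Pi.add_apply, Function.comp_apply, Prod.swap_prod_mk]
    have zero_case : barrier A ρ x₀ x = barrier A ρ x₀ y →
        1 / ‖x - y‖ ^ n * psi g (holderQuot s (barrier A ρ x₀) (x, y)) = 0 := by
      intro h
      simp [holderQuot, h, psi]
    by_cases hxy : x = y
    · rw [zero_case (by rw [hxy])]; positivity
    have hb := kern_bound_psi (x₀ := x₀) hg hs0 hs hA hρ hxy
    by_cases hx : x ∈ Metric.closedBall x₀ ρ
    · refine hb.trans ?_
      rw [indicator_of_mem hx, one_mul]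
      have := hi y
      gcongr
      linarith [mul_nonneg this hk']
    by_cases hy : y ∈ Metric.closedBall x₀ ρ
    · refine hb.trans ?_
      rw [indicator_of_mem hy, one_mul]
      have := hi x
      rw [norm_sub_rev y x]
      gcongr
      linarith [mul_nonneg this hk]
    · rw [zero_case ?_]
      · positivity
      · rw [Metric.mem_closedBall, not_le, dist_eq_norm] at hx hy
        rw [barrier_eq_zero hρ hx.le, barrier_eq_zero hρ hy.le]

/-- For fixed $z$, translating $x$ by $z$ in the $\eta(x+z)$ term moves the difference from $\eta$
to the barrier. The symmetric sum estimated in `kern_bound_symm` appears, and no regularity of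
$\eta$ is needed. -/
theorem inner_integral_bound (hg : Regular Lam g) (hs0 : 0 < s) (hs : s < 1)
    (hA : 0 < A) (hρ : 0 < ρ) {η : E n → ℝ} (hη : Integrable η) (hη0 : ∀ x, 0 ≤ η x)
    (hsupp : ∀ x, η x ≠ 0 → ‖x - x₀‖ ≤ ρ) {z : E n} (hz0 : z ≠ 0) :
    |∫ x, 1 / ‖z‖ ^ n * (g ((barrier A ρ x₀ x - barrier A ρ x₀ (x + z)) / ‖z‖ ^ s) *
        ((η x - η (x + z)) / ‖z‖ ^ s))|
      ≤ ((6 * 8 ^ Lam + 2) * g (A / ρ ^ s) * ∫ x, η x) * kern n s ρ ‖z‖ := by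
  have hz : 0 < ‖z‖ := norm_pos_iff.2 hz0
  set ψ := barrier A ρ x₀ with hψ
  set a : E n → ℝ := fun x => g ((ψ x - ψ (x + z)) / ‖z‖ ^ s) with ha
  set b : E n → ℝ := fun x => g ((ψ x - ψ (x - z)) / ‖z‖ ^ s) with hb
  have hts : 0 < ‖z‖ ^ s := by positivity
  have hψm : Measurable ψ := measurable_barrier
  have ham : Measurable a := hg.measurable.comp (by fun_prop)
  have hbm : Measurable b := hg.measurable.comp (by fun_prop)
  have hbd : ∀ x y, |g ((ψ x - ψ y) / ‖z‖ ^ s)| ≤ g (A / ‖z‖ ^ s) := by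
    intro x y
    rw [hg.abs_eq, abs_div, abs_of_pos hts]
    refine hg.mono ?_
    gcongr
    exact abs_barrier_sub_le' hA.le _ _
  have hη2 : Integrable (fun x => η (x + z)) := hη.comp_add_right z
  have i1 : Integrable (fun x => a x * η x) :=
    hη.bdd_mul ham.aestronglyMeasurable (Eventually.of_forall fun x => hbd x (x + z))
  have i2 : Integrable (fun x => a x * η (x + z)) :=
    hη2.bdd_mul ham.aestronglyMeasurable (Eventually.of_forall fun x => hbd x (x + z))
  have i3 : Integrable (fun x => b x * η x) :=
    hη.bdd_mul hbm.aestronglyMeasurable (Eventually.of_forall fun x => hbd x (x - z))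
  have e2 : ∫ x, a x * η (x + z) = - ∫ x, b x * η x := by
    rw [← integral_sub_right_eq_self _ z, ← integral_neg]
    refine integral_congr_ae (Eventually.of_forall fun x => ?_)
    simp only [ha, hb, sub_add_cancel]
    rw [← neg_mul, ← hg.odd, ← neg_div, neg_sub]
  have e3 : ∫ x, 1 / ‖z‖ ^ n * (g ((ψ x - ψ (x + z)) / ‖z‖ ^ s) * ((η x - η (x + z)) / ‖z‖ ^ s))
      = ∫ x, 1 / ‖z‖ ^ n * (1 / ‖z‖ ^ s) * (a x + b x) * η x := by
    calc _ = ∫ x, 1 / ‖z‖ ^ n * (1 / ‖z‖ ^ s) * (a x * η x - a x * η (x + z)) := by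
          refine integral_congr_ae (Eventually.of_forall fun x => ?_)
          simp only [ha]; ring
      _ = 1 / ‖z‖ ^ n * (1 / ‖z‖ ^ s) * (∫ x, a x * η x + b x * η x) := by
          rw [integral_const_mul, integral_sub i1 i2, e2, sub_neg_eq_add, integral_add i1 i3]
      _ = _ := by
          rw [← integral_const_mul]
          refine integral_congr_ae (Eventually.of_forall fun x => ?_)
          simp only; ring
  rw [e3]
  have hdom : Integrable (fun x => (6 * 8 ^ Lam + 2) * g (A / ρ ^ s) * kern n s ρ ‖z‖ * η x) :=
    hη.const_mul _
  have := norm_integral_le_of_norm_le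
    (f := fun x => 1 / ‖z‖ ^ n * (1 / ‖z‖ ^ s) * (a x + b x) * η x) hdom
    (Eventually.of_forall fun x => ?_)
  · rw [integral_const_mul, Real.norm_eq_abs] at this
    refine this.trans_eq ?_
    ring
  · rw [Real.norm_eq_abs, abs_mul, abs_of_nonneg (hη0 x)]
    by_cases h0 : η x = 0
    · simp [h0]
    · refine mul_le_mul_of_nonneg_right ?_ (hη0 x)
      rw [abs_mul, abs_of_nonneg (by positivity : 0 ≤ 1 / ‖z‖ ^ n * (1 / ‖z‖ ^ s))]
      exact kern_bound_symm hg hs0 hs hA hρ (hsupp x h0) hz0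

/-- The fractional `g`-Laplacian of the barrier is bounded in the support of the barrier. -/
theorem abs_barrier_integral_le (hg : Regular Lam g) (hn : 1 ≤ n) (hs0 : 0 < s) (hs : s < 1)
    (hA : 0 < A) (hρ : 0 < ρ) {η : E n → ℝ} (hη : Integrable η) (hη0 : ∀ x, 0 ≤ η x)
    (hsupp : ∀ x, η x ≠ 0 → ‖x - x₀‖ ≤ ρ)
    (hF : Integrable (fun p : E n × E n => 1 / ‖p.1 - p.2‖ ^ n *
      (g (holderQuot s (barrier A ρ x₀) p) * holderQuot s η p))) :
    |∫ p : E n × E n, 1 / ‖p.1 - p.2‖ ^ n *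
      (g (holderQuot s (barrier A ρ x₀) p) * holderQuot s η p)|
      ≤ ((6 * 8 ^ Lam + 2) * g (A / ρ ^ s) * ∫ x, η x) * (ρ ^ (-s) * kernInt n s) := by
  have : Nonempty (Fin n) := ⟨⟨0, hn⟩⟩
  rw [← integral_shear]
  rw [← integrable_shear_iff] at hF
  rw [Measure.volume_eq_prod] at hF ⊢
  -- The order matters: $x$ is integrated first with $z$ fixed, so the singularity at $z=0$ is met
  -- only after the cancellation.
  rw [integral_prod_symm _ hF, ← integral_kern n s hρ, ← integral_const_mul, ← Real.norm_eq_abs]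
  refine norm_integral_le_of_norm_le ((integrable_kern hn hs0 hs hρ).const_mul _) ?_
  have hne : ∀ᵐ z : E n, z ≠ 0 := by
    simp [ae_iff, measure_singleton]
  filter_upwards [hne] with z hz
  have := inner_integral_bound (x₀ := x₀) hg hs0 hs hA hρ hη hη0 hsupp hz
  rw [Real.norm_eq_abs]
  refine le_trans (le_of_eq ?_) this
  congr 1
  refine integral_congr_ae (Eventually.of_forall fun x => ?_)
  simp [holderQuot]

end Barrier

/-! ### Pointwise lower bounds for the pairing with the truncation -/

/-- The density of the nonlocal `g`-tail outside `B_R`. -/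
noncomputable def tailDensity {n : ℕ} (s : ℝ) (g : ℝ → ℝ) (R : ℝ) (w : E n → ℝ) (y : E n) : ℝ :=
  (Metric.ball (0 : E n) R)ᶜ.indicator
    (fun y => 1 / ‖y‖ ^ n * (1 / ‖y‖ ^ s) * g (|w y| / ‖y‖ ^ s)) y

/-- The truncation `(w - M + ψ)₊` restricted to a set `B`. -/
noncomputable def truncation {n : ℕ} (B : Set (E n)) (ψ w : E n → ℝ) (M : ℝ) (x : E n) : ℝ :=
  B.indicator (fun x => max 0 (w x - M + ψ x)) x

theorem tailDensity_nonneg {n : ℕ} {s Lam : ℝ} {g : ℝ → ℝ} (hg : Regular Lam g) (R : ℝ)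
    (w : E n → ℝ) (y : E n) : 0 ≤ tailDensity s g R w y := by
  refine indicator_nonneg (fun y _ => ?_) y
  have := hg.nonneg (by positivity : 0 ≤ |w y| / ‖y‖ ^ s)
  positivity

theorem tailDensity_neg {n : ℕ} (s : ℝ) (g : ℝ → ℝ) (R : ℝ) (w : E n → ℝ) :
    tailDensity s g R (fun x => -w x) = tailDensity s g R w := by
  funext y
  simp [tailDensity, abs_neg]

section Geometry

variable {n : ℕ} {s R r : ℝ} {x₀ x y : E n}

theorem dist_lower (hx : x ∈ Metric.ball x₀ (r / 3)) (hy : y ∉ Metric.ball x₀ r) :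
    2 / 3 * ‖y - x₀‖ ≤ ‖x - y‖ := by
  rw [Metric.mem_ball, dist_eq_norm] at hx hy
  have := norm_sub_le_norm_sub_add_norm_sub y x x₀
  rw [norm_sub_rev y x] at this
  linarith

theorem dist_lower_origin (hx₀ : x₀ ∈ Metric.ball (0 : E n) (R / 2)) (hr : r ≤ R / 2)
    (hx : x ∈ Metric.ball x₀ (r / 3)) (hy : y ∉ Metric.ball (0 : E n) R) :
    1 / 3 * ‖y‖ ≤ ‖x - y‖ := by
  rw [Metric.mem_ball, dist_eq_norm] at hx hy hx₀
  rw [sub_zero] at hx₀ hy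
  have h1 := norm_sub_norm_le y x
  have h2 := norm_sub_norm_le x x₀
  rw [norm_sub_rev y x] at h1
  linarith

/-- Comparison of `|x-y|^{-n-s}` with a kernel at comparable distance. -/
theorem kernel_le {c q d : ℝ} (n : ℕ) (hs0 : 0 < s) (hs : s < 1) (hc : 1 ≤ c) (hq : 0 < q)
    (h : q / c ≤ d) : 1 / d ^ s ≤ c * (1 / q ^ s) ∧
      1 / d ^ n * (1 / d ^ s) ≤ c ^ (n + 1) * (1 / q ^ n * (1 / q ^ s)) := by
  have hc0 : 0 < c := by linarith
  have hqc : 0 < q / c := by positivity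
  have h1 : 1 / d ^ s ≤ c * (1 / q ^ s) := by
    calc 1 / d ^ s ≤ 1 / (q / c) ^ s := by gcongr
      _ = c ^ s * (1 / q ^ s) := by rw [Real.div_rpow hq.le hc0.le]; field_simp
      _ ≤ c * (1 / q ^ s) := by
        gcongr
        simpa using Real.rpow_le_rpow_of_exponent_le hc hs.le
  refine ⟨h1, ?_⟩
  have hd : 0 < d := hqc.trans_le h
  calc 1 / d ^ n * (1 / d ^ s) ≤ 1 / (q / c) ^ n * (c * (1 / q ^ s)) := by gcongr
    _ = _ := by rw [div_pow]; field_simp; ring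

end Geometry

section Pointwise

variable {n : ℕ} {s Lam R r M ω e : ℝ} {x₀ : E n} {g : ℝ → ℝ} {ψ w : E n → ℝ} {D : Set (E n)}

/-- The lower bound for the action of the operator on the truncation at a point. -/
noncomputable def lowerDensity {n : ℕ} (s Lam : ℝ) (g : ℝ → ℝ) (R r ω e : ℝ) (x₀ : E n)
    (D : Set (E n)) (w : E n → ℝ) (y : E n) : ℝ :=
  D.indicator (fun _ => 1 / (2 * r) ^ n * (1 / (2 * r) ^ s) * g (ω / r ^ s / 8)) y
    - 2 ^ (n + 1) * (10 * e * g (ω / r ^ s)) * kern n s r ‖y - x₀‖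
    - 3 ^ (n + 1) * 9 ^ Lam * tailDensity s g R w y

/-- The growth conditions on `w` used at almost every point. -/
structure GrowthAt (s R r M ω e : ℝ) (x₀ : E n) (D : Set (E n)) (w : E n → ℝ) (x : E n) : Prop where
  inside : x ∈ Metric.ball x₀ r → w x ≤ M
  good : x ∈ D → w x ≤ M - ω / 2
  outside : x ∉ Metric.ball x₀ r → w x ≤ M + e * ω * (‖x - x₀‖ / r) ^ s +
    (Metric.ball (0 : E n) R)ᶜ.indicator (fun x => |w x|) x

theorem truncation_nonneg (B : Set (E n)) (ψ w : E n → ℝ) (M : ℝ) (x : E n) :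
    0 ≤ truncation B ψ w M x := indicator_nonneg (fun _ _ => le_max_left _ _) x

/-- On the larger ball the truncation is the positive part of `w - M + ψ`. -/
theorem truncation_eq (hψ : ∀ x, x ∉ Metric.ball x₀ (r / 3) → ψ x = 0) {x : E n}
    (hx : w x ≤ M) : truncation (Metric.ball x₀ (r / 3)) ψ w M x = max 0 (w x - M + ψ x) := by
  unfold truncation
  by_cases h : x ∈ Metric.ball x₀ (r / 3)
  · rw [indicator_of_mem h]
  · rw [indicator_of_notMem h, hψ x h, max_eq_left (by linarith)]

theorem of_truncation_ne_zero {B : Set (E n)} {x : E n} (h : truncation B ψ w M x ≠ 0) :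
    x ∈ B ∧ truncation B ψ w M x = w x - M + ψ x ∧ 0 < w x - M + ψ x := by
  unfold truncation at h ⊢
  have hx : x ∈ B := by by_contra h'; exact h (indicator_of_notMem h' _)
  rw [indicator_of_mem hx] at h ⊢
  have h1 : 0 < w x - M + ψ x := by
    by_contra h'
    exact h (max_eq_left (not_lt.1 h'))
  exact ⟨hx, max_eq_right h1.le, h1⟩

theorem truncation_le {B : Set (E n)} (hψ0 : ∀ x, 0 ≤ ψ x) {x : E n} (hx : x ∈ B → w x ≤ M) :
    truncation B ψ w M x ≤ ψ x := by
  by_cases h : truncation B ψ w M x = 0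
  · rw [h]; exact hψ0 x
  · obtain ⟨h1, h2, -⟩ := of_truncation_ne_zero h
    rw [h2]; linarith [hx h1]

/-- Monotonicity of the operator. -/
theorem monotone_pairing (hg : Regular Lam g) {a b c d t : ℝ} (ht : 0 ≤ t) {p q : ℝ}
    (hp : p = max 0 (a + c)) (hq : q = max 0 (b + d)) :
    0 ≤ (g ((a - b) / t) + g ((c - d) / t)) * ((p - q) / t) := by
  have key : ∀ m k : ℝ, 0 ≤ m + k → 0 ≤ g m + g k := by
    intro m k h
    have : g (-k) ≤ g m := hg.mono (by linarith)
    rw [hg.odd] at this; linarith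
  have key2 : ∀ m k : ℝ, m + k ≤ 0 → g m + g k ≤ 0 := by
    intro m k h
    have : g m ≤ g (-k) := hg.mono (by linarith)
    rw [hg.odd] at this; linarith
  rcases le_total (b + d) (a + c) with h | h
  · refine mul_nonneg (key _ _ ?_) (div_nonneg ?_ ht)
    · rw [← add_div]; exact div_nonneg (by linarith) ht
    · rw [hp, hq, sub_nonneg]; exact max_le_max_left _ h
  · refine mul_nonneg_of_nonpos_of_nonpos (key2 _ _ ?_) (div_nonpos_of_nonpos_of_nonneg ?_ ht)
    · rw [← add_div]; exact div_nonpos_of_nonpos_of_nonneg (by linarith) ht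
    · rw [hp, hq, sub_nonpos]; exact max_le_max_left _ h

theorem lowerDensity_le_indicator (hg : Regular Lam g) (hω : 0 ≤ ω) (hr : 0 < r) (he : 0 ≤ e)
    (y : E n) : lowerDensity s Lam g R r ω e x₀ D w y ≤
      D.indicator (fun _ => 1 / (2 * r) ^ n * (1 / (2 * r) ^ s) * g (ω / r ^ s / 8)) y := by
  unfold lowerDensity
  have h1 := hg.nonneg (by positivity : 0 ≤ ω / r ^ s)
  have h2 := kern_nonneg n s hr (norm_nonneg (y - x₀))
  have h3 := tailDensity_nonneg (s := s) hg R w y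
  have h4 : 0 ≤ 2 ^ (n + 1) * (10 * e * g (ω / r ^ s)) * kern n s r ‖y - x₀‖ := by positivity
  have h5 : 0 ≤ 3 ^ (n + 1) * 9 ^ Lam * tailDensity s g R w y := by positivity
  linarith

/-- The source of the gain. The jump $w(x)-w(y)$ is at least $(M-w(y))-\psi(x)$, and `half_le` lets
the pairing of $\psi$ compensate the loss $\psi(x)$ whatever its size. The $8$ collects the drop
$\omega/2$, the bound $|x-y|^s\le2r^s$ and the halving. -/
theorem pairing_good (hg : Regular Lam g) (hs0 : 0 < s) (hs : s < 1) (hω : 0 < ω) (hr : 0 < r)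
    (hψ0 : ∀ x, 0 ≤ ψ x) {x y : E n}
    (hx : x ∈ Metric.ball x₀ (r / 3)) (hx1 : M - ψ x ≤ w x)
    (hy1 : w y ≤ M - ω / 2) (hy2 : y ∈ Metric.ball x₀ r) (hy3 : y ∉ Metric.ball x₀ (r / 2)) :
    1 / (2 * r) ^ n * (1 / (2 * r) ^ s) * g (ω / r ^ s / 8) ≤
      1 / ‖x - y‖ ^ n * (1 / ‖x - y‖ ^ s) *
        (g ((w x - w y) / ‖x - y‖ ^ s) + g (ψ x / ‖x - y‖ ^ s)) := by
  rw [Metric.mem_ball, dist_eq_norm] at hx hy2 hy3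
  have hd1 : ‖x - y‖ ≤ 2 * r := by
    have := norm_sub_le_norm_sub_add_norm_sub x x₀ y
    rw [norm_sub_rev x₀ y] at this
    linarith
  have hd0 : 0 < ‖x - y‖ := by
    have := norm_sub_le_norm_sub_add_norm_sub y x x₀
    rw [norm_sub_rev y x] at this
    linarith
  set d := ‖x - y‖ with hd
  have hds : 0 < d ^ s := by positivity
  have hrs : 0 < r ^ s := by positivity
  have hd2 : d ^ s ≤ 2 * r ^ s := by
    calc d ^ s ≤ (2 * r) ^ s := by gcongr
      _ = 2 ^ s * r ^ s := Real.mul_rpow (by norm_num) hr.le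
      _ ≤ 2 * r ^ s := by
        gcongr
        simpa using Real.rpow_le_rpow_of_exponent_le (one_le_two) hs.le
  have h1 : g ((M - w y) / d ^ s / 2) ≤ g ((M - w y) / d ^ s - ψ x / d ^ s) + g (ψ x / d ^ s) :=
    hg.half_le (div_nonneg (hψ0 x) hds.le) (div_nonneg (by linarith) hds.le)
  have h2 : g ((M - w y) / d ^ s - ψ x / d ^ s) ≤ g ((w x - w y) / d ^ s) := by
    refine hg.mono ?_
    rw [← sub_div]
    exact div_le_div_of_nonneg_right (by linarith) hds.le
  have h3 : g (ω / r ^ s / 8) ≤ g ((M - w y) / d ^ s / 2) := by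
    refine hg.mono ?_
    calc ω / r ^ s / 8 = (ω / 2) / (2 * r ^ s) / 2 := by field_simp; norm_num
      _ ≤ (M - w y) / d ^ s / 2 := by gcongr <;> linarith
  have h0 := hg.nonneg (by positivity : 0 ≤ ω / r ^ s / 8)
  have h4 : g (ω / r ^ s / 8) ≤ g ((w x - w y) / d ^ s) + g (ψ x / d ^ s) := by linarith
  gcongr

/-- Outside $B_R$ the distance to $x$ is at least $|y|/3$, so the kernel can be recentred at the
origin. In $9^\Lambda$ one factor $3$ is this comparison and the other comes from splitting $g$ of a
sum of three terms. -/
theorem far_tail_le (hg : Regular Lam g) (hs0 : 0 < s) (hs : s < 1) (hr : 0 < r)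
    (hR : r ≤ R / 2) (hx₀ : x₀ ∈ Metric.ball (0 : E n) (R / 2)) {x y : E n}
    (hx : x ∈ Metric.ball x₀ (r / 3)) (hy : y ∉ Metric.ball x₀ r) :
    1 / ‖x - y‖ ^ n * (1 / ‖x - y‖ ^ s) *
      g (3 * ((Metric.ball (0 : E n) R)ᶜ.indicator (fun x => |w x|) y / ‖x - y‖ ^ s)) ≤
      3 ^ (n + 1) * 9 ^ Lam * tailDensity s g R w y := by
  have hd := dist_lower hx hy
  have hyr : r ≤ ‖y - x₀‖ := by rwa [Metric.mem_ball, dist_eq_norm, not_lt] at hy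
  set d := ‖x - y‖ with hdd
  have hd0 : 0 < d := by linarith
  have hds : 0 < d ^ s := by positivity
  set h := (Metric.ball (0 : E n) R)ᶜ.indicator (fun x => |w x|) y with hh
  by_cases hyR : y ∈ Metric.ball (0 : E n) R
  · have e1 : h = 0 := by rw [hh]; exact indicator_of_notMem (by simpa using hyR) _
    rw [e1, zero_div, mul_zero, hg.zero, mul_zero]
    have := tailDensity_nonneg (s := s) hg R w y
    positivity
  · have e1 : h = |w y| := by rw [hh]; exact indicator_of_mem hyR _
    have e2 : tailDensity s g R w y = 1 / ‖y‖ ^ n * (1 / ‖y‖ ^ s) * g (|w y| / ‖y‖ ^ s) :=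
      indicator_of_mem hyR _
    rw [e1, e2]
    have hy0 : 0 < ‖y‖ := by
      rw [Metric.mem_ball, dist_zero_right, not_lt] at hyR
      linarith
    have hys : 0 < ‖y‖ ^ s := by positivity
    obtain ⟨m1, m2⟩ := kernel_le (s := s) n hs0 hs (c := 3) (by norm_num) hy0
      (by linarith [dist_lower_origin hx₀ hR hx hyR] : ‖y‖ / 3 ≤ d)
    have m3 : g (3 * (|w y| / d ^ s)) ≤ 9 ^ Lam * g (|w y| / ‖y‖ ^ s) := by
      refine le_trans (hg.mono ?_) (hg.doubling 9 _ (by norm_num) (by positivity))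
      calc 3 * (|w y| / d ^ s) = 3 * |w y| * (1 / d ^ s) := by ring
        _ ≤ 3 * |w y| * (3 * (1 / ‖y‖ ^ s)) := by gcongr
        _ = _ := by ring
    have m4 := hg.nonneg (by positivity : 0 ≤ 3 * (|w y| / d ^ s))
    calc _ ≤ (3 ^ (n + 1) * (1 / ‖y‖ ^ n * (1 / ‖y‖ ^ s))) * (9 ^ Lam * g (|w y| / ‖y‖ ^ s)) := by
          gcongr
      _ = _ := by ring

/-- Here $w(x)-w(y)$ may be negative, but only through the height of $\psi$, the tolerated growth of
$w$ and its values outside $B_R$. The first two cost $O(e)$ because $g$ is sublinear under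
contraction; the third is charged to the tail. -/
theorem pairing_far (hg : Regular Lam g) (hs0 : 0 < s) (hs : s < 1) (hω : 0 < ω) (hr : 0 < r)
    (hR : r ≤ R / 2) (hx₀ : x₀ ∈ Metric.ball (0 : E n) (R / 2)) (he0 : 0 ≤ e) (he : e ≤ 1 / 5)
    (hψ1 : ∀ x, ψ x ≤ e * ω) {x y : E n}
    (hx : x ∈ Metric.ball x₀ (r / 3)) (hx1 : M - ψ x ≤ w x)
    (hy : y ∉ Metric.ball x₀ r)
    (hy1 : w y ≤ M + e * ω * (‖y - x₀‖ / r) ^ s +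
      (Metric.ball (0 : E n) R)ᶜ.indicator (fun x => |w x|) y) :
    - (2 ^ (n + 1) * (10 * e * g (ω / r ^ s)) * kern n s r ‖y - x₀‖)
      - 3 ^ (n + 1) * 9 ^ Lam * tailDensity s g R w y ≤
      1 / ‖x - y‖ ^ n * (1 / ‖x - y‖ ^ s) * g ((w x - w y) / ‖x - y‖ ^ s) := by
  have hd := dist_lower hx hy
  have hyr : r ≤ ‖y - x₀‖ := by rwa [Metric.mem_ball, dist_eq_norm, not_lt] at hy
  have hq0 : 0 < ‖y - x₀‖ := by linarith
  rw [kern_of_ge hs hr hyr]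
  set q := ‖y - x₀‖ with hq
  set d := ‖x - y‖ with hdd
  have hd0 : 0 < d := by linarith
  have hds : 0 < d ^ s := by positivity
  have hrs : 0 < r ^ s := by positivity
  have hqs : 0 < q ^ s := by positivity
  set h := (Metric.ball (0 : E n) R)ᶜ.indicator (fun x => |w x|) y with hh
  have hh0 : 0 ≤ h := indicator_nonneg (fun _ _ => abs_nonneg _) y
  obtain ⟨k1, k2⟩ := kernel_le (s := s) n hs0 hs (c := 3 / 2) (by norm_num) hq0
    (by linarith : q / (3 / 2) ≤ d)
  have hd_rs : 1 / d ^ s ≤ 3 / 2 * (1 / r ^ s) := k1.trans (by gcongr)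
  set t₀ := ω / r ^ s with ht₀
  have ht0 : 0 ≤ t₀ := by positivity
  have hg0 := hg.nonneg ht0
  -- This is where $e\le1/5$ is needed: the contraction factor $5e$ must not exceed $1$. The $5$
  -- rounds up $3\cdot\frac32$.
  have hga : g (5 * e * t₀) ≤ 5 * e * g t₀ := hg.sub _ _ (by positivity) (by linarith) ht0
  have htail := far_tail_le (w := w) hg hs0 hs hr hR hx₀ hx hy
  have hB : 3 * (e * ω * (q / r) ^ s / d ^ s) ≤ 5 * e * t₀ := by
    calc 3 * (e * ω * (q / r) ^ s / d ^ s) = 3 * (e * ω) * (q / r) ^ s * (1 / d ^ s) := by ring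
      _ ≤ 3 * (e * ω) * (q / r) ^ s * (3 / 2 * (1 / q ^ s)) := by gcongr
      _ = (9 / 2) * e * t₀ := by rw [ht₀, Real.div_rpow hq0.le hr.le]; field_simp; ring
      _ ≤ _ := by gcongr; norm_num
  have hgA : g (3 * (e * ω / d ^ s)) ≤ 5 * e * g t₀ := by
    refine le_trans (hg.mono ?_) hga
    calc 3 * (e * ω / d ^ s) = 3 * (e * ω) * (1 / d ^ s) := by ring
      _ ≤ 3 * (e * ω) * (3 / 2 * (1 / r ^ s)) := by gcongr
      _ = (9 / 2) * e * t₀ := by rw [ht₀]; ring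
      _ ≤ _ := by gcongr; norm_num
  have hgB : g (3 * (e * ω * (q / r) ^ s / d ^ s)) ≤ 5 * e * g t₀ := (hg.mono hB).trans hga
  have hsum := hg.add_three_le (a := e * ω / d ^ s) (b := e * ω * (q / r) ^ s / d ^ s)
    (c := h / d ^ s) (by positivity) (by positivity) (by positivity)
  have hlow : - g (e * ω / d ^ s + e * ω * (q / r) ^ s / d ^ s + h / d ^ s) ≤
      g ((w x - w y) / d ^ s) := by
    rw [← hg.odd]
    refine hg.mono ?_
    rw [← add_div, ← add_div, ← neg_div]
    gcongr
    linarith [hψ1 x]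
  have hW : 0 ≤ 1 / d ^ n * (1 / d ^ s) := by positivity
  have step : 1 / d ^ n * (1 / d ^ s) * (10 * e * g t₀) ≤
      2 ^ (n + 1) * (10 * e * g t₀) * (1 / q ^ n * (1 / q ^ s)) := by
    calc _ ≤ (3 / 2) ^ (n + 1) * (1 / q ^ n * (1 / q ^ s)) * (10 * e * g t₀) := by gcongr
      _ ≤ 2 ^ (n + 1) * (1 / q ^ n * (1 / q ^ s)) * (10 * e * g t₀) := by gcongr; norm_num
      _ = _ := by ring
  have hfin : - (10 * e * g t₀) - g (3 * (h / d ^ s)) ≤ g ((w x - w y) / d ^ s) := by linarith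
  have := mul_le_mul_of_nonneg_left hfin hW
  rw [mul_sub] at this
  linarith

/-- The pointwise lower bound for the pairing with the truncation. -/
theorem pairing_lower (hg : Regular Lam g) (hs0 : 0 < s) (hs : s < 1) (hω : 0 < ω) (hr : 0 < r)
    (hR : r ≤ R / 2) (hx₀ : x₀ ∈ Metric.ball (0 : E n) (R / 2)) (he0 : 0 ≤ e) (he : e ≤ 1 / 5)
    (hψ : ∀ x, x ∉ Metric.ball x₀ (r / 3) → ψ x = 0)
    (hψ0 : ∀ x, 0 ≤ ψ x) (hψ1 : ∀ x, ψ x ≤ e * ω)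
    (hD1 : D ⊆ Metric.ball x₀ r) (hD2 : ∀ x ∈ D, x ∉ Metric.ball x₀ (r / 2)) {η : E n → ℝ}
    (hη : η = truncation (Metric.ball x₀ (r / 3)) ψ w M)
    {x y : E n} (hx : GrowthAt s R r M ω e x₀ D w x) (hy : GrowthAt s R r M ω e x₀ D w y) :
    η x * lowerDensity s Lam g R r ω e x₀ D w y + η y * lowerDensity s Lam g R r ω e x₀ D w x ≤
      1 / ‖x - y‖ ^ n * (g (holderQuot s w (x, y)) * holderQuot s η (x, y)) +
      1 / ‖x - y‖ ^ n * (g (holderQuot s ψ (x, y)) * holderQuot s η (x, y)) := by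
  have hsub : Metric.ball x₀ (r / 3) ⊆ Metric.ball x₀ (r / 2) :=
    Metric.ball_subset_ball (by linarith)
  have hsub2 : Metric.ball x₀ (r / 3) ⊆ Metric.ball x₀ r :=
    Metric.ball_subset_ball (by linarith)
  have hη0 : ∀ x, 0 ≤ η x := fun x => by rw [hη]; exact truncation_nonneg _ _ _ _ _
  have hneg : ∀ z, z ∉ D → lowerDensity s Lam g R r ω e x₀ D w z ≤ 0 := by
    intro z hz
    have := lowerDensity_le_indicator (s := s) (R := R) (x₀ := x₀) (D := D) (w := w) hg hω.le hr he0 z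
    rwa [indicator_of_notMem hz] at this
  have main : ∀ x y, GrowthAt s R r M ω e x₀ D w x → GrowthAt s R r M ω e x₀ D w y → η x ≠ 0 →
      η x * lowerDensity s Lam g R r ω e x₀ D w y + η y * lowerDensity s Lam g R r ω e x₀ D w x ≤
      1 / ‖x - y‖ ^ n * (g (holderQuot s w (x, y)) * holderQuot s η (x, y)) +
      1 / ‖x - y‖ ^ n * (g (holderQuot s ψ (x, y)) * holderQuot s η (x, y)) := by
    intro x y hx hy hx0
    have hx0' := hx0
    rw [hη] at hx0'
    obtain ⟨hxB, hx2, hx3⟩ := of_truncation_ne_zero hx0'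
    have hxD : x ∉ D := fun h => hD2 x h (hsub hxB)
    have hxp := hη0 x
    by_cases hyr : y ∈ Metric.ball x₀ r
    · by_cases hyD : y ∈ D
      · have hyη : η y = 0 := by
          by_contra hc
          rw [hη] at hc
          exact hD2 y hyD (hsub (of_truncation_ne_zero hc).1)
        have hψy : ψ y = 0 := hψ y fun h => hD2 y hyD (hsub h)
        have h1 := pairing_good (n := n) hg hs0 hs hω hr hψ0 hxB (by linarith) (hy.good hyD) hyr
          (hD2 y hyD)
        have h2 := lowerDensity_le_indicator (s := s) (R := R) (x₀ := x₀) (D := D) (w := w)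
          hg hω.le hr he0 y
        rw [indicator_of_mem hyD] at h2
        have h3 := mul_le_mul_of_nonneg_left (h2.trans h1) hxp
        simp only [holderQuot, hyη, hψy, sub_zero, zero_mul, add_zero]
        refine h3.trans_eq ?_
        ring
      · have hRHS : η x * lowerDensity s Lam g R r ω e x₀ D w y +
            η y * lowerDensity s Lam g R r ω e x₀ D w x ≤ 0 :=
          add_nonpos (mul_nonpos_of_nonneg_of_nonpos hxp (hneg y hyD))
            (mul_nonpos_of_nonneg_of_nonpos (hη0 y) (hneg x hxD))
        refine hRHS.trans ?_
        -- With both points in $B_r(x_0)$ and neither in $D$ the claimed bound is nonpositive, so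
        -- the sign of the monotone pairing is all that is required.
        have h1 := monotone_pairing hg (a := w x - M) (b := w y - M) (c := ψ x) (d := ψ y)
          (t := ‖x - y‖ ^ s) (by positivity)
          (hη ▸ truncation_eq hψ (hx.inside (hsub2 hxB)) : η x = _)
          (hη ▸ truncation_eq hψ (hy.inside hyr) : η y = _)
        rw [sub_sub_sub_cancel_right] at h1
        rw [← mul_add, ← add_mul]
        exact mul_nonneg (by positivity) h1
    · have hyη : η y = 0 := by
        by_contra hc
        rw [hη] at hc
        exact hyr (hsub2 (of_truncation_ne_zero hc).1)
      have hψy : ψ y = 0 := hψ y fun h => hyr (hsub2 h)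
      have h1 := pairing_far (n := n) hg hs0 hs hω hr hR hx₀ he0 he hψ1 hxB (by linarith) hyr
        (hy.outside hyr)
      have h2 : lowerDensity s Lam g R r ω e x₀ D w y =
          - (2 ^ (n + 1) * (10 * e * g (ω / r ^ s)) * kern n s r ‖y - x₀‖)
          - 3 ^ (n + 1) * 9 ^ Lam * tailDensity s g R w y := by
        unfold lowerDensity
        rw [indicator_of_notMem fun h => hyr (hD1 h), zero_sub]
      rw [← h2] at h1
      have h3 := mul_le_mul_of_nonneg_left h1 hxp
      have h4 : 0 ≤ 1 / ‖x - y‖ ^ n * (g (ψ x / ‖x - y‖ ^ s) * (η x / ‖x - y‖ ^ s)) := by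
        have := hg.nonneg (div_nonneg (hψ0 x) (by positivity : 0 ≤ ‖x - y‖ ^ s))
        positivity
      simp only [holderQuot, hyη, hψy, sub_zero, zero_mul, add_zero]
      refine h3.trans ?_
      refine le_trans (le_of_eq ?_) (le_add_of_nonneg_right h4)
      ring
  by_cases hx0 : η x = 0
  · by_cases hy0 : η y = 0
    · simp [holderQuot, hx0, hy0]
    -- Both factors of each pairing are antisymmetric in $(x,y)$, so the roles can be exchanged.
    · have h := main y x hy hx hy0
      have hswap : ∀ f : E n → ℝ, holderQuot s f (y, x) = - holderQuot s f (x, y) := by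
        intro f
        simp only [holderQuot]
        rw [norm_sub_rev y x, ← neg_div, neg_sub]
      rw [hswap, hswap, hswap, hg.odd, hg.odd, neg_mul_neg, neg_mul_neg, norm_sub_rev y x] at h
      linarith
  · exact main x y hx hy hx0

end Pointwise

/-! ### Admissibility of the truncation as a test function -/

theorem ae_prod_of_ae {n : ℕ} {p : E n → Prop} (h : ∀ᵐ x, p x) :
    ∀ᵐ z : E n × E n, p z.1 ∧ p z.2 := by
  have h1 : ∀ᵐ z : E n × E n, p z.1 := Measure.quasiMeasurePreserving_fst.ae h
  have h2 : ∀ᵐ z : E n × E n, p z.2 := Measure.quasiMeasurePreserving_snd.ae h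
  exact h1.and h2

theorem integrableOn_psi_of_memWtilde {n : ℕ} {s Lam : ℝ} {g : ℝ → ℝ} (hg : Regular Lam g)
    {Ω : Set (E n)} (hΩ : MeasurableSet Ω) {w : E n → ℝ} (hw : MemWtilde s g Ω w) :
    IntegrableOn (fun p : E n × E n => 1 / ‖p.1 - p.2‖ ^ n * psi g (holderQuot s w p)) (Ω ×ˢ Ω) := by
  obtain ⟨⟨hm, -⟩, U, hU, hΩU, hfin⟩ := hw
  have h1 : luxNorm g ((mu n).restrict (U ×ˢ U)) (holderQuot s w) < ∞ :=
    lt_of_le_of_lt (le_add_left le_rfl) (lt_of_le_of_lt le_self_add hfin)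
  have h2 : AEMeasurable (holderQuot s w) ((mu n).restrict (U ×ˢ U)) :=
    ((aemeasurable_holderQuot s hm).mono_ac (mu_absolutelyContinuous n)).restrict
  have h3 := hg.psi_integrable_of_luxNorm h2 h1
  have h4 : IntegrableOn (fun p => psi g (holderQuot s w p)) (Ω ×ˢ Ω) (mu n) :=
    IntegrableOn.mono_set h3
      (prod_mono (subset_closure.trans hΩU) (subset_closure.trans hΩU))
  exact (integrableOn_mu_iff _ (hΩ.prod hΩ)).1 h4

section Truncation

variable {n : ℕ} {s Lam R r M A N : ℝ} {x₀ : E n} {g : ℝ → ℝ} {w : E n → ℝ}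

theorem far_psi_le (hg : Regular Lam g) (hs0 : 0 < s) (hs : s < 1) (hA : 0 < A) (hr : 0 < r)
    {x y : E n} (hx : x ∈ Metric.ball x₀ (r / 3)) (hy : y ∉ Metric.ball x₀ r) {c : ℝ}
    (hc0 : 0 ≤ c) (hc : c ≤ A) :
    1 / ‖x - y‖ ^ n * psi g (c / ‖x - y‖ ^ s) ≤
      (A / (r / 3) ^ s * g (A / (r / 3) ^ s) * (r / 3) ^ s) * kern n s (r / 3) ‖x - y‖ := by
  have hd := dist_lower hx hy
  have hyr : r ≤ ‖y - x₀‖ := by rwa [Metric.mem_ball, dist_eq_norm, not_lt] at hy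
  have hd0 : r / 3 ≤ ‖x - y‖ := by linarith
  have hρ : 0 < r / 3 := by positivity
  rw [kern_of_ge hs hρ hd0]
  set d := ‖x - y‖
  set ρ := r / 3
  have hd' : 0 < d := by linarith
  have hds : 0 < d ^ s := by positivity
  have hρs : 0 < ρ ^ s := by positivity
  set m := A / ρ ^ s with hm
  have hm0 : 0 ≤ m := by positivity
  have hgm := hg.nonneg hm0
  have h1 : |c / d ^ s| ≤ ρ ^ s / d ^ s * m := by
    rw [abs_of_nonneg (by positivity)]
    calc c / d ^ s ≤ A / d ^ s := by gcongr
      _ = _ := by rw [hm]; field_simp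
  have hr1 : ρ ^ s / d ^ s ≤ 1 := by rw [div_le_one hds]; gcongr
  have h2 : psi g (c / d ^ s) ≤ (ρ ^ s / d ^ s) * (m * g m) := by
    unfold psi
    calc _ ≤ (ρ ^ s / d ^ s * m) * g m := by
          refine mul_le_mul h1 (hg.mono (h1.trans (mul_le_of_le_one_left hm0 hr1)))
            (hg.nonneg (abs_nonneg _)) (by positivity)
      _ = _ := by ring
  calc _ ≤ 1 / d ^ n * ((ρ ^ s / d ^ s) * (m * g m)) :=
        mul_le_mul_of_nonneg_left h2 (by positivity)
    _ = _ := by ring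

theorem aemeasurable_truncation {B : Set (E n)} (hB : MeasurableSet B) {ψ : E n → ℝ}
    (hψ : Measurable ψ) (hw : AEMeasurable w) : AEMeasurable (truncation B ψ w M) := by
  unfold truncation
  exact (aemeasurable_const.max ((hw.sub_const M).add hψ.aemeasurable)).indicator hB

/-- Inside $B_r(x_0)$ the truncation equals $(w-M+\psi)_+$ without any cut, since $w\le M$ there;
its quotient is controlled by those of $w$ and $\psi$. Otherwise one point is in $B_{r/3}(x_0)$ and
the other outside $B_r(x_0)$, and the kernel is not singular. -/
theorem integrable_psi_truncation (hg : Regular Lam g) (hn : 1 ≤ n) (hs0 : 0 < s) (hs : s < 1)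
    (hA : 0 < A) (hr : 0 < r) (hwm : AEMeasurable w)
    (hw : IntegrableOn (fun p : E n × E n => 1 / ‖p.1 - p.2‖ ^ n * psi g (holderQuot s w p))
      (Metric.ball x₀ r ×ˢ Metric.ball x₀ r))
    (hM : ∀ᵐ x, x ∈ Metric.ball x₀ r → w x ≤ M) :
    Integrable (fun p : E n × E n => 1 / ‖p.1 - p.2‖ ^ n *
      psi g (holderQuot s (truncation (Metric.ball x₀ (r / 3)) (barrier A (r / 3) x₀) w M) p)) := by
  have hρ : 0 < r / 3 := by positivity
  set η := truncation (Metric.ball x₀ (r / 3)) (barrier A (r / 3) x₀) w M with hη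
  set ψ := barrier A (r / 3) x₀ with hψ
  have hψz : ∀ x, x ∉ Metric.ball x₀ (r / 3) → ψ x = 0 := by
    intro x hx
    rw [Metric.mem_ball, dist_eq_norm, not_lt] at hx
    exact barrier_eq_zero hρ hx
  have hsub2 : Metric.ball x₀ (r / 3) ⊆ Metric.ball x₀ r :=
    Metric.ball_subset_ball (by linarith)
  have hηm : AEMeasurable η :=
    aemeasurable_truncation measurableSet_ball measurable_barrier hwm
  have i1 := integrable_kern_indicator (r := r / 3) hn hs0 hs hρ x₀
  have i2 := i1.swap
  have i3 := integrable_psi_barrier (x₀ := x₀) hg hn hs0 hs hA hρ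
  have i4 := (integrable_indicator_iff (measurableSet_ball.prod measurableSet_ball)).2 hw
  set C' := A / (r / 3) ^ s * g (A / (r / 3) ^ s) * (r / 3) ^ s with hC'
  have hC'0 : 0 ≤ C' := by
    have := hg.nonneg (by positivity : 0 ≤ A / (r / 3) ^ s)
    positivity
  have h2L : (0 : ℝ) < 2 ^ Lam := by positivity
  refine (((i4.add i3).const_mul (2 * 2 ^ Lam)).add ((i1.add i2).const_mul C')).mono' ?_ ?_
  · refine AEStronglyMeasurable.mul ?_ ?_
    · exact (by fun_prop : Measurable fun p : E n × E n =>
        1 / ‖p.1 - p.2‖ ^ n).aestronglyMeasurable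
    · exact (hg.measurable_psi.comp_aemeasurable
        (aemeasurable_holderQuot s hηm)).aestronglyMeasurable
  filter_upwards [ae_prod_of_ae hM] with p hp
  obtain ⟨x, y⟩ := p
  obtain ⟨hpx, hpy⟩ := hp
  simp only at hpx hpy
  have hk := kern_nonneg n s hρ (norm_nonneg (x - y))
  have hk' : 0 ≤ kern n s (r / 3) ‖y - x‖ := by rwa [norm_sub_rev]
  have hi : ∀ z : E n, 0 ≤ (Metric.closedBall x₀ (r / 3)).indicator (fun _ => (1 : ℝ)) z :=
    fun z => indicator_nonneg (fun _ _ => zero_le_one) z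
  have hB1 := mul_nonneg (hi x) hk
  have hB2 := mul_nonneg (hi y) hk'
  have hψη := hg.psi_nonneg (holderQuot s η (x, y))
  have hψψ : 0 ≤ 1 / ‖x - y‖ ^ n * psi g (holderQuot s ψ (x, y)) := by
    have := hg.psi_nonneg (holderQuot s ψ (x, y)); positivity
  have hI : 0 ≤ (Metric.ball x₀ r ×ˢ Metric.ball x₀ r).indicator
      (fun p : E n × E n => 1 / ‖p.1 - p.2‖ ^ n * psi g (holderQuot s w p)) (x, y) := by
    refine indicator_nonneg (fun p _ => ?_) _
    have := hg.psi_nonneg (holderQuot s w p); positivity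
  rw [Real.norm_of_nonneg (by positivity)]
  simp only [Pi.add_apply, Function.comp_apply, Prod.swap_prod_mk]
  have hηle : ∀ z, (z ∈ Metric.ball x₀ r → w z ≤ M) → η z ≤ A := fun z hz =>
    (truncation_le (fun x => barrier_nonneg hA.le x) (fun h => hz (hsub2 h))).trans
      (barrier_le hA.le z)
  by_cases hx : x ∈ Metric.ball x₀ r
  · by_cases hy : y ∈ Metric.ball x₀ r
    · rw [indicator_of_mem (mk_mem_prod hx hy)]
      have e1 : η x = max 0 (w x - M + ψ x) := truncation_eq hψz (hpx hx)
      have e2 : η y = max 0 (w y - M + ψ y) := truncation_eq hψz (hpy hy)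
      have h1 : psi g (holderQuot s η (x, y)) ≤
          2 * 2 ^ Lam * (psi g (holderQuot s w (x, y)) + psi g (holderQuot s ψ (x, y))) := by
        refine le_trans (hg.abs_mul_mono (b := holderQuot s w (x, y) + holderQuot s ψ (x, y)) ?_)
          (hg.abs_mul_add_le _ _)
        simp only [holderQuot]
        rw [← add_div, abs_div, abs_div]
        refine div_le_div_of_nonneg_right ?_ (abs_nonneg _)
        rw [e1, e2, max_comm, max_comm 0 (w y - M + ψ y)]
        have h0 := abs_max_sub_max_le_abs (w x - M + ψ x) (w y - M + ψ y) 0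
        rwa [show w x - M + ψ x - (w y - M + ψ y) = w x - w y + (ψ x - ψ y) by ring] at h0
      have h2 := mul_le_mul_of_nonneg_left h1 (by positivity : 0 ≤ 1 / ‖x - y‖ ^ n)
      have h3 : 0 ≤ C' * ((Metric.closedBall x₀ (r / 3)).indicator (fun _ => (1 : ℝ)) x *
        kern n s (r / 3) ‖x - y‖ + (Metric.closedBall x₀ (r / 3)).indicator (fun _ => (1 : ℝ)) y *
        kern n s (r / 3) ‖y - x‖) := by positivity
      refine h2.trans ?_
      simp only
      linarith
    · have hyη : η y = 0 := indicator_of_notMem (fun h => hy (hsub2 h)) _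
      by_cases hxη : η x = 0
      · have : 1 / ‖x - y‖ ^ n * psi g (holderQuot s η (x, y)) = 0 := by
          simp [holderQuot, hxη, hyη, psi]
        rw [this]; positivity
      · have hxB := (of_truncation_ne_zero hxη).1
        have := far_psi_le (n := n) hg hs0 hs hA hr hxB hy
          (truncation_nonneg (Metric.ball x₀ (r / 3)) ψ w M x) (hηle x hpx)
        rw [← hη] at this
        rw [indicator_of_mem (Metric.ball_subset_closedBall hxB), one_mul]
        simp only [holderQuot, hyη, sub_zero]
        have h3 := mul_nonneg hC'0 hB2
        have h4 : 0 ≤ 2 * 2 ^ Lam * ((Metric.ball x₀ r ×ˢ Metric.ball x₀ r).indicator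
          (fun p : E n × E n => 1 / ‖p.1 - p.2‖ ^ n * psi g (holderQuot s w p)) (x, y) +
          1 / ‖x - y‖ ^ n * psi g (holderQuot s ψ (x, y))) := by positivity
        simp only [holderQuot] at h4
        linarith
  · have hxη : η x = 0 := indicator_of_notMem (fun h => hx (hsub2 h)) _
    by_cases hyη : η y = 0
    · have : 1 / ‖x - y‖ ^ n * psi g (holderQuot s η (x, y)) = 0 := by
        simp [holderQuot, hxη, hyη, psi]
      rw [this]; positivity
    · have hyB := (of_truncation_ne_zero hyη).1
      have := far_psi_le (n := n) hg hs0 hs hA hr hyB hx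
        (truncation_nonneg (Metric.ball x₀ (r / 3)) ψ w M y) (hηle y hpy)
      rw [← hη] at this
      rw [indicator_of_mem (Metric.ball_subset_closedBall hyB), one_mul]
      have e : psi g (holderQuot s η (x, y)) = psi g (η y / ‖y - x‖ ^ s) := by
        simp only [holderQuot, hxη, zero_sub, psi, neg_div, abs_neg, norm_sub_rev y x]
      rw [e, norm_sub_rev x y]
      rw [norm_sub_rev x y] at hB1 hψψ
      have h3 := mul_nonneg hC'0 hB1
      have h4 : 0 ≤ 2 * 2 ^ Lam * ((Metric.ball x₀ r ×ˢ Metric.ball x₀ r).indicator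
          (fun p : E n × E n => 1 / ‖p.1 - p.2‖ ^ n * psi g (holderQuot s w p)) (x, y) +
          1 / ‖y - x‖ ^ n * psi g (holderQuot s ψ (x, y))) := by positivity
      linarith

/-- Near pairs are controlled by the two modulars. For far pairs $|w(y)|\le N+|w(y)|1_{B_R^c}(y)$,
which gives a kernel term and a tail term. The bound $N$ serves integrability only and enters no
constant of the growth lemma. -/
theorem integrable_pairing_truncation (hg : Regular Lam g) (hn : 1 ≤ n) (hs0 : 0 < s) (hs : s < 1)
    (hA : 0 < A) (hr : 0 < r) (hR : r ≤ R / 2) (hx₀ : x₀ ∈ Metric.ball (0 : E n) (R / 2))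
    (hwm : AEMeasurable w)
    (hw : IntegrableOn (fun p : E n × E n => 1 / ‖p.1 - p.2‖ ^ n * psi g (holderQuot s w p))
      (Metric.ball x₀ r ×ˢ Metric.ball x₀ r))
    (hM : ∀ᵐ x, x ∈ Metric.ball x₀ r → w x ≤ M)
    (hN0 : 0 ≤ N) (hN : ∀ᵐ x, x ∈ Metric.ball (0 : E n) R → |w x| ≤ N)
    (htl : Integrable (tailDensity s g R w)) :
    Integrable (fun p : E n × E n => 1 / ‖p.1 - p.2‖ ^ n * (g (holderQuot s w p) *
      holderQuot s (truncation (Metric.ball x₀ (r / 3)) (barrier A (r / 3) x₀) w M) p)) := by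
  have hρ : 0 < r / 3 := by positivity
  have i5 := integrable_psi_truncation hg hn hs0 hs hA hr hwm hw hM
  set η := truncation (Metric.ball x₀ (r / 3)) (barrier A (r / 3) x₀) w M with hη
  have hsub2 : Metric.ball x₀ (r / 3) ⊆ Metric.ball x₀ r :=
    Metric.ball_subset_ball (by linarith)
  have hsub3 : Metric.ball x₀ (r / 3) ⊆ Metric.ball (0 : E n) R := by
    refine Metric.ball_subset_ball' ?_
    rw [Metric.mem_ball] at hx₀
    linarith
  have hηm : AEMeasurable η :=
    aemeasurable_truncation measurableSet_ball measurable_barrier hwm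
  have i1 := integrable_kern_indicator (r := r / 3) hn hs0 hs hρ x₀
  have i2 := i1.swap
  have i4 := (integrable_indicator_iff (measurableSet_ball.prod measurableSet_ball)).2 hw
  have i6 : Integrable ((Metric.closedBall x₀ (r / 3)).indicator (fun _ : E n => (1 : ℝ))) :=
    (integrable_indicator_iff Metric.isClosed_closedBall.measurableSet).2
      (integrableOn_const (measure_closedBall_lt_top).ne)
  have i7 : Integrable (fun p : E n × E n =>
      (Metric.closedBall x₀ (r / 3)).indicator (fun _ : E n => (1 : ℝ)) p.1 *
        tailDensity s g R w p.2) := i6.mul_prod htl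
  have i8 := i7.swap
  set c₁ := A * (2 * g (3 * (N / (r / 3) ^ s))) with hc₁
  set c₂ := A * (3 ^ (n + 1) * 9 ^ Lam) with hc₂
  have hgN := hg.nonneg (by positivity : 0 ≤ 3 * (N / (r / 3) ^ s))
  have hc₁0 : 0 ≤ c₁ := by positivity
  have hc₂0 : 0 ≤ c₂ := by positivity
  refine ((i4.add i5).add (((i1.add i2).const_mul c₁).add ((i7.add i8).const_mul c₂))).mono' ?_ ?_
  · refine AEStronglyMeasurable.mul ?_ ?_
    · exact (by fun_prop : Measurable fun p : E n × E n =>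
        1 / ‖p.1 - p.2‖ ^ n).aestronglyMeasurable
    · exact (hg.measurable.comp_aemeasurable
        (aemeasurable_holderQuot s hwm)).aestronglyMeasurable.mul
        (aemeasurable_holderQuot s hηm).aestronglyMeasurable
  have hηle : ∀ z, (z ∈ Metric.ball x₀ r → w z ≤ M) → η z ≤ A := fun z hz =>
    (truncation_le (fun x => barrier_nonneg hA.le x) (fun h => hz (hsub2 h))).trans
      (barrier_le hA.le z)
  have hη0 : ∀ z, 0 ≤ η z := fun z => truncation_nonneg _ _ _ _ z
  have far : ∀ x y : E n, x ∈ Metric.ball x₀ (r / 3) → y ∉ Metric.ball x₀ r → η x ≤ A →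
      |w x| ≤ N → (y ∈ Metric.ball (0 : E n) R → |w y| ≤ N) →
      |1 / ‖x - y‖ ^ n * (g ((w x - w y) / ‖x - y‖ ^ s) * (η x / ‖x - y‖ ^ s))| ≤
        c₁ * kern n s (r / 3) ‖x - y‖ + c₂ * tailDensity s g R w y := by
    intro x y hx hy hxA hxN hyN
    have hd := dist_lower hx hy
    have hyr : r ≤ ‖y - x₀‖ := by rwa [Metric.mem_ball, dist_eq_norm, not_lt] at hy
    have hd0 : r / 3 ≤ ‖x - y‖ := by linarith
    have ht := far_tail_le (n := n) (w := w) hg hs0 hs hr hR hx₀ hx hy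
    rw [kern_of_ge hs hρ hd0]
    set d := ‖x - y‖
    set h := (Metric.ball (0 : E n) R)ᶜ.indicator (fun x => |w x|) y with hh
    have hh0 : 0 ≤ h := indicator_nonneg (fun _ _ => abs_nonneg _) y
    have hyb : |w y| ≤ N + h := by
      by_cases hyR : y ∈ Metric.ball (0 : E n) R
      · linarith [hyN hyR]
      · have : h = |w y| := indicator_of_mem hyR _
        linarith
    have hd' : 0 < d := by linarith
    have hds : 0 < d ^ s := by positivity
    have h1 : |g ((w x - w y) / d ^ s)| ≤ 2 * g (3 * (N / (r / 3) ^ s)) + g (3 * (h / d ^ s)) := by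
      rw [hg.abs_eq, abs_div, abs_of_pos hds]
      have e1 : g (|w x - w y| / d ^ s) ≤ g (N / d ^ s + N / d ^ s + h / d ^ s) := by
        refine hg.mono ?_
        rw [← add_div, ← add_div]
        gcongr
        have := abs_sub (w x) (w y)
        linarith
      have e2 := hg.add_three_le (a := N / d ^ s) (b := N / d ^ s)
        (c := h / d ^ s) (by positivity) (by positivity) (by positivity)
      have e3 : g (3 * (N / d ^ s)) ≤ g (3 * (N / (r / 3) ^ s)) := by
        refine hg.mono ?_
        gcongr
      linarith
    rw [abs_mul, abs_mul, abs_of_nonneg (by positivity : 0 ≤ 1 / d ^ n),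
      abs_of_nonneg (div_nonneg (hη0 x) hds.le)]
    have h2 := hg.nonneg (by positivity : 0 ≤ 3 * (h / d ^ s))
    calc 1 / d ^ n * (|g ((w x - w y) / d ^ s)| * (η x / d ^ s))
        ≤ 1 / d ^ n * ((2 * g (3 * (N / (r / 3) ^ s)) + g (3 * (h / d ^ s))) * (A / d ^ s)) := by
          have := hη0 x
          gcongr
      _ = c₁ * (1 / d ^ n * (1 / d ^ s)) +
          A * (1 / d ^ n * (1 / d ^ s) * g (3 * (h / d ^ s))) := by rw [hc₁]; ring
      _ ≤ _ := by
          rw [hc₂]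
          linarith [mul_le_mul_of_nonneg_left ht hA.le]
  filter_upwards [ae_prod_of_ae hM, ae_prod_of_ae hN] with p hp hpN
  obtain ⟨x, y⟩ := p
  obtain ⟨hpx, hpy⟩ := hp
  obtain ⟨hNx, hNy⟩ := hpN
  simp only at hpx hpy hNx hNy
  have hk := kern_nonneg n s hρ (norm_nonneg (x - y))
  have hk' : 0 ≤ kern n s (r / 3) ‖y - x‖ := by rwa [norm_sub_rev]
  have hi : ∀ z : E n, 0 ≤ (Metric.closedBall x₀ (r / 3)).indicator (fun _ => (1 : ℝ)) z :=
    fun z => indicator_nonneg (fun _ _ => zero_le_one) z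
  have htd := fun z => tailDensity_nonneg (s := s) hg R w z
  have b1 := mul_nonneg hc₁0 (mul_nonneg (hi x) hk)
  have b2 := mul_nonneg hc₁0 (mul_nonneg (hi y) hk')
  have b3 := mul_nonneg hc₂0 (mul_nonneg (hi x) (htd y))
  have b4 := mul_nonneg hc₂0 (mul_nonneg (hi y) (htd x))
  have b5 : 0 ≤ 1 / ‖x - y‖ ^ n * psi g (holderQuot s η (x, y)) := by
    have := hg.psi_nonneg (holderQuot s η (x, y)); positivity
  have b6 : 0 ≤ (Metric.ball x₀ r ×ˢ Metric.ball x₀ r).indicator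
      (fun p : E n × E n => 1 / ‖p.1 - p.2‖ ^ n * psi g (holderQuot s w p)) (x, y) := by
    refine indicator_nonneg (fun p _ => ?_) _
    have := hg.psi_nonneg (holderQuot s w p); positivity
  simp only [Pi.add_apply, Function.comp_apply, Prod.swap_prod_mk, Real.norm_eq_abs, mul_add]
  by_cases hx : x ∈ Metric.ball x₀ r
  · by_cases hy : y ∈ Metric.ball x₀ r
    · rw [indicator_of_mem (mk_mem_prod hx hy)]
      have h1 := hg.abs_mul_le (holderQuot s w (x, y)) (holderQuot s η (x, y))
      have h2 := mul_le_mul_of_nonneg_left h1 (by positivity : 0 ≤ 1 / ‖x - y‖ ^ n)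
      rw [abs_mul, abs_of_nonneg (by positivity : 0 ≤ 1 / ‖x - y‖ ^ n)]
      refine h2.trans ?_
      rw [mul_add]
      unfold psi
      unfold psi at b5
      simp only
      linarith
    · have hyη : η y = 0 := indicator_of_notMem (fun h => hy (hsub2 h)) _
      by_cases hxη : η x = 0
      · have : 1 / ‖x - y‖ ^ n * (g (holderQuot s w (x, y)) * holderQuot s η (x, y)) = 0 := by
          simp [holderQuot, hxη, hyη]
        rw [this, abs_zero]; positivity
      · have hxB := (of_truncation_ne_zero hxη).1
        have := far x y hxB hy (hηle x hpx) (hNx (hsub3 hxB)) hNy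
        rw [indicator_of_mem (Metric.ball_subset_closedBall hxB), one_mul, one_mul]
        have e : holderQuot s η (x, y) = η x / ‖x - y‖ ^ s := by
          simp only [holderQuot, hyη, sub_zero]
        rw [e] at b5 ⊢
        have e' : holderQuot s w (x, y) = (w x - w y) / ‖x - y‖ ^ s := rfl
        rw [e']
        linarith
  · have hxη : η x = 0 := indicator_of_notMem (fun h => hx (hsub2 h)) _
    by_cases hyη : η y = 0
    · have : 1 / ‖x - y‖ ^ n * (g (holderQuot s w (x, y)) * holderQuot s η (x, y)) = 0 := by
        simp [holderQuot, hxη, hyη]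
      rw [this, abs_zero]; positivity
    · have hyB := (of_truncation_ne_zero hyη).1
      have := far y x hyB hx (hηle y hpy) (hNy (hsub3 hyB)) hNx
      rw [indicator_of_mem (Metric.ball_subset_closedBall hyB), one_mul, one_mul]
      have e : g (holderQuot s w (x, y)) * holderQuot s η (x, y) =
          g ((w y - w x) / ‖y - x‖ ^ s) * (η y / ‖y - x‖ ^ s) := by
        simp only [holderQuot, hxη, zero_sub]
        rw [norm_sub_rev y x, neg_div, ← neg_sub (w y) (w x), neg_div, hg.odd]
        ring
      rw [e, show 1 / ‖x - y‖ ^ n = 1 / ‖y - x‖ ^ n by rw [norm_sub_rev]]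
      rw [norm_sub_rev x y] at b5
      linarith

end Truncation

/-! ### The growth lemma -/

section LowerDensity

variable {n : ℕ} {s Lam R r ω e c₀ : ℝ} {x₀ : E n} {g : ℝ → ℝ} {w : E n → ℝ} {D : Set (E n)}

theorem rpow_mul_le {t c : ℝ} (hs : s < 1) (ht : 0 ≤ t) (hc : 1 ≤ c) :
    (c * t) ^ s ≤ c * t ^ s := by
  rw [Real.mul_rpow (by linarith) ht]
  gcongr
  simpa using Real.rpow_le_rpow_of_exponent_le hc hs.le

theorem integrable_kern_shift (hn : 1 ≤ n) (hs0 : 0 < s) (hs : s < 1) (hr : 0 < r) :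
    Integrable (fun y : E n => kern n s r ‖y - x₀‖) :=
  (integrable_kern hn hs0 hs hr).comp_sub_right x₀

theorem integrable_lowerDensity (hn : 1 ≤ n) (hs0 : 0 < s) (hs : s < 1) (hr : 0 < r)
    (hDm : MeasurableSet D) (hD1 : D ⊆ Metric.ball x₀ r)
    (htl : Integrable (tailDensity s g R w)) :
    Integrable (lowerDensity s Lam g R r ω e x₀ D w) := by
  have hDfin : volume D ≠ ∞ :=
    ((measure_mono hD1).trans_lt measure_ball_lt_top).ne
  exact (((integrable_indicator_iff hDm).2 (integrableOn_const hDfin)).sub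
    ((integrable_kern_shift hn hs0 hs hr).const_mul _)).sub (htl.const_mul _)

/-- All three terms scale like $g(\omega/r^s)r^{-s}$: the volume of $D$ cancels the factor $r^{-n}$,
doubling recovers $g(\omega/r^s)$ from $g(\omega/(8r^s))$, and the kernel integral is `kernInt`
times $r^{-s}$. Hence the sign depends on $e$ alone. -/
theorem integral_lowerDensity_ge (hg : Regular Lam g) (hn : 1 ≤ n) (hs0 : 0 < s) (hs : s < 1)
    (hr : 0 < r) (hω : 0 < ω) (hDm : MeasurableSet D)
    (hD1 : D ⊆ Metric.ball x₀ r) (hD3 : c₀ * r ^ n ≤ volume.real D)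
    (htl : Integrable (tailDensity s g R w))
    (htl2 : ∫ y, tailDensity s g R w y ≤ e * (g (ω / r ^ s) * r ^ (-s))) :
    (c₀ / (2 ^ (n + 1) * 8 ^ Lam) - 2 ^ (n + 1) * (10 * e) * kernInt n s
      - 3 ^ (n + 1) * 9 ^ Lam * e) * (g (ω / r ^ s) * r ^ (-s)) ≤
      ∫ y, lowerDensity s Lam g R r ω e x₀ D w y := by
  have hDfin : volume D ≠ ∞ :=
    ((measure_mono hD1).trans_lt measure_ball_lt_top).ne
  have j1 : Integrable (D.indicator
      (fun _ : E n => 1 / (2 * r) ^ n * (1 / (2 * r) ^ s) * g (ω / r ^ s / 8))) :=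
    (integrable_indicator_iff hDm).2 (integrableOn_const hDfin)
  have j2 := (integrable_kern_shift (x₀ := x₀) hn hs0 hs hr).const_mul
    (2 ^ (n + 1) * (10 * e * g (ω / r ^ s)))
  have j3 := htl.const_mul (3 ^ (n + 1) * 9 ^ Lam)
  have hrs : 0 < r ^ s := by positivity
  set t₀ := ω / r ^ s with ht₀
  have ht0 : 0 ≤ t₀ := by positivity
  have e1 : ∫ y, lowerDensity s Lam g R r ω e x₀ D w y =
      volume.real D * (1 / (2 * r) ^ n * (1 / (2 * r) ^ s) * g (t₀ / 8))
      - 2 ^ (n + 1) * (10 * e * g t₀) * (r ^ (-s) * kernInt n s)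
      - 3 ^ (n + 1) * 9 ^ Lam * ∫ y, tailDensity s g R w y := by
    have j12 : Integrable (fun y => D.indicator
        (fun _ : E n => 1 / (2 * r) ^ n * (1 / (2 * r) ^ s) * g (t₀ / 8)) y -
        2 ^ (n + 1) * (10 * e * g t₀) * kern n s r ‖y - x₀‖) := j1.sub j2
    simp only [lowerDensity, ← ht₀]
    rw [integral_sub j12 j3, integral_sub j1 j2, integral_indicator_const _ hDm,
      integral_const_mul, integral_const_mul, smul_eq_mul,
      integral_sub_right_eq_self (fun y : E n => kern n s r ‖y‖) x₀, integral_kern n s hr]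
  have h8 : g t₀ ≤ 8 ^ Lam * g (t₀ / 8) := by
    have := hg.doubling 8 (t₀ / 8) (by norm_num) (by positivity)
    rwa [mul_div_cancel₀ _ (by norm_num : (8 : ℝ) ≠ 0)] at this
  have h8p : (0 : ℝ) < 8 ^ Lam := by positivity
  have hg8 : g t₀ / 8 ^ Lam ≤ g (t₀ / 8) := by rwa [div_le_iff₀' h8p]
  have hgt := hg.nonneg ht0
  have h2s : (2 * r) ^ s ≤ 2 * r ^ s := rpow_mul_le hs hr.le one_le_two
  have e2 : c₀ / (2 ^ (n + 1) * 8 ^ Lam) * (g t₀ * r ^ (-s)) ≤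
      volume.real D * (1 / (2 * r) ^ n * (1 / (2 * r) ^ s) * g (t₀ / 8)) := by
    calc c₀ / (2 ^ (n + 1) * 8 ^ Lam) * (g t₀ * r ^ (-s))
        = (c₀ * r ^ n) * (1 / (2 * r) ^ n * (1 / (2 * r ^ s)) * (g t₀ / 8 ^ Lam)) := by
          rw [Real.rpow_neg hr.le, mul_pow]; field_simp; ring
      _ ≤ _ := by gcongr
  have h9 : (0 : ℝ) < 9 ^ Lam := by positivity
  have e3 := mul_le_mul_of_nonneg_left htl2 (by positivity : (0 : ℝ) ≤ 3 ^ (n + 1) * 9 ^ Lam)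
  rw [e1]
  nlinarith

end LowerDensity

/-- The symmetric lower bound counts the gain $cJ\Gamma$ twice, while all errors together cost at
most one $cJ\Gamma$ by the choice of $e$; one copy is left over. -/
theorem absorb_error {J Γ c e P Q S I L F F' K : ℝ} (hX : 0 ≤ J * Γ)
    (he : e * (2 * (P * 10 * I) + 2 * Q + 9 * S * I + 1) ≤ c)
    (h1 : J * L + L * J ≤ F + F') (h2 : F ≤ K * J) (h3 : F' ≤ 9 * S * I * e * (J * Γ))
    (h4 : K * J ≤ e * (J * Γ)) (h5 : J * ((c - P * (10 * e) * I - Q * e) * Γ) ≤ J * L) :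
    J * Γ * c ≤ 0 := by
  have h6 := mul_le_mul_of_nonneg_left he hX
  linarith

set_option maxHeartbeats 800000 in
/-- **Growth lemma.** A bounded-by-`M` weak subsolution which lies below `M - ω / 2` on a
substantial part of an annulus lies below `M - c ω` in a smaller ball. -/
theorem growth_lemma {n : ℕ} (hn : 1 ≤ n) {s : ℝ} (hs0 : 0 < s) (hs : s < 1) (Lam : ℝ) {c₀ : ℝ}
    (hc₀ : 0 < c₀) : ∃ e : ℝ, 0 < e ∧ e ≤ 1 / 5 ∧ ∀ g : ℝ → ℝ, Regular Lam g →
      ∀ (R r K M N ω : ℝ) (x₀ : E n) (D : Set (E n)) (w : E n → ℝ), 0 < r → r ≤ R / 2 →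
      x₀ ∈ Metric.ball (0 : E n) (R / 2) → 0 < ω →
      IsWeakSubsolution s g (Metric.ball 0 R) (fun _ => K) w →
      (∀ᵐ x, x ∈ Metric.ball (0 : E n) R → |w x| ≤ N) →
      Integrable (tailDensity s g R w) →
      ∫ y, tailDensity s g R w y ≤ e * (g (ω / r ^ s) * r ^ (-s)) →
      K ≤ e * (g (ω / r ^ s) * r ^ (-s)) →
      MeasurableSet D → D ⊆ Metric.ball x₀ r → (∀ x ∈ D, x ∉ Metric.ball x₀ (r / 2)) →
      c₀ * r ^ n ≤ volume.real D →
      (∀ᵐ x, GrowthAt s R r M ω e x₀ D w x) →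
      ∀ᵐ x, x ∈ Metric.ball x₀ (r / 4) → w x ≤ M - 49 / 256 * e * ω := by
  have hI := kernInt_nonneg n s
  have h8 : (0 : ℝ) < 8 ^ Lam := by positivity
  have h9 : (0 : ℝ) < 9 ^ Lam := by positivity
  set I := kernInt n s with hIdef
  set c₁ := c₀ / (2 ^ (n + 1) * 8 ^ Lam) with hc₁
  have hc₁0 : 0 < c₁ := by positivity
  set B₁ : ℝ := 2 * (2 ^ (n + 1) * 10 * I) + 2 * (3 ^ (n + 1) * 9 ^ Lam) +
    9 * (6 * 8 ^ Lam + 2) * I + 1 with hB₁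
  have hB₁0 : 0 < B₁ := by positivity
  -- $B_1$ adds up the loss coefficients: growth and tail (each twice, by symmetry), the barrier,
  -- and $K$. The cap $1/5$ is required by `pairing_lower`.
  refine ⟨min (1 / 5) (c₁ / B₁), by positivity, min_le_left _ _, ?_⟩
  have heB : min (1 / 5) (c₁ / B₁) * B₁ ≤ c₁ := by
    rw [← le_div_iff₀ hB₁0]; exact min_le_right _ _
  have he5 : min (1 / 5) (c₁ / B₁) ≤ 1 / 5 := min_le_left _ _
  have he0 : 0 < min (1 / 5) (c₁ / B₁) := by positivity
  set e := min (1 / 5) (c₁ / B₁) with he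
  intro g hg R r K M N ω x₀ D w hr hR hx₀ hω hsub hN htl htl2 hK hDm hD1 hD2 hD3 hG
  have hρ : 0 < r / 3 := by positivity
  have hA : 0 < e * ω := by positivity
  have hwm : AEMeasurable w := hsub.1.1.1
  have hBr : Metric.ball x₀ r ⊆ Metric.ball (0 : E n) R := by
    refine Metric.ball_subset_ball' ?_
    rw [Metric.mem_ball] at hx₀
    linarith
  have hM : ∀ᵐ x, x ∈ Metric.ball x₀ r → w x ≤ M := hG.mono fun x hx => hx.inside
  have hN' : ∀ᵐ x, x ∈ Metric.ball (0 : E n) R → |w x| ≤ max N 0 :=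
    hN.mono fun x hx h => (hx h).trans (le_max_left _ _)
  have hwpsi : IntegrableOn (fun p : E n × E n => 1 / ‖p.1 - p.2‖ ^ n * psi g (holderQuot s w p))
      (Metric.ball x₀ r ×ˢ Metric.ball x₀ r) :=
    (integrableOn_psi_of_memWtilde hg measurableSet_ball hsub.1).mono_set (prod_mono hBr hBr)
  have iη := integrable_psi_truncation hg hn hs0 hs hA hr hwm hwpsi hM
  -- Without this the integral in the weak inequality could be the default value $0$ and would carry
  -- no information.
  have iF := integrable_pairing_truncation hg hn hs0 hs hA hr hR hx₀ hwm hwpsi hM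
    (le_max_right N 0) hN' htl
  have iψ := integrable_psi_barrier (x₀ := x₀) hg hn hs0 hs hA hρ
  set ψ := barrier (e * ω) (r / 3) x₀ with hψ
  set η := truncation (Metric.ball x₀ (r / 3)) ψ w M with hη
  have hψz : ∀ x, x ∉ Metric.ball x₀ (r / 3) → ψ x = 0 := by
    intro x hx
    rw [Metric.mem_ball, dist_eq_norm, not_lt] at hx
    exact barrier_eq_zero hρ hx
  have hψ0 : ∀ x, 0 ≤ ψ x := barrier_nonneg hA.le
  have hψ1 : ∀ x, ψ x ≤ e * ω := barrier_le hA.le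
  have hsub2 : Metric.ball x₀ (r / 3) ⊆ Metric.ball x₀ r :=
    Metric.ball_subset_ball (by linarith)
  have hη0 : ∀ x, 0 ≤ η x := truncation_nonneg _ _ _ _
  have hηsupp : ∀ x, η x ≠ 0 → x ∈ Metric.ball x₀ (r / 3) := fun x h =>
    (of_truncation_ne_zero h).1
  have hηm : AEMeasurable η :=
    aemeasurable_truncation measurableSet_ball measurable_barrier hwm
  have hηle : ∀ᵐ x, η x ≤ e * ω := hM.mono fun x hx =>
    (truncation_le hψ0 fun h => hx (hsub2 h)).trans (hψ1 x)
  have iball : Integrable ((Metric.ball x₀ (r / 3)).indicator (fun _ : E n => (1 : ℝ))) :=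
    (integrable_indicator_iff measurableSet_ball).2
      (integrableOn_const (measure_ball_lt_top).ne)
  have hηint : Integrable η := by
    refine (iball.const_mul (e * ω)).mono' hηm.aestronglyMeasurable ?_
    filter_upwards [hηle] with x hx
    rw [Real.norm_of_nonneg (hη0 x)]
    by_cases h : η x = 0
    · rw [h]
      exact mul_nonneg hA.le (indicator_nonneg (fun _ _ => zero_le_one) x)
    · rw [indicator_of_mem (hηsupp x h), mul_one]; exact hx
  have hηpsi : Integrable (fun x => psi g (η x)) := by
    refine (iball.const_mul (psi g (e * ω))).mono'
      (hg.measurable_psi.comp_aemeasurable hηm).aestronglyMeasurable ?_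
    filter_upwards [hηle] with x hx
    rw [Real.norm_of_nonneg (hg.psi_nonneg _)]
    by_cases h : η x = 0
    · rw [h]
      have : psi g 0 = 0 := by simp [psi]
      rw [this]
      exact mul_nonneg (hg.psi_nonneg _) (indicator_nonneg (fun _ _ => zero_le_one) x)
    · rw [indicator_of_mem (hηsupp x h), mul_one]
      refine hg.abs_mul_mono ?_
      rw [abs_of_nonneg (hη0 x), abs_of_nonneg hA.le]; exact hx
  have hW0 : MemW0 s g (Metric.ball 0 R) η := by
    refine ⟨⟨?_, ?_⟩, Eventually.of_forall fun x hx => ?_⟩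
    · rw [Measure.restrict_univ]
      exact hg.memLG_of_integrable hηm hηpsi
    · rw [univ_prod_univ, Measure.restrict_univ]
      exact hg.memLG_of_integrable
        ((aemeasurable_holderQuot s hηm).mono_ac (mu_absolutelyContinuous n))
        ((integrable_mu_iff _).2 iη)
    · by_contra h
      exact hx (hBr (hsub2 (hηsupp x h)))
  have hweak := hsub.2 η hW0 (Eventually.of_forall fun x _ => hη0 x)
  rw [integral_mu, integral_const_mul, setIntegral_eq_integral_of_forall_compl_eq_zero
    (fun x hx => by by_contra h; exact hx (hBr (hsub2 (hηsupp x h))))] at hweak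
  have iFψ : Integrable (fun p : E n × E n => 1 / ‖p.1 - p.2‖ ^ n *
      (g (holderQuot s ψ p) * holderQuot s η p)) := by
    refine (iψ.add iη).mono' ?_ (Eventually.of_forall fun p => ?_)
    · refine AEStronglyMeasurable.mul ?_ ?_
      · exact (by fun_prop : Measurable fun p : E n × E n =>
          1 / ‖p.1 - p.2‖ ^ n).aestronglyMeasurable
      · exact (hg.measurable.comp_aemeasurable
          (aemeasurable_holderQuot s measurable_barrier.aemeasurable)).aestronglyMeasurable.mul
          (aemeasurable_holderQuot s hηm).aestronglyMeasurable
    · have h1 := hg.abs_mul_le (holderQuot s ψ p) (holderQuot s η p)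
      have h2 := mul_le_mul_of_nonneg_left h1 (by positivity : 0 ≤ 1 / ‖p.1 - p.2‖ ^ n)
      rw [Real.norm_eq_abs, abs_mul, abs_of_nonneg (by positivity : 0 ≤ 1 / ‖p.1 - p.2‖ ^ n)]
      rw [mul_add] at h2
      exact h2
  have hbar := abs_barrier_integral_le (x₀ := x₀) hg hn hs0 hs hA hρ hηint hη0
    (fun x h => by
      have := hηsupp x h
      rw [Metric.mem_ball, dist_eq_norm] at this
      exact this.le) iFψ
  have iL : Integrable (lowerDensity s Lam g R r ω e x₀ D w) :=
    integrable_lowerDensity hn hs0 hs hr hDm hD1 htl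
  have hLge := integral_lowerDensity_ge (e := e) hg hn hs0 hs hr hω hDm hD1 hD3 htl htl2
  set L := lowerDensity s Lam g R r ω e x₀ D w with hL
  have k1 : Integrable (fun p : E n × E n => η p.1 * L p.2) := hηint.mul_prod iL
  have k2 : Integrable (fun p : E n × E n => L p.1 * η p.2) := iL.mul_prod hηint
  -- The lower bound is a sum of products of a function of $x$ and a function of $y$, so Fubini
  -- makes its integral $2\int\eta\int L$.
  have hmono : ∫ p : E n × E n, (η p.1 * L p.2 + L p.1 * η p.2) ≤
      ∫ p : E n × E n, (1 / ‖p.1 - p.2‖ ^ n * (g (holderQuot s w p) * holderQuot s η p) +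
        1 / ‖p.1 - p.2‖ ^ n * (g (holderQuot s ψ p) * holderQuot s η p)) := by
    refine integral_mono_ae (k1.add k2) (iF.add iFψ) ?_
    filter_upwards [ae_prod_of_ae hG] with p hp
    have := pairing_lower (n := n) hg hs0 hs hω hr hR hx₀ he0.le he5 hψz hψ0 hψ1 hD1 hD2 hη hp.1 hp.2
    rw [mul_comm (η p.2)] at this
    exact this
  rw [integral_add k1 k2, integral_add iF iFψ] at hmono
  have p1 : ∫ p : E n × E n, η p.1 * L p.2 = (∫ x, η x) * ∫ x, L x := integral_prod_mul η L
  have p2 : ∫ p : E n × E n, L p.1 * η p.2 = (∫ x, L x) * ∫ x, η x := integral_prod_mul L η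
  rw [p1, p2] at hmono
  have hJ0 : 0 ≤ ∫ x, η x := integral_nonneg hη0
  have hrs : 0 < r ^ s := by positivity
  set J := ∫ x, η x with hJ
  set t₀ := ω / r ^ s with ht₀
  have ht0 : 0 < t₀ := by positivity
  have hΓ : 0 < g t₀ * r ^ (-s) := mul_pos (hg.pos _ ht0) (by positivity)
  set Γ := g t₀ * r ^ (-s) with hΓdef
  -- the contribution of the barrier
  have hr3 : r ^ s ≤ 3 * (r / 3) ^ s := by
    have := rpow_mul_le (s := s) (t := r / 3) (c := 3) hs hρ.le (by norm_num)
    rwa [mul_div_cancel₀ _ (by norm_num : (3 : ℝ) ≠ 0)] at this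
  have hr3p : 0 < (r / 3) ^ s := by positivity
  have hb1 : g (e * ω / (r / 3) ^ s) ≤ 3 * e * g t₀ := by
    refine le_trans (hg.mono ?_) (hg.sub (3 * e) t₀ (by positivity) (by linarith) ht0.le)
    rw [ht₀, div_le_iff₀ hr3p]
    calc e * ω = e * ω * (r ^ s / r ^ s) := by field_simp
      _ ≤ e * ω * (3 * (r / 3) ^ s / r ^ s) := by gcongr
      _ = _ := by field_simp
  have hb2 : (r / 3) ^ (-s) ≤ 3 * r ^ (-s) := by
    rw [Real.rpow_neg hρ.le, Real.rpow_neg hr.le, ← div_eq_mul_inv, inv_eq_one_div,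
      div_le_div_iff₀ hr3p hrs]
    linarith
  have hb3 : ((6 * 8 ^ Lam + 2) * g (e * ω / (r / 3) ^ s) * J) * ((r / 3) ^ (-s) * I) ≤
      (9 * (6 * 8 ^ Lam + 2) * I) * e * (J * Γ) := by
    have hgp := hg.pos t₀ ht0
    calc _ ≤ ((6 * 8 ^ Lam + 2) * (3 * e * g t₀) * J) * ((3 * r ^ (-s)) * I) := by gcongr
      _ = _ := by rw [hΓdef]; ring
  have hb4 := (abs_le.1 (hbar.trans hb3)).2
  have hJK : K * J ≤ e * (J * Γ) := by
    calc K * J ≤ e * Γ * J := by gcongr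
      _ = _ := by ring
  have hJL := mul_le_mul_of_nonneg_left hLge hJ0
  have hJΓ : 0 ≤ J * Γ := by positivity
  have hfin : J * Γ * c₁ ≤ 0 :=
    absorb_error hJΓ (by rw [← hB₁]; exact heB) hmono hweak hb4 hJK hJL
  have hJz : J = 0 := by
    rcases hJ0.eq_or_lt with h | h
    · exact h.symm
    · exact absurd hfin (not_le.2 (by positivity))
  have hηz := (integral_eq_zero_iff_of_nonneg hη0 hηint).1 hJz
  filter_upwards [hηz] with x hx hxb
  have hxB : x ∈ Metric.ball x₀ (r / 3) := Metric.ball_subset_ball (by linarith) hxb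
  have h1 : η x = max 0 (w x - M + ψ x) := indicator_of_mem hxB _
  rw [hx, Pi.zero_apply] at h1
  have h2 : w x - M + ψ x ≤ 0 := by rw [h1]; exact le_max_right _ _
  -- The radius $r/4$ is $\frac34$ of the barrier radius $r/3$, and there the profile is at least
  -- $(7/16)^2$.
  have h3 : 49 / 256 * (e * ω) ≤ ψ x := by
    refine barrier_ge hA.le hρ ?_
    rw [Metric.mem_ball, dist_eq_norm] at hxb
    linarith
  linarith

/-! ### Iteration over the scales -/

section Powers

variable {s α t : ℝ}

/-- Bernoulli's inequality for the concave power $\alpha/s$ applied to $t^s$. The small factor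
$\alpha/s$ is what makes $\alpha$-growth tolerable in the growth lemma. -/
theorem rpow_sub_one_le (hα : 0 ≤ α) (hαs : α ≤ s) (hs0 : 0 < s) (ht : 0 ≤ t) :
    t ^ α - 1 ≤ α / s * t ^ s := by
  have h := rpow_one_add_le_one_add_mul_self (s := t ^ s - 1) (p := α / s)
    (by have : 0 ≤ t ^ s := by positivity
        linarith) (by positivity) ((div_le_one hs0).2 hαs)
  rw [add_sub_cancel, ← Real.rpow_mul ht, mul_div_cancel₀ _ hs0.ne'] at h
  have : 0 ≤ α / s := by positivity
  linarith

theorem one_sub_le_quarter_rpow (hα : 0 ≤ α) (hα1 : α ≤ 1) : 1 - 3 * α ≤ (1 / 4 : ℝ) ^ α := by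
  have h := rpow_one_add_le_one_add_mul_self (s := 3) (p := α) (by norm_num) hα hα1
  rw [show (1 : ℝ) + 3 = 4 by norm_num] at h
  rw [Real.div_rpow (by norm_num) (by norm_num), Real.one_rpow, le_div_iff₀ (by positivity)]
  have : (0 : ℝ) < 4 ^ α := by positivity
  rcases le_total (1 - 3 * α) 0 with h' | h'
  · nlinarith
  · nlinarith

end Powers

/-- Oscillation control at the scale `4^{-j}`. -/
structure OscBound {n : ℕ} (R α ω : ℝ) (x₀ : E n) (u : E n → ℝ) (j : ℕ) (m M : ℝ) : Prop where
  diff : M - m = ω * ((1 / 4 : ℝ) ^ α) ^ j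
  lower : -(ω / 2) ≤ m
  upper : M ≤ ω / 2
  inside : ∀ᵐ x, x ∈ Metric.ball x₀ (R / 2 * (1 / 4) ^ j) → m ≤ u x ∧ u x ≤ M
  outside : ∀ᵐ x, x ∈ Metric.ball (0 : E n) R → x ∉ Metric.ball x₀ (R / 2 * (1 / 4) ^ j) →
    M - ω * (4 * ‖x - x₀‖ / (R / 2)) ^ α ≤ u x ∧ u x ≤ m + ω * (4 * ‖x - x₀‖ / (R / 2)) ^ α

section Iteration

variable {n : ℕ} {s R α ω e : ℝ} {x₀ : E n} {u w : E n → ℝ} {j : ℕ} {m M : ℝ}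

theorem OscBound.neg (h : OscBound R α ω x₀ u j m M) :
    OscBound R α ω x₀ (fun x => -u x) j (-M) (-m) where
  diff := by rw [← h.diff]; ring
  lower := by linarith [h.upper]
  upper := by linarith [h.lower]
  inside := h.inside.mono fun x hx hb => by
    obtain ⟨h1, h2⟩ := hx hb; constructor <;> linarith
  outside := h.outside.mono fun x hx hb hb' => by
    obtain ⟨h1, h2⟩ := hx hb hb'; constructor <;> linarith

theorem OscBound.of_neg (h : OscBound R α ω x₀ (fun x => -u x) j m M) :
    OscBound R α ω x₀ u j (-M) (-m) := by
  simpa using h.neg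

theorem quarter_pow_rpow (α : ℝ) (j : ℕ) : ((1 / 4 : ℝ) ^ j) ^ α = ((1 / 4 : ℝ) ^ α) ^ j :=
  (Real.rpow_pow_comm (by norm_num) α j).symm

/-- The reference profile dominates the oscillation outside the smaller ball. -/
theorem profile_lower (hα : 0 ≤ α) (hω : 0 ≤ ω) (hR : 0 < R) {q : ℝ}
    (hq : R / 2 * (1 / 4) ^ (j + 1) ≤ q) :
    ω * ((1 / 4 : ℝ) ^ α) ^ j ≤ ω * (4 * q / (R / 2)) ^ α := by
  rw [← quarter_pow_rpow]
  gcongr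
  rw [le_div_iff₀ (by positivity)]
  rw [pow_succ] at hq
  linarith

/-- The growth inherited from coarser scales is rewritten relative to the current scale. With
$\alpha/s=e/32$ and $4^s\le4$ the excess is $\frac e8(q/r)^s$, within the allowance $e(q/r)^s$. -/
theorem profile_upper (hα : 0 ≤ α) (hs0 : 0 < s) (hs : s < 1) (he : 0 ≤ e) (hαe : α = e * s / 32)
    (he5 : e ≤ 1 / 5) (hω : 0 ≤ ω) (hR : 0 < R) {q : ℝ} (hq : 0 ≤ q) :
    ω * (4 * q / (R / 2)) ^ α ≤ ω * ((1 / 4 : ℝ) ^ α) ^ j +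
      e * (ω * ((1 / 4 : ℝ) ^ α) ^ j) * (q / (R / 2 * (1 / 4) ^ j)) ^ s := by
  have hαs : α ≤ s := by rw [hαe]; nlinarith
  set r := R / 2 * (1 / 4) ^ j with hr
  have hr0 : 0 < r := by positivity
  have e1 : 4 * q / (R / 2) = (4 * (q / r)) * (1 / 4) ^ j := by
    rw [hr]; field_simp
  have h1 := rpow_sub_one_le (t := 4 * (q / r)) hα hαs hs0 (by positivity)
  have h2 : (4 * (q / r)) ^ s ≤ 4 * (q / r) ^ s := rpow_mul_le hs (by positivity) (by norm_num)
  have h3 : α / s = e / 32 := by rw [hαe]; field_simp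
  have hqs : 0 ≤ (q / r) ^ s := by positivity
  have h4 : (4 * (q / r)) ^ α ≤ 1 + e * (q / r) ^ s := by
    rw [h3] at h1
    have : e / 32 * (4 * (q / r)) ^ s ≤ e / 32 * (4 * (q / r) ^ s) := by gcongr
    nlinarith
  rw [e1, Real.mul_rpow (by positivity) (by positivity), quarter_pow_rpow]
  have hθ : 0 ≤ ω * ((1 / 4 : ℝ) ^ α) ^ j := by positivity
  calc ω * ((4 * (q / r)) ^ α * ((1 / 4 : ℝ) ^ α) ^ j)
      = (ω * ((1 / 4 : ℝ) ^ α) ^ j) * (4 * (q / r)) ^ α := by ring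
    _ ≤ (ω * ((1 / 4 : ℝ) ^ α) ^ j) * (1 + e * (q / r) ^ s) := by gcongr
    _ = _ := by ring

theorem OscBound.zero (hα : 0 ≤ α) (hω : 0 ≤ ω) (hR : 0 < R)
    (hx₀ : x₀ ∈ Metric.ball (0 : E n) (R / 2))
    (hu : ∀ᵐ x, x ∈ Metric.ball (0 : E n) R → |u x| ≤ ω / 2) :
    OscBound R α ω x₀ u 0 (-(ω / 2)) (ω / 2) where
  diff := by ring
  lower := le_rfl
  upper := le_rfl
  inside := hu.mono fun x hx hb => abs_le.1 (hx (by
    refine Metric.ball_subset_ball' ?_ hb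
    rw [Metric.mem_ball] at hx₀
    simp only [pow_zero, mul_one]
    linarith))
  outside := hu.mono fun x hx hb hb' => by
    have h := abs_le.1 (hx hb)
    rw [Metric.mem_ball, dist_eq_norm, not_lt] at hb'
    have := profile_lower (j := 0) (q := ‖x - x₀‖) hα hω hR (by
      norm_num at hb' ⊢
      linarith)
    rw [pow_zero, mul_one] at this
    constructor <;> linarith

/-- Within $B_R$ the growth condition is the outside bound combined with `profile_upper`. Outside
$B_R$ the profile is at least $\omega$ and the lower level at least $-\omega/2$, so $M$ plus the
allowance is nonnegative and $|w|$ covers the rest. -/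
theorem OscBound.growthAt (hα : 0 ≤ α) (hs0 : 0 < s) (hs : s < 1) (he : 0 ≤ e)
    (hαe : α = e * s / 32) (he5 : e ≤ 1 / 5) (hω : 0 ≤ ω) (hR : 0 < R)
    (hx₀ : x₀ ∈ Metric.ball (0 : E n) (R / 2))
    (h : OscBound R α ω x₀ w j m M) {D : Set (E n)}
    (hD : ∀ᵐ x, x ∈ D → w x ≤ M - ω * ((1 / 4 : ℝ) ^ α) ^ j / 2) :
    ∀ᵐ x, GrowthAt s R (R / 2 * (1 / 4) ^ j) M (ω * ((1 / 4 : ℝ) ^ α) ^ j) e x₀ D w x := by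
  filter_upwards [h.inside, h.outside, hD] with x h1 h2 h3
  refine ⟨fun hx => (h1 hx).2, h3, fun hx => ?_⟩
  have hup := profile_upper (j := j) hα hs0 hs he hαe he5 hω hR (norm_nonneg (x - x₀))
  have hd := h.diff
  by_cases hxR : x ∈ Metric.ball (0 : E n) R
  · have h4 := (h2 hxR hx).2
    rw [indicator_of_notMem (by simpa using hxR)]
    linarith
  · rw [indicator_of_mem hxR]
    have h5 : ω * ((1 / 4 : ℝ) ^ α) ^ 0 ≤ ω * (4 * ‖x - x₀‖ / (R / 2)) ^ α := by
      refine profile_lower hα hω hR ?_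
      rw [Metric.mem_ball, dist_zero_right] at hx₀
      rw [Metric.mem_ball, dist_zero_right, not_lt] at hxR
      have := norm_sub_norm_le x x₀
      norm_num
      linarith
    rw [pow_zero, mul_one] at h5
    have := h.lower
    have := le_abs_self (w x)
    linarith

/-- Decrease of the upper bound yields oscillation control at the next scale. -/
theorem OscBound.succ (hα : 0 ≤ α) (hs : s < 1) (hs0 : 0 < s) (he : 0 ≤ e)
    (hαe : α = e * s / 32) (he5 : e ≤ 1 / 5) (hω : 0 ≤ ω) (hR : 0 < R)
    (h : OscBound R α ω x₀ w j m M)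
    (hdec : ∀ᵐ x, x ∈ Metric.ball x₀ (R / 2 * (1 / 4) ^ j / 4) →
      w x ≤ M - 49 / 256 * e * (ω * ((1 / 4 : ℝ) ^ α) ^ j)) :
    OscBound R α ω x₀ w (j + 1) m (m + ω * ((1 / 4 : ℝ) ^ α) ^ (j + 1)) := by
  -- Since $4^{-\alpha}\ge1-3\alpha$, this makes the prescribed decay of the oscillation no faster
  -- than the one gained from the growth lemma.
  have hα3 : 3 * α ≤ 49 / 256 * e := by
    rw [hαe]; nlinarith
  have hθ := one_sub_le_quarter_rpow hα (by nlinarith)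
  have hθ1 : (1 / 4 : ℝ) ^ α ≤ 1 := Real.rpow_le_one (by norm_num) (by norm_num) hα
  have hd := h.diff
  have hpow : 0 ≤ ω * ((1 / 4 : ℝ) ^ α) ^ j := by positivity
  have hs1 : ω * ((1 / 4 : ℝ) ^ α) ^ (j + 1) =
      (1 / 4 : ℝ) ^ α * (ω * ((1 / 4 : ℝ) ^ α) ^ j) := by rw [pow_succ]; ring
  have hup : ω * ((1 / 4 : ℝ) ^ α) ^ (j + 1) ≤ ω * ((1 / 4 : ℝ) ^ α) ^ j := by
    rw [hs1]; exact mul_le_of_le_one_left hpow hθ1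
  have hlow : (1 - 49 / 256 * e) * (ω * ((1 / 4 : ℝ) ^ α) ^ j) ≤
      ω * ((1 / 4 : ℝ) ^ α) ^ (j + 1) := by
    rw [hs1]; gcongr; linarith
  have hrad : R / 2 * (1 / 4) ^ (j + 1) = R / 2 * (1 / 4) ^ j / 4 := by rw [pow_succ]; ring
  have hrle : R / 2 * (1 / 4) ^ (j + 1) ≤ R / 2 * (1 / 4) ^ j := by
    rw [hrad]
    have : 0 < R / 2 * (1 / 4) ^ j := by positivity
    linarith
  refine ⟨by ring, h.lower, by linarith [h.upper], ?_, ?_⟩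
  · filter_upwards [h.inside, hdec] with x h1 h2 hx
    refine ⟨(h1 (Metric.ball_subset_ball hrle hx)).1, ?_⟩
    rw [hrad] at hx
    have := h2 hx
    linarith
  · filter_upwards [h.inside, h.outside] with x h1 h2 hxR hx
    have hx' := hx
    rw [Metric.mem_ball, dist_eq_norm, not_lt] at hx'
    have hprof := profile_lower (ω := ω) hα hω hR hx'
    by_cases hxj : x ∈ Metric.ball x₀ (R / 2 * (1 / 4) ^ j)
    · obtain ⟨h3, h4⟩ := h1 hxj
      constructor <;> linarith
    · obtain ⟨h3, h4⟩ := h2 hxR hxj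
      constructor <;> linarith

end Iteration

/-! ### Oscillation decay -/

theorem annulus_volume {n : ℕ} (hn : 1 ≤ n) (x₀ : E n) {r : ℝ} (hr : 0 < r) :
    volume.real (Metric.ball (0 : E n) 1) / 2 * r ^ n ≤
      volume.real (Metric.ball x₀ r \ Metric.ball x₀ (r / 2)) := by
  have hball : ∀ t : ℝ, 0 < t →
      volume.real (Metric.ball x₀ t) = t ^ n * volume.real (Metric.ball (0 : E n) 1) := by
    intro t ht
    rw [measureReal_def, Measure.addHaar_ball_of_pos _ _ ht, finrank_euclideanSpace_fin,
      ENNReal.toReal_mul, ENNReal.toReal_ofReal (by positivity), measureReal_def]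
  rw [measureReal_sdiff (Metric.ball_subset_ball (by linarith)) measurableSet_ball
    (measure_ball_lt_top).ne, hball r hr, hball (r / 2) (by positivity)]
  have hv : 0 ≤ volume.real (Metric.ball (0 : E n) 1) := measureReal_nonneg
  have h2 : (r / 2) ^ n ≤ r ^ n / 2 := by
    rw [div_pow]
    gcongr
    calc (2 : ℝ) = 2 ^ 1 := (pow_one 2).symm
      _ ≤ 2 ^ n := pow_le_pow_right₀ (by norm_num) hn
  nlinarith

/-- On an annulus a function is below or above a given level on at least half of the volume. -/
theorem exists_half_annulus {n : ℕ} (hn : 1 ≤ n) (x₀ : E n) {r : ℝ} (hr : 0 < r) {u : E n → ℝ}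
    (hu : AEMeasurable u) (c : ℝ) :
    ∃ D : Set (E n), MeasurableSet D ∧ D ⊆ Metric.ball x₀ r ∧
      (∀ x ∈ D, x ∉ Metric.ball x₀ (r / 2)) ∧
      volume.real (Metric.ball (0 : E n) 1) / 4 * r ^ n ≤ volume.real D ∧
      ((∀ᵐ x, x ∈ D → u x ≤ c) ∨ ∀ᵐ x, x ∈ D → c ≤ u x) := by
  set T := Metric.ball x₀ r \ Metric.ball x₀ (r / 2) with hT
  have hTm : MeasurableSet T := measurableSet_ball.diff measurableSet_ball
  have hvol := annulus_volume hn x₀ hr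
  set L := {x | hu.mk u x ≤ c} with hL
  have hLm : MeasurableSet L := measurableSet_le hu.measurable_mk measurable_const
  have hTfin : volume T ≠ ∞ := ((measure_mono sdiff_subset).trans_lt measure_ball_lt_top).ne
  have hsplit : volume.real (T ∩ L) + volume.real (T \ L) = volume.real T :=
    measureReal_inter_add_sdiff hLm hTfin
  rcases le_total (volume.real (T \ L)) (volume.real (T ∩ L)) with h | h
  · refine ⟨T ∩ L, hTm.inter hLm, fun x hx => hx.1.1, fun x hx => hx.1.2, by linarith, Or.inl ?_⟩
    filter_upwards [hu.ae_eq_mk] with x hx hxD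
    rw [hx]; exact hxD.2
  · refine ⟨T \ L, hTm.diff hLm, fun x hx => hx.1.1, fun x hx => hx.1.2, by linarith, Or.inr ?_⟩
    filter_upwards [hu.ae_eq_mk] with x hx hxD
    rw [hx]; exact (not_le.1 hxD.2).le

/-- The amplitude falls like $4^{-\alpha j}$ while $r^s$ falls like $4^{-sj}$; as $\alpha\le s$, the
argument of $g$ does not decrease. Smallness of $K$ and of the tail at the first scale therefore
persists. -/
theorem density_scale_mono {s Lam α R ω : ℝ} {g : ℝ → ℝ} (hg : Regular Lam g) (hs0 : 0 < s)
    (hαs : α ≤ s) (hR : 0 < R) (hω : 0 ≤ ω) (j : ℕ) :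
    g (ω / R ^ s) * R ^ (-s) ≤
      g (ω * ((1 / 4 : ℝ) ^ α) ^ j / (R * (1 / 4) ^ j) ^ s) * (R * (1 / 4) ^ j) ^ (-s) := by
  have hRs : 0 < R ^ s := by positivity
  have h4 : (0 : ℝ) < (1 / 4) ^ j := by positivity
  have h4s : (0 : ℝ) < ((1 / 4) ^ j) ^ s := by positivity
  have hle : R * (1 / 4) ^ j ≤ R :=
    mul_le_of_le_one_right hR.le (pow_le_one₀ (by norm_num) (by norm_num))
  have h1 : ω / R ^ s ≤ ω * ((1 / 4 : ℝ) ^ α) ^ j / (R * (1 / 4) ^ j) ^ s := by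
    rw [Real.mul_rpow hR.le h4.le, ← quarter_pow_rpow]
    have h2 : (((1 / 4 : ℝ)) ^ j) ^ s ≤ ((1 / 4 : ℝ) ^ j) ^ α :=
      Real.rpow_le_rpow_of_exponent_ge h4 (pow_le_one₀ (by norm_num) (by norm_num)) hαs
    calc ω / R ^ s = ω * ((1 / 4 : ℝ) ^ j) ^ s / (R ^ s * ((1 / 4) ^ j) ^ s) := by field_simp
      _ ≤ _ := by gcongr
  have h3 := hg.nonneg (by positivity : 0 ≤ ω / R ^ s)
  refine mul_le_mul (hg.mono h1) ?_ (by positivity) (h3.trans (hg.mono h1))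
  exact Real.rpow_le_rpow_of_nonpos (by positivity) hle (by linarith)

/-- **Oscillation decay** for functions with bounded fractional `g`-Laplacian. -/
theorem oscillation_decay {n : ℕ} (hn : 1 ≤ n) {s : ℝ} (hs0 : 0 < s) (hs : s < 1) (Lam : ℝ) :
    ∃ e : ℝ, 0 < e ∧ e ≤ 1 / 5 ∧ ∀ g : ℝ → ℝ, Regular Lam g →
      ∀ (R K ω : ℝ) (u : E n → ℝ), 0 < R → 0 < ω →
      IsWeakSubsolution s g (Metric.ball 0 R) (fun _ => K) u →
      IsWeakSubsolution s g (Metric.ball 0 R) (fun _ => K) (fun x => -u x) →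
      (∀ᵐ x, x ∈ Metric.ball (0 : E n) R → |u x| ≤ ω / 2) →
      Integrable (tailDensity s g R u) →
      ∫ y, tailDensity s g R u y ≤ e * (g (ω / (R / 2) ^ s) * (R / 2) ^ (-s)) →
      K ≤ e * (g (ω / (R / 2) ^ s) * (R / 2) ^ (-s)) →
      ∀ x₀ ∈ Metric.ball (0 : E n) (R / 2), ∀ j : ℕ, ∃ m M : ℝ,
        OscBound R (e * s / 32) ω x₀ u j m M := by
  have hv : 0 < volume.real (Metric.ball (0 : E n) 1) :=
    ENNReal.toReal_pos (Metric.measure_ball_pos _ _ one_pos).ne' measure_ball_lt_top.ne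
  obtain ⟨e, he0, he5, H⟩ := growth_lemma hn hs0 hs Lam
    (c₀ := volume.real (Metric.ball (0 : E n) 1) / 4) (by positivity)
  refine ⟨e, he0, he5, ?_⟩
  intro g hg R K ω u hR hω hu hu' hb htl htl2 hK x₀ hx₀ j
  set α := e * s / 32 with hα
  have hα0 : 0 ≤ α := by positivity
  have hαs : α ≤ s := by rw [hα]; nlinarith
  have hm : AEMeasurable u := hu.1.1.1
  induction j with
  | zero => exact ⟨_, _, OscBound.zero hα0 hω.le hR hx₀ hb⟩
  | succ j ih =>
    obtain ⟨m, M, h⟩ := ih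
    have hrp : 0 < R / 2 * (1 / 4) ^ j := by positivity
    have hrle : R / 2 * (1 / 4) ^ j ≤ R / 2 :=
      mul_le_of_le_one_right (by positivity) (pow_le_one₀ (by norm_num) (by norm_num))
    have hΓ := mul_le_mul_of_nonneg_left
      (density_scale_mono (R := R / 2) hg hs0 hαs (by positivity) hω.le j) he0.le
    have hωj : 0 < ω * ((1 / 4 : ℝ) ^ α) ^ j := by positivity
    have hd := h.diff
    -- Below the middle level $u$ is half an oscillation under $M$; above it, the same holds for
    -- $-u$ with respect to $-m$.
    obtain ⟨D, hDm, hD1, hD2, hD3, hD⟩ := exists_half_annulus hn x₀ hrp hm ((m + M) / 2)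
    have key : ∀ (w : E n → ℝ) (m M : ℝ), OscBound R α ω x₀ w j m M →
        IsWeakSubsolution s g (Metric.ball 0 R) (fun _ => K) w →
        (∀ᵐ x, x ∈ Metric.ball (0 : E n) R → |w x| ≤ ω / 2) →
        tailDensity s g R w = tailDensity s g R u →
        (∀ᵐ x, x ∈ D → w x ≤ M - ω * ((1 / 4 : ℝ) ^ α) ^ j / 2) →
        OscBound R α ω x₀ w (j + 1) m (m + ω * ((1 / 4 : ℝ) ^ α) ^ (j + 1)) := by
      intro w m M hw hws hwb hwt hwD
      refine hw.succ hα0 hs hs0 he0.le hα he5 hω.le hR ?_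
      refine H g hg R (R / 2 * (1 / 4) ^ j) K M (ω / 2) _ x₀ D w hrp hrle hx₀ hωj hws hwb ?_ ?_
        (hK.trans hΓ) hDm hD1 hD2 hD3
        (hw.growthAt hα0 hs0 hs he0.le hα he5 hω.le hR hx₀ hwD)
      · rw [hwt]; exact htl
      · rw [hwt]; exact htl2.trans hΓ
    rcases hD with hD | hD
    · exact ⟨_, _, key u m M h hu hb rfl (hD.mono fun x hx hxD => by linarith [hx hxD])⟩
    · exact ⟨_, _, (key _ _ _ h.neg hu' (by simpa only [abs_neg] using hb)
        (tailDensity_neg s g R u) (hD.mono fun x hx hxD => by linarith [hx hxD])).of_neg⟩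

/-! ### The Hölder representative -/

/-- A function whose essential oscillation decays geometrically has a Hölder representative. -/
theorem exists_holder_representative {n : ℕ} {R α ω : ℝ} (hR : 0 < R) (hω : 0 < ω)
    (hα0 : 0 < α) (hα1 : α ≤ 1) {u : E n → ℝ}
    (H : ∀ x₀ ∈ Metric.ball (0 : E n) (R / 2), ∀ j : ℕ, ∃ m M : ℝ, OscBound R α ω x₀ u j m M) :
    ∃ v : E n → ℝ, v =ᵐ[volume.restrict (Metric.ball 0 (R / 2))] u ∧
      ∀ x ∈ Metric.ball (0 : E n) (R / 2), ∀ y ∈ Metric.ball (0 : E n) (R / 2),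
        |v x - v y| ≤ 8 * ω * (‖x - y‖ / (R / 2)) ^ α := by
  have H' : ∀ (x₀ : E n) (j : ℕ), ∃ m M : ℝ, x₀ ∈ Metric.ball (0 : E n) (R / 2) →
      OscBound R α ω x₀ u j m M := by
    intro x₀ j
    by_cases h : x₀ ∈ Metric.ball (0 : E n) (R / 2)
    · obtain ⟨m, M, hm⟩ := H x₀ h j
      exact ⟨m, M, fun _ => hm⟩
    · exact ⟨0, 0, fun h' => absurd h' h⟩
  choose m M hmM using H'
  set rad : ℕ → ℝ := fun j => R / 2 * (1 / 4) ^ j with hrad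
  have hradpos : ∀ j, 0 < rad j := fun j => by positivity
  set θ := (1 / 4 : ℝ) ^ α with hθ
  have hθ0 : 0 < θ := by positivity
  have hθ1 : θ < 1 := Real.rpow_lt_one (by norm_num) (by norm_num) hα0
  -- Overlapping balls share a set of positive measure, on which almost every value of $u$ separates
  -- the two levels. This compares different centres and scales without evaluating $u$ at a point.
  have cross : ∀ x ∈ Metric.ball (0 : E n) (R / 2), ∀ y ∈ Metric.ball (0 : E n) (R / 2),
      ∀ j k, (Metric.ball x (rad j) ∩ Metric.ball y (rad k)).Nonempty → m x j ≤ M y k := by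
    intro x hx y hy j k hne
    by_contra hlt
    have h0 : volume (Metric.ball x (rad j) ∩ Metric.ball y (rad k)) = 0 := by
      rw [measure_eq_zero_iff_ae_notMem]
      filter_upwards [(hmM x j hx).inside, (hmM y k hy).inside] with z h1 h2 hz
      exact hlt ((h1 hz.1).1.trans (h2 hz.2).2)
    exact ((Metric.isOpen_ball.inter Metric.isOpen_ball).measure_pos volume hne).ne' h0
  have self : ∀ x ∈ Metric.ball (0 : E n) (R / 2), ∀ j k, m x j ≤ M x k := fun x hx j k =>
    cross x hx x hx j k ⟨x, Metric.mem_ball_self (hradpos j), Metric.mem_ball_self (hradpos k)⟩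
  set v : E n → ℝ := fun x => ⨆ j, m x j with hv
  have hv1 : ∀ x ∈ Metric.ball (0 : E n) (R / 2), ∀ j, m x j ≤ v x := fun x hx j =>
    le_ciSup (f := fun j => m x j) ⟨M x 0, by rintro _ ⟨k, rfl⟩; exact self x hx k 0⟩ j
  have hv2 : ∀ x ∈ Metric.ball (0 : E n) (R / 2), ∀ j, v x ≤ M x j := fun x hx j =>
    ciSup_le fun k => self x hx k j
  have hdiff : ∀ x ∈ Metric.ball (0 : E n) (R / 2), ∀ j, M x j - m x j = ω * θ ^ j :=
    fun x hx j => (hmM x j hx).diff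
  have close : ∀ x ∈ Metric.ball (0 : E n) (R / 2), ∀ y ∈ Metric.ball (0 : E n) (R / 2), ∀ j,
      ‖x - y‖ ≤ rad j → |v x - v y| ≤ 2 * (ω * θ ^ j) := by
    intro x hx y hy j hd
    have hmem : midpoint ℝ x y ∈ Metric.ball x (rad j) ∩ Metric.ball y (rad j) := by
      have := hradpos j
      constructor
      · rw [Metric.mem_ball, dist_midpoint_left, dist_eq_norm, Real.norm_two]; linarith
      · rw [Metric.mem_ball, dist_midpoint_right, dist_eq_norm, Real.norm_two]; linarith
    have c1 := cross x hx y hy j j ⟨_, hmem⟩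
    have c2 := cross y hy x hx j j ⟨_, hmem.2, hmem.1⟩
    have d1 := hdiff x hx j
    have d2 := hdiff y hy j
    have a1 := hv1 x hx j
    have a2 := hv2 x hx j
    have a3 := hv1 y hy j
    have a4 := hv2 y hy j
    rw [abs_le]
    constructor <;> linarith
  refine ⟨v, ?_, ?_⟩
  -- The exceptional null set depends on the centre, so only countably many centres may be used.
  · obtain ⟨S, hSc, hSd⟩ := TopologicalSpace.exists_countable_dense (E n)
    have hae : ∀ᵐ z : E n, ∀ q ∈ S, q ∈ Metric.ball (0 : E n) (R / 2) → ∀ j,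
        z ∈ Metric.ball q (rad j) → m q j ≤ u z ∧ u z ≤ M q j := by
      rw [ae_ball_iff hSc]
      intro q _
      by_cases hq : q ∈ Metric.ball (0 : E n) (R / 2)
      · have : ∀ᵐ z : E n, ∀ j, z ∈ Metric.ball q (rad j) → m q j ≤ u z ∧ u z ≤ M q j :=
          ae_all_iff.2 fun j => (hmM q j hq).inside
        exact this.mono fun z hz _ => hz
      · exact Eventually.of_forall fun z h => absurd h hq
    rw [EventuallyEq, ae_restrict_iff' measurableSet_ball]
    filter_upwards [hae] with z hz hzb
    have hlim : Tendsto (fun j : ℕ => 3 * (ω * θ ^ j)) atTop (𝓝 (3 * (ω * 0))) :=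
      ((tendsto_pow_atTop_nhds_zero_of_lt_one hθ0.le hθ1).const_mul ω).const_mul 3
    have hle : ∀ j, |v z - u z| ≤ 3 * (ω * θ ^ j) := by
      intro j
      obtain ⟨q, hq, hqS⟩ := hSd.inter_open_nonempty
        (Metric.ball (0 : E n) (R / 2) ∩ Metric.ball z (rad j))
        (Metric.isOpen_ball.inter Metric.isOpen_ball) ⟨z, hzb, Metric.mem_ball_self (hradpos j)⟩
      have hzq : z ∈ Metric.ball q (rad j) := by
        rw [Metric.mem_ball, dist_comm]; exact hq.2
      obtain ⟨b1, b2⟩ := hz q hqS hq.1 j hzq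
      have b3 := close z hzb q hq.1 j (by
        rw [Metric.mem_ball, dist_eq_norm] at hzq; exact hzq.le)
      have b4 := hv1 q hq.1 j
      have b5 := hv2 q hq.1 j
      have b6 := hdiff q hq.1 j
      rw [abs_le] at b3 ⊢
      constructor <;> linarith
    have h0 := ge_of_tendsto' hlim hle
    rw [mul_zero, mul_zero] at h0
    have := abs_nonpos_iff.1 h0
    linarith
  · intro x hx y hy
    rcases eq_or_ne x y with rfl | hxy
    · simp only [sub_self, abs_zero]; positivity
    have hd0 : 0 < ‖x - y‖ := norm_pos_iff.2 (sub_ne_zero.2 hxy)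
    have hR2 : 0 < R / 2 := by positivity
    rcases lt_or_ge ‖x - y‖ (R / 2) with hd | hd
    -- The scale $j$ has $4^{-j-1}<t\le4^{-j}$, so $4^{-\alpha j}\le(4t)^\alpha\le4t^\alpha$. With
    -- the factor $2$ from `close` this gives the constant $8$.
    · obtain ⟨j, hj1, hj2⟩ := exists_nat_pow_near_of_lt_one (x := ‖x - y‖ / (R / 2))
        (y := (1 / 4 : ℝ)) (by positivity) ((div_le_one hR2).2 hd.le) (by norm_num) (by norm_num)
      set t := ‖x - y‖ / (R / 2) with ht
      have ht0 : 0 < t := by positivity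
      have hclose := close x hx y hy j (by
        rw [ht, div_le_iff₀ hR2] at hj2
        simp only [hrad]; linarith)
      have h1 : θ ^ j ≤ 4 * t ^ α := by
        rw [hθ, ← quarter_pow_rpow]
        calc ((1 / 4 : ℝ) ^ j) ^ α ≤ (4 * t) ^ α := by
              gcongr
              rw [pow_succ] at hj1; linarith
          _ = 4 ^ α * t ^ α := Real.mul_rpow (by norm_num) ht0.le
          _ ≤ 4 * t ^ α := by
              gcongr
              simpa using Real.rpow_le_rpow_of_exponent_le (by norm_num : (1 : ℝ) ≤ 4) hα1
      have h2 := mul_le_mul_of_nonneg_left h1 hω.le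
      linarith
    · have h1 : |v x - v y| ≤ ω := by
        have a1 := hv1 x hx 0
        have a2 := hv2 x hx 0
        have a3 := hv1 y hy 0
        have a4 := hv2 y hy 0
        have b1 := (hmM x 0 hx).lower
        have b2 := (hmM x 0 hx).upper
        have b3 := (hmM y 0 hy).lower
        have b4 := (hmM y 0 hy).upper
        rw [abs_le]; constructor <;> linarith
      have h2 : 1 ≤ (‖x - y‖ / (R / 2)) ^ α :=
        Real.one_le_rpow ((one_le_div hR2).2 hd) hα0.le
      nlinarith

/-! ### Control of the $g$-tail by the power tails -/

theorem tail_rpow {n : ℕ} {s p R : ℝ} (hp : 0 < p) (u : E n → ℝ) :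
    tail s (p + 1) u R ^ p = ENNReal.ofReal (R ^ (s * (p + 1))) *
      ∫⁻ y in (Metric.ball (0 : E n) R)ᶜ,
        ENNReal.ofReal (|u y| ^ p / ‖y‖ ^ ((n : ℝ) + s * (p + 1))) := by
  unfold tail
  rw [add_sub_cancel_right, ← ENNReal.rpow_mul, one_div_mul_cancel hp.ne', ENNReal.rpow_one]

theorem tail_power_identity {n : ℕ} {s p R ω a t : ℝ} (hR : 0 < R) (hω : 0 < ω)
    (ha : 0 ≤ a) (ht : 0 < t) :
    1 / t ^ n * (1 / t ^ s) * (a * R ^ s / (ω * t ^ s)) ^ p =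
      R ^ (-s) * ω ^ (-p) * (R ^ (s * (p + 1)) * (a ^ p / t ^ ((n : ℝ) + s * (p + 1)))) := by
  have hts : 0 < t ^ s := by positivity
  have hRs : 0 < R ^ s := by positivity
  rw [Real.div_rpow (by positivity) (by positivity), Real.mul_rpow ha hRs.le,
    Real.mul_rpow hω.le hts.le, Real.rpow_add ht, Real.rpow_natCast, mul_add, mul_one,
    Real.rpow_add ht, Real.rpow_add hR, Real.rpow_mul ht.le, Real.rpow_mul hR.le,
    Real.rpow_neg hR.le, Real.rpow_neg hω.le]
  have h1 : 0 < (t ^ s) ^ p := by positivity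
  have h2 : 0 < ω ^ p := by positivity
  field_simp

/-- The integral is exactly $R^{-s}(\mathrm{Tail}_{p+1}/\omega)^p\le R^{-s}\tau^p$, and
$\tau^p\le\tau$ makes the bound linear in $\tau$ for both exponents. -/
theorem lintegral_tail_power_le {n : ℕ} {s p R ω τ : ℝ} (hp : 1 ≤ p) (hR : 0 < R)
    (hω : 0 < ω) (hτ0 : 0 ≤ τ) (hτ : τ ≤ 1) {u : E n → ℝ}
    (hT : tail s (p + 1) u R ≤ ENNReal.ofReal (τ * ω)) :
    ∫⁻ y in (Metric.ball (0 : E n) R)ᶜ, ENNReal.ofReal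
      (1 / ‖y‖ ^ n * (1 / ‖y‖ ^ s) * (|u y| * R ^ s / (ω * ‖y‖ ^ s)) ^ p) ≤
      ENNReal.ofReal (τ * R ^ (-s)) := by
  have hp0 : 0 < p := by linarith
  have h1 : ∫⁻ y in (Metric.ball (0 : E n) R)ᶜ, ENNReal.ofReal
      (1 / ‖y‖ ^ n * (1 / ‖y‖ ^ s) * (|u y| * R ^ s / (ω * ‖y‖ ^ s)) ^ p) =
      ENNReal.ofReal (R ^ (-s) * ω ^ (-p)) * tail s (p + 1) u R ^ p := by
    rw [tail_rpow hp0, ← lintegral_const_mul' _ _ ENNReal.ofReal_ne_top,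
      ← lintegral_const_mul' _ _ ENNReal.ofReal_ne_top]
    refine setLIntegral_congr_fun measurableSet_ball.compl fun y hy => ?_
    have hy0 : 0 < ‖y‖ := by
      rw [mem_compl_iff, Metric.mem_ball, dist_zero_right, not_lt] at hy
      linarith
    rw [tail_power_identity hR hω (abs_nonneg _) hy0, ENNReal.ofReal_mul (by positivity),
      ENNReal.ofReal_mul (by positivity : 0 ≤ R ^ (s * (p + 1)))]
  rw [h1]
  calc _ ≤ ENNReal.ofReal (R ^ (-s) * ω ^ (-p)) * ENNReal.ofReal (τ * ω) ^ p := by gcongr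
    _ = ENNReal.ofReal (R ^ (-s) * τ ^ p) := by
        rw [ENNReal.ofReal_rpow_of_nonneg (by positivity) hp0.le, ← ENNReal.ofReal_mul (by positivity),
          Real.mul_rpow hτ0 hω.le, Real.rpow_neg hω.le]
        congr 1
        have : 0 < ω ^ p := by positivity
        field_simp
    _ ≤ _ := by
        refine ENNReal.ofReal_le_ofReal ?_
        rw [mul_comm]
        gcongr
        rcases hτ0.eq_or_lt with rfl | h
        · rw [Real.zero_rpow hp0.ne']
        · simpa using Real.rpow_le_rpow_of_exponent_ge h hτ hp

/-- The nonlocal tails control the `g`-tail. -/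
theorem tailDensity_bound {n : ℕ} {s lam Lam R ω τ : ℝ} {g : ℝ → ℝ} (hlam : 1 < lam)
    (hLam : lam ≤ Lam) (hg : IsAdmissible lam Lam g) (hR : 0 < R) (hω : 0 < ω)
    (hτ0 : 0 ≤ τ) (hτ : τ ≤ 1) {u : E n → ℝ} (hu : AEMeasurable u)
    (hT1 : tail s (lam + 1) u R ≤ ENNReal.ofReal (τ * ω))
    (hT2 : tail s (Lam + 1) u R ≤ ENNReal.ofReal (τ * ω)) :
    Integrable (tailDensity s g R u) ∧
      ∫ y, tailDensity s g R u y ≤ 2 * τ * (g (ω / R ^ s) * R ^ (-s)) := by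
  have hr := hg.regular hlam
  have hRs : 0 < R ^ s := by positivity
  have ht0 : 0 ≤ ω / R ^ s := by positivity
  have hgt := hr.nonneg ht0
  have hm : AEStronglyMeasurable (tailDensity s g R u) volume := by
    have h1 : AEMeasurable (fun y : E n => 1 / ‖y‖ ^ n * (1 / ‖y‖ ^ s) * g (|u y| / ‖y‖ ^ s)) := by
      have h2 : Measurable (fun y : E n => 1 / ‖y‖ ^ n * (1 / ‖y‖ ^ s)) := by fun_prop
      have h3 : Measurable (fun y : E n => ‖y‖ ^ s) := by fun_prop
      exact h2.aemeasurable.mul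
        (hr.measurable.comp_aemeasurable ((measurable_norm.comp_aemeasurable hu).div h3.aemeasurable))
    exact (h1.indicator measurableSet_ball.compl).aestronglyMeasurable
  have hnn : 0 ≤ᵐ[volume] tailDensity s g R u :=
    Eventually.of_forall fun y => tailDensity_nonneg hr R u y
  have hmain : ∫⁻ y, ENNReal.ofReal (tailDensity s g R u y) ≤
      ENNReal.ofReal (2 * τ * (g (ω / R ^ s) * R ^ (-s))) := by
    have e1 : ∀ y, ENNReal.ofReal (tailDensity s g R u y) =
        (Metric.ball (0 : E n) R)ᶜ.indicator (fun y => ENNReal.ofReal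
          (1 / ‖y‖ ^ n * (1 / ‖y‖ ^ s) * g (|u y| / ‖y‖ ^ s))) y := by
      intro y
      unfold tailDensity
      by_cases hy : y ∈ (Metric.ball (0 : E n) R)ᶜ
      · rw [indicator_of_mem hy, indicator_of_mem hy]
      · rw [indicator_of_notMem hy, indicator_of_notMem hy, ENNReal.ofReal_zero]
    simp_rw [e1]
    rw [lintegral_indicator measurableSet_ball.compl]
    have hae : AEMeasurable (fun y : E n => ENNReal.ofReal
        (1 / ‖y‖ ^ n * (1 / ‖y‖ ^ s) * (|u y| * R ^ s / (ω * ‖y‖ ^ s)) ^ lam))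
        (volume.restrict (Metric.ball (0 : E n) R)ᶜ) := by
      have h2 : Measurable (fun y : E n => 1 / ‖y‖ ^ n * (1 / ‖y‖ ^ s)) := by fun_prop
      have h3 : Measurable (fun y : E n => ω * ‖y‖ ^ s) := by fun_prop
      exact (h2.aemeasurable.mul ((((measurable_norm.comp_aemeasurable hu).mul_const _).div
        h3.aemeasurable).pow_const lam)).ennreal_ofReal.restrict
    calc ∫⁻ y in (Metric.ball (0 : E n) R)ᶜ, ENNReal.ofReal
          (1 / ‖y‖ ^ n * (1 / ‖y‖ ^ s) * g (|u y| / ‖y‖ ^ s))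
        ≤ ∫⁻ y in (Metric.ball (0 : E n) R)ᶜ, ENNReal.ofReal (g (ω / R ^ s)) * (ENNReal.ofReal
            (1 / ‖y‖ ^ n * (1 / ‖y‖ ^ s) * (|u y| * R ^ s / (ω * ‖y‖ ^ s)) ^ lam) + ENNReal.ofReal
            (1 / ‖y‖ ^ n * (1 / ‖y‖ ^ s) * (|u y| * R ^ s / (ω * ‖y‖ ^ s)) ^ Lam)) := by
          refine setLIntegral_mono' measurableSet_ball.compl fun y hy => ?_
          have hy0 : 0 < ‖y‖ := by
            rw [mem_compl_iff, Metric.mem_ball, dist_zero_right, not_lt] at hy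
            linarith
          rw [← ENNReal.ofReal_add (by positivity) (by positivity), ← ENNReal.ofReal_mul hgt]
          refine ENNReal.ofReal_le_ofReal ?_
          have hys : 0 < ‖y‖ ^ s := by positivity
          -- This $b$ is the ratio of $|u(y)|/|y|^s$ to the reference slope $\omega/R^s$, so
          -- $g(\omega/R^s)$ factors out.
          have h := hg.le_add_rpow_mul hlam (b := |u y| * R ^ s / (ω * ‖y‖ ^ s)) (by positivity) ht0
          rw [show |u y| * R ^ s / (ω * ‖y‖ ^ s) * (ω / R ^ s) = |u y| / ‖y‖ ^ s by
            field_simp] at h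
          calc _ ≤ 1 / ‖y‖ ^ n * (1 / ‖y‖ ^ s) * (((|u y| * R ^ s / (ω * ‖y‖ ^ s)) ^ lam +
                (|u y| * R ^ s / (ω * ‖y‖ ^ s)) ^ Lam) * g (ω / R ^ s)) := by gcongr
            _ = _ := by ring
      _ ≤ ENNReal.ofReal (g (ω / R ^ s)) *
            (ENNReal.ofReal (τ * R ^ (-s)) + ENNReal.ofReal (τ * R ^ (-s))) := by
          rw [lintegral_const_mul' _ _ ENNReal.ofReal_ne_top, lintegral_add_left' hae]
          gcongr
          · exact lintegral_tail_power_le hlam.le hR hω hτ0 hτ hT1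
          · exact lintegral_tail_power_le (hlam.le.trans hLam) hR hω hτ0 hτ hT2
      _ = _ := by
          rw [← ENNReal.ofReal_add (by positivity) (by positivity), ← ENNReal.ofReal_mul hgt]
          congr 1; ring
  refine ⟨⟨hm, ?_⟩, ?_⟩
  · rw [hasFiniteIntegral_iff_ofReal hnn]
    exact hmain.trans_lt ENNReal.ofReal_lt_top
  · rw [integral_eq_lintegral_of_nonneg_ae hnn hm]
    exact ENNReal.toReal_le_of_le_ofReal (by positivity) hmain

/-! ### The interior estimate -/

theorem holderSeminorm_le {n : ℕ} {α B : ℝ} {A : Set (E n)} {v : E n → ℝ}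
    (h : ∀ x ∈ A, ∀ y ∈ A, |v x - v y| ≤ B * ‖x - y‖ ^ α) :
    holderSeminorm α A v ≤ ENNReal.ofReal B := by
  refine iSup₂_le fun x hx => iSup₂_le fun y hy => iSup_le fun hxy => ?_
  refine ENNReal.ofReal_le_ofReal ?_
  have : 0 < ‖x - y‖ := norm_pos_iff.2 (sub_ne_zero.2 hxy)
  rw [div_le_iff₀ (by positivity)]
  exact h x hx y hy

/-- Interior Hölder estimate with all quantities finite and the amplitude positive. -/
theorem interior_estimate {n : ℕ} (hn : 1 ≤ n) {s : ℝ} (hs0 : 0 < s) (hs : s < 1)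
    {lam Lam : ℝ} (hlam : 1 < lam) (hLam : lam ≤ Lam) :
    ∃ e : ℝ, 0 < e ∧ e ≤ 1 / 5 ∧ ∀ g : ℝ → ℝ, IsAdmissible lam Lam g →
      ∀ (R K N T₁ T₂ : ℝ) (u : E n → ℝ), 0 < R → R < 1 → 0 ≤ K → 0 < N → 0 ≤ T₁ → 0 ≤ T₂ →
      WeaklyBounded s g (Metric.ball 0 R) K u →
      (∀ᵐ x, x ∈ Metric.ball (0 : E n) R → |u x| ≤ N) →
      tail s (lam + 1) u R ≤ ENNReal.ofReal T₁ →
      tail s (Lam + 1) u R ≤ ENNReal.ofReal T₂ →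
      ∃ v : E n → ℝ, v =ᵐ[volume.restrict (Metric.ball 0 (R / 2))] u ∧
        holderSeminorm (e * s / 32) (Metric.ball 0 (R / 2)) v ≤
          ENNReal.ofReal (32 / e * (R ^ (s - e * s / 32) * gInv g K + R ^ (-s) * (N + T₂ + T₁))) := by
  obtain ⟨e, he0, he5, H⟩ := oscillation_decay hn hs0 hs Lam
  refine ⟨e, he0, he5, ?_⟩
  intro g hg R K N T₁ T₂ u hR hR1 hK hN hT₁ hT₂ hu hbd ht₁ ht₂
  have hr := hg.regular hlam
  obtain ⟨hk0, hkK⟩ := hg.gInv_spec hK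
  set k := gInv g K with hk
  set α := e * s / 32 with hα
  have hα0 : 0 < α := by positivity
  have hαs : α ≤ s := by rw [hα]; nlinarith
  have hRs : 0 < R ^ s := by positivity
  -- Chosen so that $\frac e2\omega$ dominates every datum. The tails then fit with $\tau=e/2$, and
  -- $g^{-1}(K)\le e\,\omega/R^s$ gives the smallness of $K$.
  set ω := 2 / e * (N + T₂ + T₁ + R ^ s * k) with hω
  have hω0 : 0 < ω := by positivity
  have heω : e / 2 * ω = N + T₂ + T₁ + R ^ s * k := by rw [hω]; field_simp
  have hRk : 0 ≤ R ^ s * k := by positivity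
  have hNω : N ≤ ω / 2 := by nlinarith
  have hT₁ω : T₁ ≤ e / 2 * ω := by linarith
  have hT₂ω : T₂ ≤ e / 2 * ω := by linarith
  obtain ⟨htl, htl2⟩ := tailDensity_bound (s := s) (τ := e / 2) hlam hLam hg hR hω0 (by positivity)
    (by linarith) hu.1.1.1.1 (ht₁.trans (ENNReal.ofReal_le_ofReal hT₁ω))
    (ht₂.trans (ENNReal.ofReal_le_ofReal hT₂ω))
  have ht0 : 0 ≤ ω / R ^ s := by positivity
  have hgt := hr.nonneg ht0
  have hR2 : 0 < R / 2 := by positivity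
  have hscale : g (ω / R ^ s) * R ^ (-s) ≤ g (ω / (R / 2) ^ s) * (R / 2) ^ (-s) := by
    refine mul_le_mul (hr.mono ?_) ?_ (by positivity) (hr.nonneg (by positivity))
    · gcongr; linarith
    · exact Real.rpow_le_rpow_of_nonpos hR2 (by linarith) (by linarith)
  -- Here $R<1$ is used, and again at the end to replace $R^{-\alpha}$ by $R^{-s}$.
  have hRneg : 1 ≤ R ^ (-s) := Real.one_le_rpow_of_pos_of_le_one_of_nonpos hR hR1.le (by linarith)
  have hKω : K ≤ e * (g (ω / R ^ s) * R ^ (-s)) := by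
    have h1 : k ≤ e * (ω / R ^ s) := by
      rw [← mul_div_assoc, le_div_iff₀ hRs]; linarith
    calc K = g k := hkK.symm
      _ ≤ g (e * (ω / R ^ s)) := hr.mono h1
      _ ≤ e * g (ω / R ^ s) := hr.sub _ _ he0.le (by linarith) ht0
      _ ≤ e * (g (ω / R ^ s) * R ^ (-s)) := by
          gcongr; exact le_mul_of_one_le_right hgt hRneg
  have hosc := H g hr R K ω u hR hω0 hu.1
    (by have h2 := hu.2
        unfold IsWeakSupersolution at h2
        simpa only [neg_neg] using h2)
    (hbd.mono fun x hx hb => (hx hb).trans hNω) htl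
    (htl2.trans (by
      have := mul_le_mul_of_nonneg_left hscale he0.le
      linarith))
    (hKω.trans (mul_le_mul_of_nonneg_left hscale he0.le))
  obtain ⟨v, hv, hvh⟩ := exists_holder_representative hR hω0 hα0 (by linarith) hosc
  refine ⟨v, hv, (holderSeminorm_le (B := 8 * ω * (1 / (R / 2) ^ α)) fun x hx y hy => ?_).trans
    (ENNReal.ofReal_le_ofReal ?_)⟩
  · have := hvh x hx y hy
    rw [Real.div_rpow (norm_nonneg _) hR2.le] at this
    calc _ ≤ _ := this
      _ = _ := by ring
  · have hRα : 0 < R ^ α := by positivity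
    have h1 : 1 / (R / 2) ^ α ≤ 2 * R ^ (-α) := by
      rw [Real.rpow_neg hR.le]
      have := (kernel_le (s := α) (c := 2) (q := R) (d := R / 2) n hα0 (by linarith)
        (by norm_num) hR le_rfl).1
      rwa [one_div (R ^ α)] at this
    have h2 : R ^ (-α) ≤ R ^ (-s) := Real.rpow_le_rpow_of_exponent_ge hR hR1.le (by linarith)
    have h3 : R ^ (s - α) = R ^ s * R ^ (-α) := by rw [sub_eq_add_neg, Real.rpow_add hR]
    calc 8 * ω * (1 / (R / 2) ^ α) ≤ 8 * ω * (2 * R ^ (-α)) := by gcongr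
      _ = 32 / e * (R ^ s * R ^ (-α) * k + R ^ (-α) * (N + T₂ + T₁)) := by rw [hω]; ring
      _ ≤ 32 / e * (R ^ (s - α) * k + R ^ (-s) * (N + T₂ + T₁)) := by rw [h3]; gcongr

end FracG

theorem corollary3p6 (lam Lam : ℝ) (hlam : 1 < lam) (hLam : lam ≤ Lam) :
    ∃ β : ℝ, 0 < β ∧
      ∀ (n : ℕ) (s : ℝ), 1 ≤ n → 0 < s → s < 1 →
        ∃ α C : ℝ, 0 < α ∧ α < 1 ∧ 0 < C ∧
          ∀ (g : ℝ → ℝ), FracG.IsAdmissible lam Lam g →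
          ∀ (R₀ K : ℝ), 0 < R₀ → R₀ < 1 → 0 ≤ K →
          ∀ (u : FracG.E n → ℝ),
            FracG.MemWtilde s g (Metric.ball 0 R₀) u →
            MemLp u ∞ (volume.restrict (Metric.ball 0 R₀)) →
            FracG.WeaklyBounded s g (Metric.ball 0 R₀) K u →
            FracG.tail s (Lam + 1) u R₀ < ∞ →
            ∃ v : FracG.E n → ℝ,
              v =ᵐ[volume.restrict (Metric.ball 0 (R₀ / 2))] u ∧
              FracG.holderSeminorm α (Metric.ball 0 (R₀ / 2)) v ≤
                ENNReal.ofReal C *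
                  (ENNReal.ofReal (R₀ ^ (s - α) * FracG.gInv g K) +
                    ENNReal.ofReal (R₀ ^ (-s)) * FracG.Q s lam Lam β u R₀) := by
  -- The initial amplitude is linear in the supremum and the tails, hence $\beta=1$.
  refine ⟨1, one_pos, fun n s hn hs0 hs => ?_⟩
  obtain ⟨e, he0, he5, H⟩ := FracG.interior_estimate hn hs0 hs hlam hLam
  refine ⟨e * s / 32, 32 / e, by positivity, by nlinarith, by positivity, ?_⟩
  intro g hg R K hR hR1 hK u _ hub hw htail
  have hC : ENNReal.ofReal (32 / e) ≠ 0 := by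
    rw [Ne, ENNReal.ofReal_eq_zero, not_le]; positivity
  have hRs : ENNReal.ofReal (R ^ (-s)) ≠ 0 := by
    rw [Ne, ENNReal.ofReal_eq_zero, not_le]; positivity
  -- Finiteness is assumed only for the tail with exponent $p^+$; if the other one is infinite, so
  -- is the right-hand side.
  by_cases htop : FracG.tail s (lam + 1) u R = ∞
  · refine ⟨u, EventuallyEq.rfl, ?_⟩
    have : FracG.Q s lam Lam 1 u R = ∞ := by
      unfold FracG.Q
      rw [ENNReal.rpow_one, htop, add_top]
    rw [this, ENNReal.mul_top hRs, add_top, ENNReal.mul_top hC]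
    exact le_top
  have hbd : ∀ᵐ x, x ∈ Metric.ball (0 : FracG.E n) R →
      |u x| ≤ (eLpNorm u ∞ (volume.restrict (Metric.ball 0 R))).toReal := by
    rw [← ae_restrict_iff' measurableSet_ball]
    have h1 := ae_le_eLpNormEssSup (f := u) (μ := volume.restrict (Metric.ball 0 R))
    filter_upwards [h1] with x hx
    rw [← eLpNorm_exponent_top] at hx
    have := ENNReal.toReal_mono hub.2.ne hx
    simpa using this
  set N := (eLpNorm u ∞ (volume.restrict (Metric.ball 0 R))).toReal with hN
  have hN0 : 0 ≤ N := ENNReal.toReal_nonneg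
  -- A positive amplitude is needed for the iteration; if $N=0$, then $u$ vanishes almost everywhere
  -- in the ball.
  rcases hN0.eq_or_lt with hz | hpos
  · refine ⟨fun _ => 0, ?_, ?_⟩
    · rw [EventuallyEq, ae_restrict_iff' measurableSet_ball]
      filter_upwards [hbd] with x hx hxb
      have := hx (Metric.ball_subset_ball (by linarith) hxb)
      rw [← hz] at this
      exact (abs_nonpos_iff.1 this).symm
    · refine (FracG.holderSeminorm_le (B := 0) fun x _ y _ => by simp).trans ?_
      rw [ENNReal.ofReal_zero]
      exact zero_le
  obtain ⟨v, hv, hvh⟩ := H g hg R K N _ _ u hR hR1 hK hpos ENNReal.toReal_nonneg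
    ENNReal.toReal_nonneg hw hbd (ENNReal.ofReal_toReal htop).ge (ENNReal.ofReal_toReal htail.ne).ge
  refine ⟨v, hv, hvh.trans_eq ?_⟩
  have hk := (hg.gInv_spec hK).1
  have hQ : FracG.Q s lam Lam 1 u R = ENNReal.ofReal
      (N + (FracG.tail s (Lam + 1) u R).toReal + (FracG.tail s (lam + 1) u R).toReal) := by
    unfold FracG.Q
    rw [ENNReal.rpow_one, ENNReal.ofReal_add (by positivity) ENNReal.toReal_nonneg,
      ENNReal.ofReal_add hN0 ENNReal.toReal_nonneg, ENNReal.ofReal_toReal htop,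
      ENNReal.ofReal_toReal htail.ne, hN, ENNReal.ofReal_toReal hub.2.ne]
  rw [hQ, ← ENNReal.ofReal_mul (by positivity), ← ENNReal.ofReal_add (by positivity) (by positivity),
    ← ENNReal.ofReal_mul (by positivity)]
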